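/- Let $k,A,T>0$ and $M_1,M_2\ge 0$. Then there is a constant $C(T)>0$, depending only on $k$, $A$, $T$, $M_1$ and $M_2$, with the following property. Let $\beta,B>0$, and let $K$ be a measurable, non-negative, symmetric function on $(0,\infty)^2$ with $$K(v_1,v_2)\le\begin{cases}k(v_1v_2)^{-\beta}, & (v_1,v_2)\in(0,1)^2,\\ k\,v_2v_1^{-\beta}, & (v_1,v_2)\in(0,1)\times(1,\infty),\\ k(v_1+v_2), & (v_1,v_2)\in(1,\infty)^2.\end{cases}$$ Let $g$ be a non-negative continuous function on $[0,\infty)^2$, with $g(t,0)=0$ for all $t\ge 0$, such that $v\mapsto g(t,v)$ is twice differentiable with $|\partial_v g(t,v)|<A$ and $|\partial_v^2 g(t,v)|<B$ for all $t\ge0$ and $v>0$. For $m,r\in\mathbb{R}$ write $L^1_{m,r}=L^1\big(0,\infty;(v^m+v^r)\,dv\big)$, with its norm. For an initial condition $c_0$, a weak solution on $[0,T]$ of $$\partial_t c(t,v)+\partial_v(gc)(t,v)=\frac12\int_0^{v}K(v-v_2,v_2)c(t,v-v_2)c(t,v_2)\,dv_2-\int_0^\infty K(v,v_2)c(t,v)c(t,v_2)\,dv_2,\qquad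 c(0,\cdot)=c_0,$$ is a non-negative function $c$ that is continuous from $[0,T]$ to $L^1_{-\beta,1}$ with its weak topology and satisfies, for all $t\in[0,T]$ and $\phi\in W^{1,\infty}(0,\infty)$, $$\begin{aligned}\int_0^\infty c(t,v)\phi(v)\,dv&=\int_0^\infty c_0(v)\phi(v)\,dv+\int_0^t\int_0^\infty\phi'(v)g(s,v)c(s,v)\,dv\,ds\\&\quad+\frac12\int_0^t\int_0^\infty\int_0^\infty\big[\phi(v_1+v_2)-\phi(v_1)-\phi(v_2)\big]K(v_1,v_2)c(s,v_2)c(s,v_1)\,dv_1\,dv_2\,ds.\end{aligned}$$ Let $c_{1,0}$ and $c_{2,0}$ be non-negative functions in $L^1_{-2\beta,2}$, and let $c_1$ and $c_2$ be weak solutions on $[0,T]$ with initial conditions $c_{1,0}$ and $c_{2,0}$, respectively, such that $c_i\in L^\infty(0,T;L^1_{-2\beta,2})$ with norm at most $M_i$ for $i=1,2$. Then $$\|c_1(t)-c_2(t)\|_{L^1_{-\beta,1}}\le C(T)\,\|c_{1,0}-c_{2,0}\|_{L^1_{-\beta,1}}\qquad\text{for all } t\in[0,T].$$ -/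

import Mathlib

open MeasureTheory Set
open scoped ENNReal NNReal ContDiff

namespace GrowthCoag

/-- Lebesgue measure on `(0,∞)`. -/
noncomputable abbrev vol : Measure ℝ := volume.restrict (Ioi 0)

/-- The weight `v ^ m + v ^ r` on `(0,∞)`, for real exponents `m` and `r`. -/
noncomputable def weight (m r v : ℝ) : ℝ := v ^ m + v ^ r

/-- `u` belongs to `L¹_{m,r}(0,∞) = L¹(0,∞; (v ^ m + v ^ r) dv)`.  As the weight is positive on
`(0,∞)`, this contains the a.e. measurability of `u` on `(0,∞)`. -/
def MemWeightedL1 (m r : ℝ) (u : ℝ → ℝ) : Prop :=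
  Integrable (fun v => weight m r v * u v) vol

/-- The norm `∫_0^∞ (v ^ m + v ^ r) |u(v)| dv` of `L¹_{m,r}(0,∞)`, with values in `[0,∞]`. -/
noncomputable def weightedNorm (m r : ℝ) (u : ℝ → ℝ) : ℝ≥0∞ :=
  ∫⁻ v, ‖weight m r v * u v‖ₑ ∂vol

/-- The norm of `L^∞(0,T; L¹_{m,r}(0,∞))`: the essential supremum over `t ∈ (0,T)` of the
`L¹_{m,r}`-norm of `c(t)`, with values in `[0,∞]`. -/
noncomputable def linftyNorm (T m r : ℝ) (c : ℝ → ℝ → ℝ) : ℝ≥0∞ :=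
  essSup (fun t => weightedNorm m r (c t)) (volume.restrict (Ioo 0 T))

/-- The assumptions on the coagulation kernel `K` on `(0,∞)²`, with exponent `β` and constant `k`:
it is measurable, non-negative, symmetric and bounded as indicated. -/
structure IsCoagulationKernel (K : ℝ → ℝ → ℝ) (β k : ℝ) : Prop where
  aemeasurable : AEMeasurable (Function.uncurry K) (volume.restrict (Ioi 0 ×ˢ Ioi 0))
  nonneg : ∀ v₁ > 0, ∀ v₂ > 0, 0 ≤ K v₁ v₂
  symm : ∀ v₁ > 0, ∀ v₂ > 0, K v₁ v₂ = K v₂ v₁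
  le_small_small : ∀ v₁ ∈ Ioo (0 : ℝ) 1, ∀ v₂ ∈ Ioo (0 : ℝ) 1, K v₁ v₂ ≤ k * (v₁ * v₂) ^ (-β)
  le_small_large : ∀ v₁ ∈ Ioo (0 : ℝ) 1, ∀ v₂ ∈ Ioi (1 : ℝ), K v₁ v₂ ≤ k * v₂ * v₁ ^ (-β)
  le_large_large : ∀ v₁ ∈ Ioi (1 : ℝ), ∀ v₂ ∈ Ioi (1 : ℝ), K v₁ v₂ ≤ k * (v₁ + v₂)

/-- The assumptions on the growth rate `g(t,v)`: it is continuous and non-negative on `[0,∞)²`,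
vanishes at `v = 0`, and is twice differentiable with respect to `v`, with first derivative smaller
than `A` and second derivative smaller than `B` in absolute value. Nothing is asked about the
derivatives at the endpoint `v = 0`. -/
structure IsGrowthRate (g : ℝ → ℝ → ℝ) (A B : ℝ) : Prop where
  continuousOn : ContinuousOn (Function.uncurry g) (Ici 0 ×ˢ Ici 0)
  nonneg : ∀ t ≥ 0, ∀ v ≥ 0, 0 ≤ g t v
  zero : ∀ t ≥ 0, g t 0 = 0
  differentiableAt : ∀ t ≥ 0, ∀ v > 0, DifferentiableAt ℝ (g t) v
  abs_deriv_lt : ∀ t ≥ 0, ∀ v > 0, |deriv (g t) v| < A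
  differentiableAt_deriv : ∀ t ≥ 0, ∀ v > 0, DifferentiableAt ℝ (deriv (g t)) v
  abs_deriv_deriv_lt : ∀ t ≥ 0, ∀ v > 0, |deriv (deriv (g t)) v| < B

/-- `φ` belongs to `W^{1,∞}(0,∞)` and `φ'` is its weak derivative. -/
structure IsW1Infty (φ φ' : ℝ → ℝ) : Prop where
  memLp : MemLp φ ∞ vol
  memLp_deriv : MemLp φ' ∞ vol
  weak_deriv : ∀ η : ℝ → ℝ, ContDiff ℝ ∞ η → HasCompactSupport η → tsupport η ⊆ Ioi 0 →
    (∫ v, φ v * deriv η v ∂vol) = - (∫ v, φ' v * η v ∂vol)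

/-- `c` belongs to `C([0,T]; w-L¹_{m,r}(0,∞))`: each `c(t)` is in `L¹_{m,r}(0,∞)`, and the pairing
of `c(t)` with every element `ψ ∈ L^∞(0,∞)` of the dual space is continuous in `t ∈ [0,T]`. -/
structure IsWeaklyContinuous (T m r : ℝ) (c : ℝ → ℝ → ℝ) : Prop where
  mem : ∀ t ∈ Icc 0 T, MemWeightedL1 m r (c t)
  continuousOn : ∀ ψ : ℝ → ℝ, MemLp ψ ∞ vol →
    ContinuousOn (fun t => ∫ v, ψ v * (weight m r v * c t v) ∂vol) (Icc 0 T)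

/-- `c` is a weak solution on `[0,T]` of the growth-coagulation equation
`∂ₜ c + ∂ᵥ (g c) = Q(c)` with kernel `K`, growth rate `g` and initial condition `c₀`. -/
structure IsWeakSolution (K g : ℝ → ℝ → ℝ) (β T : ℝ) (c₀ : ℝ → ℝ) (c : ℝ → ℝ → ℝ) : Prop where
  nonneg : ∀ t ∈ Icc 0 T, ∀ᵐ v ∂vol, 0 ≤ c t v
  weaklyContinuous : IsWeaklyContinuous T (-β) 1 c
  weak_formulation : ∀ t ∈ Icc 0 T, ∀ φ φ' : ℝ → ℝ, IsW1Infty φ φ' →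
    (∫ v, c t v * φ v ∂vol) =
      (∫ v, c₀ v * φ v ∂vol)
      + (∫ s in (0 : ℝ)..t, (∫ v, φ' v * g s v * c s v ∂vol))
      + 1 / 2 * (∫ s in (0 : ℝ)..t, (∫ v₂, (∫ v₁,
          (φ (v₁ + v₂) - φ v₁ - φ v₂) * K v₁ v₂ * c s v₂ * c s v₁ ∂vol) ∂vol))

end GrowthCoag

namespace GrowthCoag
open Filter Topology

/-! Put `u = c₁ - c₂` and `p = c₁ + c₂`. Because `K` is symmetric, the quadratic coagulation term
polarises, and `u` solves the linear equation `∂ₜ u + ∂ᵥ (g u) = gain - crossLoss - lossRate * u`,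
whose coefficients depend on `p ≥ 0` (`isTransportSolution_sub`). Formally, one multiplies by `W(v)
sign u`, integrates, and applies Gronwall. Write `w(v) = v ^ (-β) + v` and take `W ≤ w`.

Transport contributes `∫ W' g |u| ≤ A ∫ W |u|`, because `g(s,v) ≤ A v` and `v W'(v) ≤ W(v)`
(`neg_integral_weight_sign_mul_deriv_le`). Collisions contribute at most `½ ∬ K(x,y) p(y) |u(x)|
(W(x+y) + W(y) - W(x))`. Subadditivity of `W` bounds the bracket by `2 W(y)`: the term `W(x)`, which
would require a second moment of `u`, is cancelled by the loss of `u`. With `K(x,y) ≤ 2k w(x) w(y)`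
there remains `2k ∫ w |u| ∫ w² p` (`integral_weight_coagulation_le`). Since `w² ≤ 2 (v ^ (-2β) + v ^
2)`, the last factor is at most `2 (M₁ + M₂)`, which gives an exponential constant free of `β` and
`B`.

Multiplication by `sign u` is not allowed for a weak solution, so the equation is first mollified in
`v`, as in the DiPerna–Lions theory. The chain rule for `|·|` then holds in time for each fixed `v`,
and the transport term produces a commutator which tends to `0` in `L¹`. The bound `B` on the second
derivative of `g` enters only there, through an error of order `B ε`. The limit is Kato's inequality
(`kato_inequality`), valid for bounded weights. It is applied to the weights `approxWeight β δ`, and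
`δ → 0` is taken before Gronwall.

Two reductions make this meaningful: a weakly continuous family has a jointly measurable version,
obtained by differentiating its distribution functions, and `K` is replaced by an a.e. equal kernel
that is measurable, symmetric and dominated everywhere. -/

/-! ### The sign function and the chain rule for the absolute value -/

theorem measurable_real_sign : Measurable Real.sign := by
  have : Real.sign = fun r : ℝ => if r < 0 then (-1 : ℝ) else if 0 < r then 1 else 0 := by
    ext r; rfl
  rw [this]
  exact Measurable.ite measurableSet_Iio measurable_const
    (Measurable.ite measurableSet_Ioi measurable_const measurable_const)

theorem abs_sign_le_one (r : ℝ) : |Real.sign r| ≤ 1 := by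
  rcases Real.sign_apply_eq r with h | h | h <;> simp [h]

theorem sign_mul_self_eq_abs (r : ℝ) : Real.sign r * r = |r| := by
  rcases lt_trichotomy r 0 with h | h | h
  · simp [Real.sign_of_neg h, abs_of_neg h]
  · simp [h]
  · simp [Real.sign_of_pos h, abs_of_pos h]

/-- The chain rule for the absolute value of an indefinite integral. -/
theorem abs_sub_abs_eq_integral_sign {U H : ℝ → ℝ} {a b : ℝ} (hab : a ≤ b)
    (hH : IntervalIntegrable H volume a b)
    (hU : ∀ x ∈ Icc a b, U x = U a + ∫ y in a..x, H y) :
    |U b| - |U a| = ∫ y in a..b, Real.sign (U y) * H y := by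
  set V : ℝ → ℝ := fun x => U a + ∫ y in a..x, H y with hV
  have hac : AbsolutelyContinuousOnInterval (fun x => ∫ y in a..x, H y) a b :=
    hH.absolutelyContinuousOnInterval_intervalIntegral left_mem_uIcc
  -- Composition with `|·|` does not increase increments, so `|V|` inherits absolute continuity and
  -- is the integral of its a.e. derivative.
  have hacV : AbsolutelyContinuousOnInterval (fun x => |V x|) a b := by
    refine squeeze_zero' (Eventually.of_forall fun E => Finset.sum_nonneg fun _ _ => dist_nonneg)
      (Eventually.of_forall fun E => Finset.sum_le_sum fun i _ => ?_) hac
    simp only [Real.dist_eq, hV]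
    refine (abs_abs_sub_abs_le_abs_sub _ _).trans (le_of_eq ?_)
    congr 1; ring
  have h1 := hacV.integral_deriv_eq_sub
  have e1 : V b = U b := (hU b ⟨hab, le_rfl⟩).symm
  have e2 : V a = U a := by simp [hV]
  rw [e1, e2] at h1
  rw [← h1]
  have hsub : ∀ x ∈ uIcc a b, V x = U x := fun x hx => by
    rw [uIcc_of_le hab] at hx; exact (hU x hx).symm
  refine intervalIntegral.integral_congr_ae ?_
  filter_upwards [hH.ae_hasDerivAt_integral, hacV.ae_differentiableAt] with x hx hx' hxm
  have hxu : x ∈ uIcc a b := uIoc_subset_uIcc hxm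
  have hd : HasDerivAt V (H x) x := (hx hxu a left_mem_uIcc).const_add (U a)
  rw [← hsub x hxu]
  -- At a zero of `V` the function `|V|` has a minimum, so its derivative, where it exists, is `0`.
  -- This matches `Real.sign 0 = 0`.
  by_cases h0 : V x = 0
  · rw [h0]
    have : IsLocalMin (fun x => |V x|) x := Eventually.of_forall fun y => by simp [h0]
    simp [this.deriv_eq_zero]
  · rcases lt_or_gt_of_ne h0 with h | h
    · have : (fun x => |V x|) =ᶠ[𝓝 x] fun x => - V x := by
        filter_upwards [hd.continuousAt.eventually_lt continuousAt_const h] with y hy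
        exact abs_of_neg hy
      rw [this.deriv_eq, hd.fun_neg.deriv, Real.sign_of_neg h]; ring
    · have : (fun x => |V x|) =ᶠ[𝓝 x] fun x => V x := by
        filter_upwards [continuousAt_const.eventually_lt hd.continuousAt h] with y hy
        exact abs_of_pos hy
      rw [this.deriv_eq, hd.deriv, Real.sign_of_pos h]; ring

/-! ### One-sided mollification in `L¹` -/

/-- Continuity of translations in `L¹`: translations form a continuous curve of measure-preserving
maps, and composition with such maps is continuous in `Lp`. -/
theorem tendsto_lintegral_translate_sub {u : ℝ → ℝ} (hu : Integrable u) :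
    Tendsto (fun h : ℝ => ∫⁻ v, ‖u (v + h) - u v‖ₑ) (𝓝 0) (𝓝 0) := by
  have hmp : ∀ h : ℝ, MeasurePreserving (fun v : ℝ => v + h) volume volume :=
    fun h => measurePreserving_add_right volume h
  let γ : C(ℝ × ℝ, ℝ) := ⟨fun p => p.2 + p.1, by fun_prop⟩
  have hγ : Continuous fun h => γ.curry h := γ.curry.continuous
  have hmp' : ∀ h, MeasurePreserving (γ.curry h) volume volume := fun h => hmp h
  set F : Lp ℝ 1 (volume : Measure ℝ) := hu.toL1 u
  have hc : Continuous fun h => Lp.compMeasurePreserving (γ.curry h) (hmp' h) F :=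
    (continuous_const (y := F)).compMeasurePreservingLp hγ hmp' (by simp)
  have h0 := (Lp.tendsto_Lp_iff_tendsto_eLpNorm' _ _).1 (hc.tendsto 0)
  refine h0.congr fun h => ?_
  rw [eLpNorm_one_eq_lintegral_enorm]
  refine lintegral_congr_ae ?_
  have hF : F =ᵐ[volume] u := hu.coeFn_toL1
  filter_upwards [Lp.coeFn_compMeasurePreserving F (hmp' h),
    Lp.coeFn_compMeasurePreserving F (hmp' 0), hF,
    (hmp' h).quasiMeasurePreserving.ae_eq_comp hF] with v h1 h2 h3 h4
  have e : (γ.curry 0) v = v := by simp [γ]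
  simp only [Pi.sub_apply, h1, h2, Function.comp_apply, e, h3]
  simp only [Function.comp_apply] at h4
  rw [h4]
  simp [γ]

/-- One-sided mollification: `∫ κ(z) u(v + ε z) dz`. -/
noncomputable def moll (κ : ℝ → ℝ) (ε : ℝ) (u : ℝ → ℝ) (v : ℝ) : ℝ := ∫ z, κ z * u (v + ε * z)

/-- By Tonelli the error is at most the average over `|κ(z)| dz` of the translation errors of `u`,
each dominated by `2 ‖u‖₁`. The mass of `κ` is left free, since the lemma serves both the mollifier
and the kernel `ρ + z ρ'` of mass zero. -/
theorem tendsto_lintegral_moll_sub {κ u : ℝ → ℝ} (hκ : Continuous κ) (hκc : HasCompactSupport κ)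
    (hu : Integrable u) (hum : Measurable u) {ε : ℕ → ℝ} (hε : Tendsto ε atTop (𝓝 0))
    (hε0 : ∀ n, ε n ≠ 0) :
    Tendsto (fun n => ∫⁻ v, ‖moll κ (ε n) u v - (∫ z, κ z) * u v‖ₑ) atTop (𝓝 0) := by
  have hκi : Integrable κ := hκ.integrable_of_hasCompactSupport hκc
  have hjm : ∀ n, Measurable fun p : ℝ × ℝ => ‖κ p.2‖ₑ * ‖u (p.1 + ε n * p.2) - u p.1‖ₑ := by
    intro n
    have := hκ.measurable
    fun_prop
  have hle : ∀ n, ∫⁻ v, ‖moll κ (ε n) u v - (∫ z, κ z) * u v‖ₑ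
      ≤ ∫⁻ z, ‖κ z‖ₑ * ∫⁻ v, ‖u (v + ε n * z) - u v‖ₑ := by
    intro n
    calc ∫⁻ v, ‖moll κ (ε n) u v - (∫ z, κ z) * u v‖ₑ
        ≤ ∫⁻ v, ∫⁻ z, ‖κ z‖ₑ * ‖u (v + ε n * z) - u v‖ₑ := by
          refine lintegral_mono fun v => ?_
          have hi : Integrable fun z => κ z * u (v + ε n * z) := by
            obtain ⟨C, hC⟩ := hκc.exists_bound_of_continuous hκ
            refine ((hu.comp_add_left v).comp_mul_left' (hε0 n)).bdd_mul
              hκ.aestronglyMeasurable (Eventually.of_forall hC)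
          have : moll κ (ε n) u v - (∫ z, κ z) * u v
              = ∫ z, κ z * (u (v + ε n * z) - u v) := by
            rw [moll, ← integral_mul_const, ← integral_sub hi (hκi.mul_const _)]
            simp only [mul_sub]
          rw [this]
          refine (enorm_integral_le_lintegral_enorm _).trans_eq ?_
          simp only [enorm_mul]
      _ = ∫⁻ z, ∫⁻ v, ‖κ z‖ₑ * ‖u (v + ε n * z) - u v‖ₑ :=
          lintegral_lintegral_swap (hjm n).aemeasurable
      _ = _ := by
          refine lintegral_congr fun z => ?_
          rw [lintegral_const_mul]
          fun_prop
  refine tendsto_of_tendsto_of_tendsto_of_le_of_le tendsto_const_nhds ?_ (fun _ => zero_le) hle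
  have hfin : ∫⁻ v, ‖u v‖ₑ ≠ ⊤ := hu.2.ne
  have hdct := tendsto_lintegral_of_dominated_convergence
    (F := fun n z => ‖κ z‖ₑ * ∫⁻ v, ‖u (v + ε n * z) - u v‖ₑ) (f := fun _ => 0)
    (μ := (volume : Measure ℝ)) (fun z => ‖κ z‖ₑ * (2 * ∫⁻ v, ‖u v‖ₑ)) ?_ ?_ ?_ ?_
  · simpa using hdct
  · intro n
    have := hκ.measurable
    refine (by fun_prop : Measurable fun z => ‖κ z‖ₑ).mul ?_
    refine Measurable.lintegral_prod_right' (f := fun p : ℝ × ℝ => ‖u (p.2 + ε n * p.1) - u p.2‖ₑ) ?_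
    fun_prop
  · refine fun n => Eventually.of_forall fun z => ?_
    simp only
    gcongr
    calc ∫⁻ v, ‖u (v + ε n * z) - u v‖ₑ ≤ ∫⁻ v, (‖u (v + ε n * z)‖ₑ + ‖u v‖ₑ) :=
          lintegral_mono fun v => enorm_sub_le
      _ = 2 * ∫⁻ v, ‖u v‖ₑ := by
          rw [lintegral_add_right _ (by fun_prop),
            lintegral_add_right_eq_self (fun v => ‖u v‖ₑ), two_mul]
  · rw [lintegral_mul_const _ (by have := hκ.measurable; fun_prop)]
    exact ENNReal.mul_ne_top hκi.2.ne (ENNReal.mul_ne_top (by simp) hfin)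
  · refine Eventually.of_forall fun z => ?_
    have h1 : Tendsto (fun n => ε n * z) atTop (𝓝 0) := by simpa using hε.mul_const z
    have := ENNReal.Tendsto.const_mul ((tendsto_lintegral_translate_sub hu).comp h1)
      (a := ‖κ z‖ₑ) (Or.inr enorm_ne_top)
    simpa using this

theorem measurable_moll {κ u : ℝ → ℝ} (hκ : Measurable κ) (hu : Measurable u) (ε : ℝ) :
    Measurable (moll κ ε u) := by
  have : StronglyMeasurable fun p : ℝ × ℝ => κ p.2 * u (p.1 + ε * p.2) :=
    Measurable.stronglyMeasurable (by fun_prop)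
  exact this.integral_prod_right.measurable

theorem lintegral_enorm_moll_le {κ u : ℝ → ℝ} (hκ : Measurable κ) (hu : Measurable u) (ε : ℝ) :
    ∫⁻ v, ‖moll κ ε u v‖ₑ ≤ (∫⁻ z, ‖κ z‖ₑ) * ∫⁻ v, ‖u v‖ₑ := by
  calc ∫⁻ v, ‖moll κ ε u v‖ₑ ≤ ∫⁻ v, ∫⁻ z, ‖κ z‖ₑ * ‖u (v + ε * z)‖ₑ := by
        refine lintegral_mono fun v => (enorm_integral_le_lintegral_enorm _).trans_eq ?_
        simp only [enorm_mul]
    _ = ∫⁻ z, ∫⁻ v, ‖κ z‖ₑ * ‖u (v + ε * z)‖ₑ :=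
        lintegral_lintegral_swap (by fun_prop)
    _ = ∫⁻ z, ‖κ z‖ₑ * ∫⁻ v, ‖u v‖ₑ := by
        refine lintegral_congr fun z => ?_
        rw [lintegral_const_mul _ (by fun_prop), lintegral_add_right_eq_self (fun v => ‖u v‖ₑ)]
    _ = _ := lintegral_mul_const _ (by fun_prop)

theorem integrable_moll {κ u : ℝ → ℝ} (hκ : Measurable κ) (hκi : Integrable κ)
    (hu : Measurable u) (hui : Integrable u) (ε : ℝ) : Integrable (moll κ ε u) :=
  ⟨(measurable_moll hκ hu ε).aestronglyMeasurable,
    (lintegral_enorm_moll_le hκ hu ε).trans_lt (ENNReal.mul_lt_top hκi.2 hui.2)⟩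

theorem integral_comp_sub_div_mul (φ u : ℝ → ℝ) {ε : ℝ} (hε : 0 < ε) (v : ℝ) :
    ∫ x, φ ((x - v) / ε) * u x = ε * moll φ ε u v := by
  have h1 := Measure.integral_comp_mul_left (fun y => φ (y / ε) * u (v + y)) ε
  have h2 := integral_add_right_eq_self (μ := (volume : Measure ℝ))
    (fun x => φ ((x - v) / ε) * u x) v
  rw [← h2, moll]
  have h3 : (fun z => φ z * u (v + ε * z)) = fun z => φ (ε * z / ε) * u (v + ε * z) := by
    ext z; rw [mul_div_cancel_left₀ _ hε.ne']
  rw [h3, h1, abs_of_pos (inv_pos.2 hε), smul_eq_mul, ← mul_assoc, mul_inv_cancel₀ hε.ne', one_mul]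
  refine integral_congr_ae (Eventually.of_forall fun x => ?_)
  simp only [add_sub_cancel_right]
  rw [add_comm]

/-- A smooth kernel of unit mass supported in `(0,1)`. -/
structure IsMollifier (ρ : ℝ → ℝ) : Prop where
  contDiff : ContDiff ℝ ∞ ρ
  compact : HasCompactSupport ρ
  tsupport_subset : tsupport ρ ⊆ Ioo 0 1
  integral_eq_one : ∫ z, ρ z = 1

theorem exists_isMollifier : ∃ ρ : ℝ → ℝ, IsMollifier ρ := by
  let f : ContDiffBump (1 / 2 : ℝ) := ⟨1 / 8, 1 / 4, by norm_num, by norm_num⟩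
  refine ⟨f.normed volume, f.contDiff_normed, f.hasCompactSupport_normed, ?_, f.integral_normed⟩
  rw [f.tsupport_normed_eq]
  intro x hx
  rw [Metric.mem_closedBall, Real.dist_eq, abs_le] at hx
  simp only [f] at hx
  constructor <;> linarith [hx.1, hx.2]

namespace IsMollifier
variable {ρ : ℝ → ℝ}

theorem differentiable (h : IsMollifier ρ) : Differentiable ℝ ρ :=
  h.contDiff.differentiable (by simp)

theorem contDiff_deriv (h : IsMollifier ρ) : ContDiff ℝ ∞ (deriv ρ) :=
  (contDiff_infty_iff_deriv.1 h.contDiff).2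

theorem compact_deriv (h : IsMollifier ρ) : HasCompactSupport (deriv ρ) := h.compact.deriv

theorem tsupport_deriv_subset (h : IsMollifier ρ) : tsupport (deriv ρ) ⊆ Ioo 0 1 :=
  (closure_minimal (support_deriv_subset) (isClosed_tsupport _)).trans h.tsupport_subset

theorem eq_zero (h : IsMollifier ρ) {z : ℝ} (hz : z ∉ Ioo (0 : ℝ) 1) : ρ z = 0 :=
  image_eq_zero_of_notMem_tsupport fun h' => hz (h.tsupport_subset h')

theorem deriv_eq_zero (h : IsMollifier ρ) {z : ℝ} (hz : z ∉ Ioo (0 : ℝ) 1) : deriv ρ z = 0 :=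
  image_eq_zero_of_notMem_tsupport fun h' => hz (h.tsupport_deriv_subset h')

theorem continuous (h : IsMollifier ρ) : Continuous ρ := h.contDiff.continuous
theorem continuous_deriv (h : IsMollifier ρ) : Continuous (deriv ρ) := h.contDiff_deriv.continuous
theorem integrable (h : IsMollifier ρ) : Integrable ρ :=
  h.continuous.integrable_of_hasCompactSupport h.compact
theorem integrable_deriv (h : IsMollifier ρ) : Integrable (deriv ρ) :=
  h.continuous_deriv.integrable_of_hasCompactSupport h.compact_deriv

theorem compact_mul_deriv (h : IsMollifier ρ) : HasCompactSupport fun z => z * deriv ρ z :=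
  h.compact_deriv.mul_left

/-- The integrand is the derivative of the compactly supported function `z ρ(z)`. This zero mean is
what makes the commutator vanish in the limit. -/
theorem integral_add_mul_deriv (h : IsMollifier ρ) : ∫ z, (ρ z + z * deriv ρ z) = 0 := by
  have hd : ∀ z, HasDerivAt (fun z => z * ρ z) (ρ z + z * deriv ρ z) z := fun z => by
    simpa using (hasDerivAt_id z).fun_mul (h.differentiable z).hasDerivAt
  have hi : Integrable fun z => z * deriv ρ z :=
    (continuous_id.mul h.continuous_deriv).integrable_of_hasCompactSupport h.compact_mul_deriv
  refine integral_eq_zero_of_hasDerivAt_of_integrable hd (h.integrable.add hi) ?_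
  exact (continuous_id.mul h.continuous).integrable_of_hasCompactSupport h.compact.mul_left

end IsMollifier

/-- After the substitution `x = v + ε z` the variable `v` appears only in `φ`, so the derivative
falls on `φ` and integrability of `u` suffices. -/
theorem hasDerivAt_moll {φ u : ℝ → ℝ} (hφ : ContDiff ℝ ∞ φ) (hφc : HasCompactSupport φ)
    (hu : Integrable u) {ε : ℝ} (hε : 0 < ε) (v : ℝ) :
    HasDerivAt (moll φ ε u) (-(ε⁻¹ * moll (deriv φ) ε u v)) v := by
  have hφ' : Continuous (deriv φ) := (contDiff_infty_iff_deriv.1 hφ).2.continuous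
  have hφd : Differentiable ℝ φ := hφ.differentiable (by simp)
  obtain ⟨C, hC⟩ := hφc.deriv.exists_bound_of_continuous hφ'
  obtain ⟨C₀, hC₀⟩ := hφc.exists_bound_of_continuous hφ.continuous
  have e1 : moll φ ε u = fun w => ∫ x, ε⁻¹ * (φ ((x - w) / ε) * u x) := by
    ext w
    rw [integral_const_mul, integral_comp_sub_div_mul _ _ hε, ← mul_assoc,
      inv_mul_cancel₀ hε.ne', one_mul]
  have e2 : -(ε⁻¹ * moll (deriv φ) ε u v)
      = ∫ x, -(ε⁻¹ * ε⁻¹) * (deriv φ ((x - v) / ε) * u x) := by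
    rw [integral_const_mul, integral_comp_sub_div_mul _ _ hε]
    field_simp
  have hm : ∀ {ψ : ℝ → ℝ}, Continuous ψ → ∀ w,
      AEStronglyMeasurable (fun x => ψ ((x - w) / ε) * u x) volume := fun hψ w =>
    (Continuous.aestronglyMeasurable (by fun_prop)).mul hu.1
  rw [e1, e2]
  refine (hasDerivAt_integral_of_dominated_loc_of_deriv_le (s := univ)
    (F' := fun w x => -(ε⁻¹ * ε⁻¹) * (deriv φ ((x - w) / ε) * u x))
    (bound := fun x => (ε⁻¹ * ε⁻¹) * (C * ‖u x‖)) univ_mem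
    (Eventually.of_forall fun w => (hm hφ.continuous w).const_mul _) ?_
    ((hm hφ' v).const_mul _) ?_ ((hu.norm.const_mul _).const_mul _) ?_).2
  · exact (hu.bdd_mul (Continuous.aestronglyMeasurable (by have := hφ.continuous; fun_prop))
      (Eventually.of_forall fun x => hC₀ _)).const_mul _
  · refine Eventually.of_forall fun x w _ => ?_
    rw [norm_mul, norm_mul, norm_neg, Real.norm_of_nonneg (by positivity : 0 ≤ ε⁻¹ * ε⁻¹)]
    gcongr
    exact hC _
  · refine Eventually.of_forall fun x w _ => ?_
    have h1 : HasDerivAt (fun w => (x - w) / ε) (-1 / ε) w := by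
      simpa using ((hasDerivAt_id w).const_sub x).div_const ε
    have h2 := ((hφd ((x - w) / ε)).hasDerivAt.comp w h1)
    have h3 := (h2.mul_const (u x)).const_mul ε⁻¹
    refine h3.congr_deriv ?_
    field_simp

/-! ### Bounds on the growth rate and the commutator -/

namespace IsGrowthRate
variable {g : ℝ → ℝ → ℝ} {A B s : ℝ}

theorem abs_sub_le (hg : IsGrowthRate g A B) (hs : 0 ≤ s) {v w : ℝ} (hv : 0 < v) (hw : 0 < w) :
    |deriv (g s) w - deriv (g s) v| ≤ B * |w - v| := by
  have := (convex_Ioi (0 : ℝ)).norm_image_sub_le_of_norm_deriv_le (f := deriv (g s)) (C := B)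
    (fun x hx => hg.differentiableAt_deriv s hs x hx)
    (fun x hx => (hg.abs_deriv_deriv_lt s hs x hx).le) (x := v) (y := w) hv hw
  simpa using this

theorem continuousOn_right (hg : IsGrowthRate g A B) (hs : 0 ≤ s) : ContinuousOn (g s) (Ici 0) :=
  hg.continuousOn.comp (f := fun v => (s, v)) (by fun_prop) fun v hv => ⟨hs, hv⟩

/-- Mean value inequality starting from `g s 0 = 0`. It makes `g u` integrable once `v u` is, and
removes the boundary term at `v = 0`. -/
theorem le_mul (hg : IsGrowthRate g A B) (hs : 0 ≤ s) {v : ℝ} (hv : 0 ≤ v) : g s v ≤ A * v := by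
  have := (convex_Ici (0 : ℝ)).image_sub_le_mul_sub_of_deriv_le (hg.continuousOn_right hs)
    (fun x hx => by
      rw [interior_Ici] at hx
      exact (hg.differentiableAt s hs x hx).differentiableWithinAt) (C := A)
    (fun x hx => by
      rw [interior_Ici] at hx
      exact (le_abs_self _).trans (hg.abs_deriv_lt s hs x hx).le) 0 self_mem_Ici v hv hv
  simpa [hg.zero s hs] using this

/-- The function `x ↦ g s x - g' x`, with `g'` the derivative at `v`, has derivative at most `B h`
on `[v, v + h]`. The sharp constant `B / 2` is not needed. -/
theorem abs_taylor_le (hg : IsGrowthRate g A B) (hB : 0 ≤ B) (hs : 0 ≤ s) {v h : ℝ} (hv : 0 < v)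
    (hh : 0 ≤ h) : |g s (v + h) - g s v - deriv (g s) v * h| ≤ B * h ^ 2 := by
  have hd : ∀ x ∈ Icc v (v + h), HasDerivWithinAt (fun x => g s x - deriv (g s) v * x)
      (deriv (g s) x - deriv (g s) v) (Icc v (v + h)) x := fun x hx => by
    have := ((hg.differentiableAt s hs x (hv.trans_le hx.1)).hasDerivAt.fun_sub
      ((hasDerivAt_id x).const_mul (deriv (g s) v)))
    simpa using this.hasDerivWithinAt
  have := (convex_Icc v (v + h)).norm_image_sub_le_of_norm_hasDerivWithin_le (C := B * h) hd
    (fun x hx => ?_) (left_mem_Icc.2 (by linarith)) (right_mem_Icc.2 (by linarith))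
  · rw [Real.norm_eq_abs, Real.norm_eq_abs, add_sub_cancel_left, abs_of_nonneg hh] at this
    calc _ = |g s (v + h) - deriv (g s) v * (v + h) - (g s v - deriv (g s) v * v)| := by
            congr 1; ring
      _ ≤ B * h * h := this
      _ = _ := by ring
  · refine (hg.abs_sub_le hs hv (hv.trans_le hx.1)).trans ?_
    rw [abs_of_nonneg (by linarith [hx.1])]
    gcongr
    linarith [hx.2]

theorem continuousOn_deriv (hg : IsGrowthRate g A B) (hs : 0 ≤ s) :
    ContinuousOn (deriv (g s)) (Ioi 0) := fun x hx =>
  (hg.differentiableAt_deriv s hs x hx).continuousAt.continuousWithinAt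

end IsGrowthRate

/-- The commutator of the transport operator `u ↦ (γ u)'` and the mollification. -/
noncomputable def commutator (ρ : ℝ → ℝ) (ε : ℝ) (γ u : ℝ → ℝ) (v : ℝ) : ℝ :=
  ε⁻¹ * moll (deriv ρ) ε (fun x => γ x * u x) v + deriv γ v * moll ρ ε u v
    - γ v * (ε⁻¹ * moll (deriv ρ) ε u v)

theorem integrable_moll_integrand {κ u : ℝ → ℝ} (hκ : Continuous κ) (hκc : HasCompactSupport κ)
    (hu : Integrable u) {ε : ℝ} (hε : ε ≠ 0) (v : ℝ) : Integrable fun z => κ z * u (v + ε * z) := by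
  obtain ⟨C, hC⟩ := hκc.exists_bound_of_continuous hκ
  exact ((hu.comp_add_left v).comp_mul_left' hε).bdd_mul
    hκ.aestronglyMeasurable (Eventually.of_forall hC)

theorem abs_commutator_le {ρ : ℝ → ℝ} (hρ : IsMollifier ρ) {g : ℝ → ℝ → ℝ} {A B s : ℝ}
    (hg : IsGrowthRate g A B) (hB : 0 ≤ B) (hs : 0 ≤ s) {u : ℝ → ℝ} (hu : Integrable u)
    (hgu : Integrable fun x => g s x * u x) {ε : ℝ} (hε : 0 < ε) {v : ℝ} (hv : 0 < v) :
    |commutator ρ ε (g s) u v| ≤ A * |moll (fun z => ρ z + z * deriv ρ z) ε u v|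
      + (B * ε) * moll (fun z => |deriv ρ z|) ε (fun x => |u x|) v := by
  have hi1 := integrable_moll_integrand hρ.continuous_deriv hρ.compact_deriv hgu hε.ne' v
  have hi2 := integrable_moll_integrand hρ.continuous hρ.compact hu hε.ne' v
  have hi3 := integrable_moll_integrand hρ.continuous_deriv hρ.compact_deriv hu hε.ne' v
  have hc4 : Continuous fun z => z * deriv ρ z := continuous_id.mul hρ.continuous_deriv
  have hi4 := integrable_moll_integrand hc4 hρ.compact_mul_deriv hu hε.ne' v
  have hi5 := integrable_moll_integrand hρ.continuous_deriv.abs (hρ.compact_deriv.comp_left abs_zero)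
    hu.abs hε.ne' v
  have e1 : moll (fun z => ρ z + z * deriv ρ z) ε u v
      = moll ρ ε u v + moll (fun z => z * deriv ρ z) ε u v := by
    rw [moll, moll, moll, ← integral_add hi2 hi4]
    simp only [add_mul]
  -- Taylor expansion of `g s` at `v` under the integral with `ρ'`: the first-order part combines
  -- with the term in `moll ρ` to give the kernel `ρ + z ρ'`, and a remainder of order `B ε²` is
  -- left against the factor `ε⁻¹`.
  have e2 : commutator ρ ε (g s) u v
      = deriv (g s) v * moll (fun z => ρ z + z * deriv ρ z) ε u v
      + ∫ z, ε⁻¹ * (deriv ρ z * (g s (v + ε * z) - g s v - deriv (g s) v * (ε * z))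
          * u (v + ε * z)) := by
    have e3 : (∫ z, ε⁻¹ * (deriv ρ z * (g s (v + ε * z) - g s v - deriv (g s) v * (ε * z))
          * u (v + ε * z))) = ε⁻¹ * (moll (deriv ρ) ε (fun x => g s x * u x) v
          - g s v * moll (deriv ρ) ε u v
          - deriv (g s) v * ε * moll (fun z => z * deriv ρ z) ε u v) := by
      have h3 := hi3.const_mul (g s v)
      have h4 := hi4.const_mul (deriv (g s) v * ε)
      have h13 : Integrable fun z => deriv ρ z * (g s (v + ε * z) * u (v + ε * z))
          - g s v * (deriv ρ z * u (v + ε * z)) := hi1.sub h3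
      simp only [moll]
      rw [← integral_const_mul (g s v), ← integral_sub hi1 h3,
        ← integral_const_mul (deriv (g s) v * ε), ← integral_sub h13 h4, ← integral_const_mul]
      refine integral_congr_ae (Eventually.of_forall fun z => ?_)
      simp only
      ring
    rw [e3, e1, commutator]
    field_simp
    ring
  rw [e2]
  refine (abs_add_le _ _).trans (add_le_add ?_ ?_)
  · rw [abs_mul]
    gcongr
    exact (hg.abs_deriv_lt s hs v hv).le
  · rw [moll, ← integral_const_mul]
    refine abs_integral_le_integral_abs.trans (integral_mono_of_nonneg
      (Eventually.of_forall fun z => abs_nonneg _) (hi5.const_mul _)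
      (Eventually.of_forall fun z => ?_))
    simp only
    -- Outside `(0,1)` the factor `ρ'` vanishes, so the Taylor bound is needed only for increments
    -- `ε z` in `(0, ε)`.
    by_cases hz : z ∈ Ioo (0 : ℝ) 1
    · have h1 := hg.abs_taylor_le hB hs hv (mul_nonneg hε.le hz.1.le)
      rw [abs_mul, abs_mul, abs_mul, abs_of_pos (inv_pos.2 hε)]
      have h2 : |g s (v + ε * z) - g s v - deriv (g s) v * (ε * z)| ≤ B * ε ^ 2 := by
        refine h1.trans ?_
        rw [mul_pow]
        have : z ^ 2 ≤ 1 := pow_le_one₀ hz.1.le hz.2.le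
        have := mul_le_mul_of_nonneg_left this (sq_nonneg ε)
        nlinarith
      calc ε⁻¹ * (|deriv ρ z| * |g s (v + ε * z) - g s v - deriv (g s) v * (ε * z)|
            * |u (v + ε * z)|)
          ≤ ε⁻¹ * (|deriv ρ z| * (B * ε ^ 2) * |u (v + ε * z)|) := by
            gcongr
        _ = _ := by field_simp
    · simp [hρ.deriv_eq_zero hz]

theorem measurable_commutator {ρ : ℝ → ℝ} (hρ : IsMollifier ρ) {γ u : ℝ → ℝ} (hγ : Measurable γ)
    (hu : Measurable u) (ε : ℝ) : Measurable (commutator ρ ε γ u) := by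
  have h1 := measurable_moll hρ.continuous_deriv.measurable (hγ.mul hu) ε
  have h2 := measurable_moll hρ.continuous_deriv.measurable hu ε
  have h3 := measurable_moll hρ.continuous.measurable hu ε
  have h4 := measurable_deriv γ
  exact ((h1.const_mul _).add (h4.mul h3)).sub (hγ.mul (h2.const_mul _))

/-! ### The transport term tested with the sign -/

/-- A bounded positive weight on `(0,∞)` growing at most linearly in the sense `v W'(v) ≤ W(v)`. -/
structure IsTransportWeight (W W' : ℝ → ℝ) (C : ℝ) : Prop where
  measurable : Measurable W
  pos : ∀ v > 0, 0 < W v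
  le : ∀ v > 0, W v ≤ C
  hasDerivAt : ∀ v > 0, HasDerivAt W (W' v) v
  continuousOn : ContinuousOn W' (Ioi 0)
  mul_le : ∀ v > 0, v * W' v ≤ W v

theorem IsTransportWeight.integrableOn_mul {W W' : ℝ → ℝ} {C : ℝ} (hW : IsTransportWeight W W' C)
    {F : ℝ → ℝ} (hF : IntegrableOn F (Ioi 0)) : IntegrableOn (fun v => W v * F v) (Ioi 0) := by
  refine Integrable.bdd_mul (c := C) hF hW.measurable.aestronglyMeasurable ?_
  filter_upwards [ae_restrict_mem measurableSet_Ioi] with v hv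
  rw [Real.norm_of_nonneg (hW.pos v hv).le]
  exact hW.le v hv

theorem integrable_sign_mul {μ : Measure ℝ} {U F : ℝ → ℝ} (hU : Measurable U)
    (hF : Integrable F μ) : Integrable (fun v => Real.sign (U v) * F v) μ :=
  hF.bdd_mul (c := 1) (measurable_real_sign.comp hU).aestronglyMeasurable
    (Eventually.of_forall fun _ => abs_sign_le_one _)

/-- The transport term, tested with the sign, only sees the growth of the weight. -/
theorem neg_integral_weight_sign_mul_deriv_le {g : ℝ → ℝ → ℝ} {A B s : ℝ}
    (hg : IsGrowthRate g A B) (hs : 0 ≤ s) (hA : 0 ≤ A) {W W' : ℝ → ℝ} {C : ℝ}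
    (hW : IsTransportWeight W W' C) {U D : ℝ → ℝ} (hU : ∀ v, HasDerivAt U (D v) v)
    (hD : Continuous D) (hUi : Integrable U)
    (hi : IntegrableOn (fun v => deriv (g s) v * U v + g s v * D v) (Ioi 0)) :
    -(∫ v in Ioi 0, W v * (Real.sign (U v) * (deriv (g s) v * U v + g s v * D v)))
      ≤ A * ∫ v in Ioi 0, W v * |U v| := by
  have hUc : Continuous U := continuous_iff_continuousAt.2 fun v => (hU v).continuousAt
  set h' : ℝ → ℝ := fun v => deriv (g s) v * U v + g s v * D v with hh'
  have hgd : ∀ v > 0, HasDerivAt (g s) (deriv (g s) v) v := fun v hv =>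
    (hg.differentiableAt s hs v hv).hasDerivAt
  have hh : ∀ v > 0, HasDerivAt (fun v => W v * (g s v * U v))
      (W' v * (g s v * U v) + W v * h' v) v := fun v hv =>
    (hW.hasDerivAt v hv).mul ((hgd v hv).mul (hU v))
  have hi1 : IntegrableOn (fun v => W v * (Real.sign (U v) * h' v)) (Ioi 0) :=
    hW.integrableOn_mul (integrable_sign_mul hUc.measurable hi)
  have hi2 : IntegrableOn (fun v => W v * |U v|) (Ioi 0) :=
    hW.integrableOn_mul hUi.abs.integrableOn
  -- the integral over `[a, b]`
  have key : ∀ a b, 0 < a → a ≤ b → -(∫ v in a..b, W v * (Real.sign (U v) * h' v))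
      ≤ C * (A * a * |U a|) + A * ∫ v in a..b, W v * |U v| := by
    intro a b ha hab
    have hsub : uIcc a b ⊆ Ioi 0 := by
      rw [uIcc_of_le hab]; exact fun x hx => ha.trans_le hx.1
    have hWc : ContinuousOn W (uIcc a b) := fun x hx =>
      (hW.hasDerivAt x (hsub hx)).continuousAt.continuousWithinAt
    have hgc : ContinuousOn (g s) (uIcc a b) := fun x hx =>
      (hgd x (hsub hx)).continuousAt.continuousWithinAt
    have hgc' := (hg.continuousOn_deriv hs).mono hsub
    have hWc' := hW.continuousOn.mono hsub
    have hc : ContinuousOn (fun v => W' v * (g s v * U v) + W v * h' v) (uIcc a b) := by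
      simp only [hh']
      have := hUc.continuousOn (s := uIcc a b)
      have := hD.continuousOn (s := uIcc a b)
      fun_prop
    -- The chain rule is applied to the whole flux `W g U`, so that integrating its derivative
    -- yields boundary terms that can be controlled.
    have h1 := abs_sub_abs_eq_integral_sign (U := fun v => W v * (g s v * U v)) hab
      hc.intervalIntegrable (fun x hx => by
        rw [intervalIntegral.integral_eq_sub_of_hasDerivAt
          (f := fun v => W v * (g s v * U v))]
        · ring
        · intro y hy
          rw [uIcc_of_le hx.1] at hy
          exact hh y (ha.trans_le hy.1)
        · refine (hc.mono ?_).intervalIntegrable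
          rw [uIcc_of_le hx.1, uIcc_of_le hab]
          exact Icc_subset_Icc_right hx.2)
    have hj1 : IntervalIntegrable (fun v => W' v * |g s v * U v|) volume a b := by
      refine ContinuousOn.intervalIntegrable ?_
      have := hUc.continuousOn (s := uIcc a b)
      fun_prop
    have hj2 : IntervalIntegrable (fun v => W v * (Real.sign (U v) * h' v)) volume a b :=
      (intervalIntegrable_iff_integrableOn_Ioc_of_le hab).2
        (hi1.mono_set fun x hx => ha.trans hx.1)
    have hj3 : IntervalIntegrable (fun v => W v * |U v|) volume a b :=
      (intervalIntegrable_iff_integrableOn_Ioc_of_le hab).2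
        (hi2.mono_set fun x hx => ha.trans hx.1)
    have h2 : ∫ v in a..b, Real.sign (W v * (g s v * U v)) *
        (W' v * (g s v * U v) + W v * h' v)
        = (∫ v in a..b, W' v * |g s v * U v|) + ∫ v in a..b, W v * (Real.sign (U v) * h' v) := by
      rw [← intervalIntegral.integral_add hj1 hj2]
      refine intervalIntegral.integral_congr fun v hv => ?_
      have hv0 : 0 < v := hsub hv
      have hWv := hW.pos v hv0
      -- Where `g s` vanishes it has a local minimum, as `g ≥ 0`. Hence its derivative vanishes too
      -- and both integrands are `0`. Elsewhere the flux has the sign of `U`.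
      rcases (hg.nonneg s hs v hv0.le).eq_or_lt with h0 | h0
      · have hmin : IsLocalMin (g s) v := by
          filter_upwards [lt_mem_nhds hv0] with x hx
          rw [← h0]
          exact hg.nonneg s hs x hx.le
        simp [← h0, hh', hmin.deriv_eq_zero]
      · have hsg : Real.sign (W v * (g s v * U v)) = Real.sign (U v) := by
          rcases lt_trichotomy (U v) 0 with h | h | h
          · rw [Real.sign_of_neg h, Real.sign_of_neg (mul_neg_of_pos_of_neg hWv
              (mul_neg_of_pos_of_neg h0 h))]
          · simp [h]
          · rw [Real.sign_of_pos h, Real.sign_of_pos (by positivity)]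
        rw [hsg, abs_mul, abs_of_pos h0, ← sign_mul_self_eq_abs]
        ring
    have h3 : ∫ v in a..b, W' v * |g s v * U v| ≤ A * ∫ v in a..b, W v * |U v| := by
      rw [← intervalIntegral.integral_const_mul]
      refine intervalIntegral.integral_mono_on hab hj1 (hj3.const_mul A) fun v hv => ?_
      have hv0 : 0 < v := ha.trans_le hv.1
      have hg0 := hg.nonneg s hs v hv0.le
      rw [abs_mul, abs_of_nonneg hg0, ← mul_assoc, ← mul_assoc]
      refine mul_le_mul_of_nonneg_right ?_ (abs_nonneg _)
      rcases le_or_gt (W' v) 0 with hneg | hpos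
      · exact (mul_nonpos_of_nonpos_of_nonneg hneg hg0).trans
          (mul_nonneg hA (hW.pos v hv0).le)
      · calc W' v * g s v ≤ W' v * (A * v) := by gcongr; exact hg.le_mul hs hv0.le
          _ = A * (v * W' v) := by ring
          _ ≤ A * W v := by gcongr; exact hW.mul_le v hv0
    have h4 : |W a * (g s a * U a)| ≤ C * (A * a * |U a|) := by
      have hg0 := hg.nonneg s hs a ha.le
      rw [abs_mul, abs_mul, abs_of_pos (hW.pos a ha), abs_of_nonneg hg0]
      have := hW.le a ha
      have := hg.le_mul hs ha.le
      have := (hW.pos a ha).le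
      have : 0 ≤ C := by linarith
      gcongr
    -- The boundary term at `b` has the favourable sign and is dropped. The one at `a` is `O(a)` by
    -- `h4` and disappears as `a → 0`.
    have h5 := abs_nonneg (W b * (g s b * U b))
    linarith
  have hlim0 : Tendsto (fun n : ℕ => ((n : ℝ) + 1)⁻¹) atTop (𝓝 0) := by
    simpa [one_div] using tendsto_one_div_add_atTop_nhds_zero_nat (𝕜 := ℝ)
  have hlim1 : Tendsto (fun n : ℕ => (n : ℝ) + 1) atTop atTop :=
    tendsto_atTop_add_const_right _ _ tendsto_natCast_atTop_atTop
  have hcov : AECover (volume.restrict (Ioi (0 : ℝ))) atTop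
      fun n : ℕ => Ioc (((n : ℝ) + 1)⁻¹) ((n : ℝ) + 1) :=
    (aecover_Ioi_of_Ioi hlim0).inter (aecover_Iic hlim1).restrict
  have hle : ∀ n : ℕ, ((n : ℝ) + 1)⁻¹ ≤ (n : ℝ) + 1 := fun n =>
    (inv_le_one_of_one_le₀ (by linarith [n.cast_nonneg (α := ℝ)])).trans
      (by linarith [n.cast_nonneg (α := ℝ)])
  have hres : ∀ (F : ℝ → ℝ) (n : ℕ), ∫ v in Ioc (((n : ℝ) + 1)⁻¹) ((n : ℝ) + 1), F v
      ∂(volume.restrict (Ioi 0)) = ∫ v in (((n : ℝ) + 1)⁻¹)..((n : ℝ) + 1), F v := fun F n => by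
    rw [intervalIntegral.integral_of_le (hle n), Measure.restrict_restrict measurableSet_Ioc,
      inter_eq_left.2]
    exact fun x hx => (by positivity : (0 : ℝ) < ((n : ℝ) + 1)⁻¹).trans hx.1
  have t1 := (hcov.integral_tendsto_of_countably_generated hi1).neg
  have t2 := (hcov.integral_tendsto_of_countably_generated hi2).const_mul A
  have t3 : Tendsto (fun n : ℕ => C * (A * ((n : ℝ) + 1)⁻¹ * |U (((n : ℝ) + 1)⁻¹)|)) atTop
      (𝓝 0) := by
    have : Tendsto (fun x => C * (A * x * |U x|)) (𝓝 0) (𝓝 (C * (A * 0 * |U 0|))) :=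
      Continuous.tendsto (by fun_prop) 0
    simp only [mul_zero, zero_mul] at this
    exact this.comp hlim0
  have t4 := t3.add t2
  rw [zero_add] at t4
  refine le_of_tendsto_of_tendsto' t1 t4 fun n => ?_
  rw [hres, hres]
  exact key _ _ (by positivity) (hle n)

theorem integrable_growth_mul {g : ℝ → ℝ → ℝ} {A B s : ℝ} (hg : IsGrowthRate g A B) (hs : 0 ≤ s)
    {γ u : ℝ → ℝ} (hγ : Measurable γ) (hγg : ∀ v > 0, γ v = g s v) (hum : Measurable u)
    (hu0 : ∀ v ≤ 0, u v = 0) (hvu : Integrable fun v => v * u v) :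
    Integrable fun v => γ v * u v := by
  refine (hvu.const_mul A).mono (hγ.mul hum).aestronglyMeasurable (Eventually.of_forall fun v => ?_)
  rcases le_or_gt v 0 with hv | hv
  · simp [hu0 v hv]
  · have h0 := hg.nonneg s hs v hv.le
    have h1 := hg.le_mul hs hv.le
    rw [hγg v hv, ← mul_assoc, norm_mul, norm_mul, Real.norm_of_nonneg h0,
      Real.norm_of_nonneg (h0.trans h1)]
    gcongr

theorem commutator_congr {ρ : ℝ → ℝ} {ε : ℝ} {γ γ' u : ℝ → ℝ} (h : ∀ v > 0, γ v = γ' v)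
    (hu0 : ∀ v ≤ 0, u v = 0) {v : ℝ} (hv : 0 < v) :
    commutator ρ ε γ u v = commutator ρ ε γ' u v := by
  have h1 : (fun x => γ x * u x) = fun x => γ' x * u x := by
    ext x
    rcases le_or_gt x 0 with hx | hx
    · simp [hu0 x hx]
    · rw [h x hx]
  have h2 : deriv γ v = deriv γ' v := by
    refine Filter.EventuallyEq.deriv_eq ?_
    filter_upwards [lt_mem_nhds hv] with x hx using h x hx
  rw [commutator, commutator, h1, h2, h v hv]

/-- The transport term of the mollified equation, tested with the sign. -/
theorem integral_weight_sign_mul_transport_le {g : ℝ → ℝ → ℝ} {A B s : ℝ}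
    (hg : IsGrowthRate g A B) (hs : 0 ≤ s) (hA : 0 ≤ A) (hB : 0 ≤ B) {W W' : ℝ → ℝ} {C : ℝ}
    (hW : IsTransportWeight W W' C) {ρ : ℝ → ℝ} (hρ : IsMollifier ρ) {γ u : ℝ → ℝ}
    (hγ : Measurable γ) (hγg : ∀ v > 0, γ v = g s v) (hum : Measurable u) (hu : Integrable u)
    (hu0 : ∀ v ≤ 0, u v = 0) (hvu : Integrable fun v => v * u v) {ε : ℝ} (hε : 0 < ε) :
    IntegrableOn (commutator ρ ε γ u) (Ioi 0) ∧
    ∫ v in Ioi 0, W v * (Real.sign (moll ρ ε u v) * (ε⁻¹ * moll (deriv ρ) ε (fun x => γ x * u x) v))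
      ≤ A * (∫ v in Ioi 0, W v * |moll ρ ε u v|)
        + ∫ v in Ioi 0, W v * |commutator ρ ε γ u v| := by
  have hgu := integrable_growth_mul hg hs hγ hγg hum hu0 hvu
  have hgu' : Integrable fun x => g s x * u x := by
    refine hgu.congr (Eventually.of_forall fun x => ?_)
    rcases le_or_gt x 0 with hx | hx
    · simp [hu0 x hx]
    · simp [hγg x hx]
  have hκc : Continuous fun z => ρ z + z * deriv ρ z :=
    hρ.continuous.add (continuous_id.mul hρ.continuous_deriv)
  have hκs : HasCompactSupport fun z => ρ z + z * deriv ρ z := hρ.compact.add hρ.compact_mul_deriv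
  have hcom : IntegrableOn (commutator ρ ε γ u) (Ioi 0) := by
    have hb : Integrable fun v => A * |moll (fun z => ρ z + z * deriv ρ z) ε u v|
        + (B * ε) * moll (fun z => |deriv ρ z|) ε (fun x => |u x|) v :=
      ((integrable_moll hκc.measurable (hκc.integrable_of_hasCompactSupport hκs) hum hu
        ε).abs.const_mul A).add ((integrable_moll hρ.continuous_deriv.abs.measurable
        hρ.integrable_deriv.abs (by fun_prop) hu.abs ε).const_mul _)
    refine hb.integrableOn.mono' (measurable_commutator hρ hγ hum ε).aestronglyMeasurable ?_
    filter_upwards [ae_restrict_mem measurableSet_Ioi] with v hv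
    rw [commutator_congr hγg hu0 hv]
    exact abs_commutator_le hρ hg hB hs hu hgu' hε hv
  refine ⟨hcom, ?_⟩
  have hUm := measurable_moll hρ.continuous.measurable hum ε
  have hUi := integrable_moll hρ.continuous.measurable hρ.integrable hum hu ε
  set U := moll ρ ε u with hU
  set Tr : ℝ → ℝ := fun v => ε⁻¹ * moll (deriv ρ) ε (fun x => γ x * u x) v with hTr
  set D : ℝ → ℝ := fun v => -(ε⁻¹ * moll (deriv ρ) ε u v) with hD
  have hUd : ∀ v, HasDerivAt U (D v) v := fun v => hasDerivAt_moll hρ.contDiff hρ.compact hu hε v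
  have hDc : Continuous D := by
    have : Continuous (moll (deriv ρ) ε u) := continuous_iff_continuousAt.2 fun v =>
      (hasDerivAt_moll hρ.contDiff_deriv hρ.compact_deriv hu hε v).continuousAt
    exact (this.const_mul _).neg
  have hTi : Integrable Tr := (integrable_moll hρ.continuous_deriv.measurable hρ.integrable_deriv
    (hγ.mul hum) hgu ε).const_mul _
  -- Both `D = U'` and the commutator are arranged so that the mollified transport term equals the
  -- commutator minus the exact derivative `(g U)'`.
  have heq : ∀ v ∈ Ioi (0 : ℝ), commutator ρ ε γ u v - Tr v
      = deriv (g s) v * U v + g s v * D v := fun v hv => by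
    have h2 : deriv γ v = deriv (g s) v := by
      refine Filter.EventuallyEq.deriv_eq ?_
      filter_upwards [lt_mem_nhds hv] with x hx using hγg x hx
    rw [commutator, hTr, hD, ← hγg v hv, h2]
    ring
  have hi : IntegrableOn (fun v => deriv (g s) v * U v + g s v * D v) (Ioi 0) :=
    (hcom.sub hTi.integrableOn).congr_fun heq measurableSet_Ioi
  have h1 := neg_integral_weight_sign_mul_deriv_le hg hs hA hW hUd hDc hUi hi
  have j1 := hW.integrableOn_mul (integrable_sign_mul hUm hcom)
  have j2 := hW.integrableOn_mul (integrable_sign_mul hUm hi)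
  have j3 := hW.integrableOn_mul hcom.abs
  have h2 : ∫ v in Ioi 0, W v * (Real.sign (U v) * Tr v)
      = (∫ v in Ioi 0, W v * (Real.sign (U v) * commutator ρ ε γ u v))
        - ∫ v in Ioi 0, W v * (Real.sign (U v) * (deriv (g s) v * U v + g s v * D v)) := by
    rw [← integral_sub j1 j2]
    refine setIntegral_congr_fun measurableSet_Ioi fun v hv => ?_
    rw [← heq v hv]
    ring
  have h3 : ∫ v in Ioi 0, W v * (Real.sign (U v) * commutator ρ ε γ u v)
      ≤ ∫ v in Ioi 0, W v * |commutator ρ ε γ u v| := by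
    refine setIntegral_mono_on j1 j3 measurableSet_Ioi fun v hv => ?_
    refine mul_le_mul_of_nonneg_left ?_ (hW.pos v hv).le
    refine (le_abs_self _).trans ?_
    rw [abs_mul]
    exact mul_le_of_le_one_left (abs_nonneg _) (abs_sign_le_one _)
  linarith

theorem lintegral_commutator_le {ρ : ℝ → ℝ} (hρ : IsMollifier ρ) {g : ℝ → ℝ → ℝ} {A B s : ℝ}
    (hg : IsGrowthRate g A B) (hA : 0 ≤ A) (hB : 0 ≤ B) (hs : 0 ≤ s) {γ u : ℝ → ℝ}
    (hγ : Measurable γ) (hγg : ∀ v > 0, γ v = g s v) (hum : Measurable u) (hu : Integrable u)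
    (hu0 : ∀ v ≤ 0, u v = 0) (hvu : Integrable fun v => v * u v) {ε : ℝ} (hε : 0 < ε) :
    ∫⁻ v in Ioi 0, ‖commutator ρ ε γ u v‖ₑ ≤
      ENNReal.ofReal A * (∫⁻ v, ‖moll (fun z => ρ z + z * deriv ρ z) ε u v‖ₑ)
      + ENNReal.ofReal (B * ε) * ((∫⁻ z, ‖deriv ρ z‖ₑ) * ∫⁻ v, ‖u v‖ₑ) := by
  have hgu := integrable_growth_mul hg hs hγ hγg hum hu0 hvu
  have hgu' : Integrable fun x => g s x * u x := by
    refine hgu.congr (Eventually.of_forall fun x => ?_)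
    rcases le_or_gt x 0 with hx | hx
    · simp [hu0 x hx]
    · simp [hγg x hx]
  have hκc : Continuous fun z => ρ z + z * deriv ρ z :=
    hρ.continuous.add (continuous_id.mul hρ.continuous_deriv)
  have hm1 := measurable_moll hκc.measurable hum ε
  have hm2 := measurable_moll hρ.continuous_deriv.abs.measurable
    (show Measurable fun x => |u x| by fun_prop) ε
  calc ∫⁻ v in Ioi 0, ‖commutator ρ ε γ u v‖ₑ
      ≤ ∫⁻ v in Ioi 0, (ENNReal.ofReal A * ‖moll (fun z => ρ z + z * deriv ρ z) ε u v‖ₑ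
        + ENNReal.ofReal (B * ε) * ‖moll (fun z => |deriv ρ z|) ε (fun x => |u x|) v‖ₑ) := by
        refine setLIntegral_mono' measurableSet_Ioi fun v hv => ?_
        rw [commutator_congr hγg hu0 hv]
        have h := abs_commutator_le hρ hg hB hs hu hgu' hε hv
        have hBε : 0 ≤ B * ε := by positivity
        rw [Real.enorm_eq_ofReal_abs, Real.enorm_eq_ofReal_abs, Real.enorm_eq_ofReal_abs,
          ← ENNReal.ofReal_mul hA, ← ENNReal.ofReal_mul hBε,
          ← ENNReal.ofReal_add (by positivity) (by positivity)]
        refine ENNReal.ofReal_le_ofReal (h.trans ?_)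
        gcongr
        exact le_abs_self _
    _ ≤ ∫⁻ v, (ENNReal.ofReal A * ‖moll (fun z => ρ z + z * deriv ρ z) ε u v‖ₑ
        + ENNReal.ofReal (B * ε) * ‖moll (fun z => |deriv ρ z|) ε (fun x => |u x|) v‖ₑ) :=
        setLIntegral_le_lintegral _ _
    _ = ENNReal.ofReal A * (∫⁻ v, ‖moll (fun z => ρ z + z * deriv ρ z) ε u v‖ₑ)
        + ENNReal.ofReal (B * ε) * ∫⁻ v, ‖moll (fun z => |deriv ρ z|) ε (fun x => |u x|) v‖ₑ := by
        rw [lintegral_add_left (by fun_prop), lintegral_const_mul _ (by fun_prop),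
          lintegral_const_mul _ (by fun_prop)]
    _ ≤ _ := by
        gcongr
        refine (lintegral_enorm_moll_le hρ.continuous_deriv.abs.measurable (by fun_prop) ε).trans_eq ?_
        simp only [Real.enorm_eq_ofReal_abs, abs_abs]

/-- In the bound of `lintegral_commutator_le` the first term is a mollification by a kernel of zero
mean, hence tends to `0 * u`, and the second carries the factor `B ε`. -/
theorem tendsto_lintegral_commutator {ρ : ℝ → ℝ} (hρ : IsMollifier ρ) {g : ℝ → ℝ → ℝ} {A B s : ℝ}
    (hg : IsGrowthRate g A B) (hA : 0 ≤ A) (hB : 0 ≤ B) (hs : 0 ≤ s) {γ u : ℝ → ℝ}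
    (hγ : Measurable γ) (hγg : ∀ v > 0, γ v = g s v) (hum : Measurable u) (hu : Integrable u)
    (hu0 : ∀ v ≤ 0, u v = 0) (hvu : Integrable fun v => v * u v)
    {ε : ℕ → ℝ} (hε : Tendsto ε atTop (𝓝 0)) (hε0 : ∀ n, 0 < ε n) :
    Tendsto (fun n => ∫⁻ v in Ioi 0, ‖commutator ρ (ε n) γ u v‖ₑ) atTop (𝓝 0) := by
  have hκc : Continuous fun z => ρ z + z * deriv ρ z :=
    hρ.continuous.add (continuous_id.mul hρ.continuous_deriv)
  have hκs : HasCompactSupport fun z => ρ z + z * deriv ρ z := hρ.compact.add hρ.compact_mul_deriv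
  refine tendsto_of_tendsto_of_tendsto_of_le_of_le tendsto_const_nhds ?_ (fun _ => zero_le)
    fun n => lintegral_commutator_le hρ hg hA hB hs hγ hγg hum hu hu0 hvu (hε0 n)
  have h1 := tendsto_lintegral_moll_sub hκc hκs hu hum hε fun n => (hε0 n).ne'
  rw [hρ.integral_add_mul_deriv] at h1
  simp only [zero_mul, sub_zero] at h1
  have h2 := ENNReal.Tendsto.const_mul h1 (a := ENNReal.ofReal A) (Or.inr ENNReal.ofReal_ne_top)
  have h3 : Tendsto (fun n => ENNReal.ofReal (B * ε n)) atTop (𝓝 0) := by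
    have := ENNReal.tendsto_ofReal (hε.const_mul B)
    simpa using this
  have h4 := ENNReal.Tendsto.mul_const h3 (b := (∫⁻ z, ‖deriv ρ z‖ₑ) * ∫⁻ v, ‖u v‖ₑ)
    (Or.inr (ENNReal.mul_ne_top hρ.integrable_deriv.2.ne hu.2.ne))
  simpa using h2.add h4

/-! ### Mollification and commutator with time as a parameter -/

theorem measurable_moll_param {κ : ℝ → ℝ} (hκ : Measurable κ) {h : ℝ → ℝ → ℝ}
    (hh : Measurable (Function.uncurry h)) (ε : ℝ) :
    Measurable fun p : ℝ × ℝ => moll κ ε (h p.1) p.2 := by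
  have : StronglyMeasurable fun q : (ℝ × ℝ) × ℝ => κ q.2 * h q.1.1 (q.1.2 + ε * q.2) := by
    have h1 : Measurable fun q : (ℝ × ℝ) × ℝ => (q.1.1, q.1.2 + ε * q.2) := by fun_prop
    exact ((hκ.comp measurable_snd).mul (hh.comp h1)).stronglyMeasurable
  exact this.integral_prod_right.measurable

theorem integrable_moll_param {τ : Measure ℝ} {κ : ℝ → ℝ} (hκ : Measurable κ)
    (hκi : Integrable κ) {h : ℝ → ℝ → ℝ} (hh : Measurable (Function.uncurry h))
    (hi : Integrable (Function.uncurry h) (τ.prod volume)) (ε : ℝ) :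
    Integrable (fun p : ℝ × ℝ => moll κ ε (h p.1) p.2) (τ.prod volume) := by
  have hm := measurable_moll_param hκ hh ε
  refine ⟨hm.aestronglyMeasurable, ?_⟩
  have hfin := hi.2
  rw [HasFiniteIntegral, lintegral_prod _ (by fun_prop)] at hfin
  rw [HasFiniteIntegral, lintegral_prod _ hm.enorm.aemeasurable]
  calc ∫⁻ s, ∫⁻ v, ‖moll κ ε (h s) v‖ₑ ∂volume ∂τ
      ≤ ∫⁻ s, (∫⁻ z, ‖κ z‖ₑ) * ∫⁻ v, ‖h s v‖ₑ ∂volume ∂τ :=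
        lintegral_mono fun s => lintegral_enorm_moll_le hκ (hh.comp measurable_prodMk_left) ε
    _ = (∫⁻ z, ‖κ z‖ₑ) * ∫⁻ s, ∫⁻ v, ‖h s v‖ₑ ∂volume ∂τ :=
        lintegral_const_mul _ (Measurable.lintegral_prod_right' (f := fun p : ℝ × ℝ => ‖h p.1 p.2‖ₑ)
          hh.enorm)
    _ < ⊤ := ENNReal.mul_lt_top hκi.2 hfin

/-- Convergence holds on almost every time slice, and `(‖ρ‖₁ + 1) ‖h s‖₁` is an integrable majorant
in `s`. -/
theorem tendsto_lintegral_moll_param_sub {τ : Measure ℝ} [SFinite τ] {ρ : ℝ → ℝ}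
    (hρ : IsMollifier ρ) {h : ℝ → ℝ → ℝ} (hh : Measurable (Function.uncurry h))
    (hi : Integrable (Function.uncurry h) (τ.prod volume))
    {ε : ℕ → ℝ} (hε : Tendsto ε atTop (𝓝 0)) (hε0 : ∀ n, 0 < ε n) :
    Tendsto (fun n => ∫⁻ p, ‖moll ρ (ε n) (h p.1) p.2 - h p.1 p.2‖ₑ ∂(τ.prod volume))
      atTop (𝓝 0) := by
  have hρm := hρ.continuous.measurable
  have hm : ∀ n, Measurable fun p : ℝ × ℝ => ‖moll ρ (ε n) (h p.1) p.2 - h p.1 p.2‖ₑ := fun n =>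
    ((measurable_moll_param hρm hh (ε n)).sub hh).enorm
  have hsec : ∀ s, Measurable (h s) := fun s => hh.comp measurable_prodMk_left
  have hm1 : Measurable fun s => ∫⁻ v, ‖h s v‖ₑ :=
    Measurable.lintegral_prod_right' (f := fun p : ℝ × ℝ => ‖h p.1 p.2‖ₑ) hh.enorm
  have hfin := hi.2
  rw [HasFiniteIntegral, lintegral_prod _ (by fun_prop)] at hfin
  have hdct := tendsto_lintegral_of_dominated_convergence (μ := τ)
    (F := fun n s => ∫⁻ v, ‖moll ρ (ε n) (h s) v - h s v‖ₑ) (f := fun _ => 0)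
    (fun s => ((∫⁻ z, ‖ρ z‖ₑ) + 1) * ∫⁻ v, ‖h s v‖ₑ)
    (fun n => Measurable.lintegral_prod_right'
      (f := fun p : ℝ × ℝ => ‖moll ρ (ε n) (h p.1) p.2 - h p.1 p.2‖ₑ) (hm n)) ?_ ?_ ?_
  · rw [lintegral_zero] at hdct
    refine hdct.congr fun n => ?_
    rw [lintegral_prod _ (hm n).aemeasurable]
  · refine fun n => Eventually.of_forall fun s => ?_
    calc ∫⁻ v, ‖moll ρ (ε n) (h s) v - h s v‖ₑ
        ≤ ∫⁻ v, (‖moll ρ (ε n) (h s) v‖ₑ + ‖h s v‖ₑ) := lintegral_mono fun v => enorm_sub_le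
      _ = (∫⁻ v, ‖moll ρ (ε n) (h s) v‖ₑ) + ∫⁻ v, ‖h s v‖ₑ :=
          lintegral_add_right _ (hsec s).enorm
      _ ≤ (∫⁻ z, ‖ρ z‖ₑ) * (∫⁻ v, ‖h s v‖ₑ) + ∫⁻ v, ‖h s v‖ₑ := by
          gcongr
          exact lintegral_enorm_moll_le hρm (hsec s) _
      _ = _ := by ring
  · rw [lintegral_const_mul _ hm1]
    exact ENNReal.mul_ne_top (ENNReal.add_ne_top.2 ⟨hρ.integrable.2.ne, by simp⟩) hfin.ne
  · filter_upwards [hi.prod_right_ae] with s hs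
    have := tendsto_lintegral_moll_sub hρ.continuous hρ.compact hs (hsec s) hε
      fun n => (hε0 n).ne'
    simpa [hρ.integral_eq_one] using this

/-- A globally continuous extension of the growth rate. -/
def extendGrowth (g : ℝ → ℝ → ℝ) (s v : ℝ) : ℝ := g (max s 0) (max v 0)

theorem IsGrowthRate.continuous_extend {g : ℝ → ℝ → ℝ} {A B : ℝ} (hg : IsGrowthRate g A B) :
    Continuous (Function.uncurry (extendGrowth g)) := by
  have : Function.uncurry (extendGrowth g)
      = Function.uncurry g ∘ fun p : ℝ × ℝ => (max p.1 0, max p.2 0) := by ext p; rfl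
  rw [this]
  exact hg.continuousOn.comp_continuous (by fun_prop) fun p => by simp

theorem extendGrowth_eq {g : ℝ → ℝ → ℝ} {s v : ℝ} (hs : 0 ≤ s) (hv : 0 ≤ v) :
    extendGrowth g s v = g s v := by
  rw [extendGrowth, max_eq_left hs, max_eq_left hv]

theorem measurable_commutator_param {ρ : ℝ → ℝ} (hρ : IsMollifier ρ) {γ u : ℝ → ℝ → ℝ}
    (hγ : Continuous (Function.uncurry γ)) (hu : Measurable (Function.uncurry u)) (ε : ℝ) :
    Measurable fun p : ℝ × ℝ => commutator ρ ε (γ p.1) (u p.1) p.2 := by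
  have h1 := measurable_moll_param hρ.continuous_deriv.measurable
    (h := fun s x => γ s x * u s x) (hγ.measurable.mul hu) ε
  have h2 := measurable_moll_param hρ.continuous_deriv.measurable hu ε
  have h3 := measurable_moll_param hρ.continuous.measurable hu ε
  have h4 : Measurable fun p : ℝ × ℝ => deriv (γ p.1) p.2 := measurable_deriv_with_param hγ
  exact ((h1.const_mul _).add (h4.mul h3)).sub (hγ.measurable.mul (h2.const_mul _))

/-- The slices converge to `0`. The condition `ε n ≤ 1` makes the slice bound `M` independent of `n`
and `s`, so dominated convergence on the finite measure `τ` applies. -/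
theorem lintegral_commutator_param {τ : Measure ℝ} [IsFiniteMeasure τ]
    (hτ : ∀ᵐ s ∂τ, 0 ≤ s) {ρ : ℝ → ℝ} (hρ : IsMollifier ρ)
    {g : ℝ → ℝ → ℝ} {A B : ℝ} (hg : IsGrowthRate g A B) (hA : 0 ≤ A) (hB : 0 ≤ B)
    {u : ℝ → ℝ → ℝ} (hum : Measurable (Function.uncurry u)) (hu0 : ∀ s, ∀ v ≤ 0, u s v = 0)
    {N : ℝ≥0} (hN : ∀ᵐ s ∂τ, ∫⁻ v, ‖u s v‖ₑ ≤ N) (hvu : ∀ᵐ s ∂τ, Integrable fun v => v * u s v)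
    {ε : ℕ → ℝ} (hε : Tendsto ε atTop (𝓝 0)) (hε0 : ∀ n, 0 < ε n) (hε1 : ∀ n, ε n ≤ 1) :
    (∀ n, Integrable (fun p : ℝ × ℝ => commutator ρ (ε n) (extendGrowth g p.1) (u p.1) p.2)
      (τ.prod vol)) ∧
    Tendsto (fun n => ∫⁻ p, ‖commutator ρ (ε n) (extendGrowth g p.1) (u p.1) p.2‖ₑ ∂(τ.prod vol))
      atTop (𝓝 0) := by
  have hm := fun n => measurable_commutator_param hρ hg.continuous_extend hum (ε n)
  have hsec : ∀ s, Measurable (u s) := fun s => hum.comp measurable_prodMk_left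
  have hγm : ∀ s, Measurable (extendGrowth g s) := fun s =>
    hg.continuous_extend.measurable.comp measurable_prodMk_left
  have hκm : Measurable fun z => ρ z + z * deriv ρ z :=
    (hρ.continuous.add (continuous_id.mul hρ.continuous_deriv)).measurable
  set K : ℝ≥0∞ := ∫⁻ z, ‖ρ z + z * deriv ρ z‖ₑ with hK
  have hKf : K ≠ ⊤ := ((hρ.continuous.add (continuous_id.mul
    hρ.continuous_deriv)).integrable_of_hasCompactSupport
      (hρ.compact.add hρ.compact_mul_deriv)).2.ne
  set M : ℝ≥0∞ := ENNReal.ofReal A * (K * N) + ENNReal.ofReal B * ((∫⁻ z, ‖deriv ρ z‖ₑ) * N)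
  have hM : M ≠ ⊤ := ENNReal.add_ne_top.2 ⟨ENNReal.mul_ne_top (by simp)
    (ENNReal.mul_ne_top hKf (by simp)), ENNReal.mul_ne_top (by simp)
    (ENNReal.mul_ne_top hρ.integrable_deriv.2.ne (by simp))⟩
  have hb : ∀ n, ∀ᵐ s ∂τ, ∫⁻ v, ‖commutator ρ (ε n) (extendGrowth g s) (u s) v‖ₑ ∂vol ≤ M := by
    intro n
    filter_upwards [hτ, hN, hvu] with s hs hNs hvs
    have hui : Integrable (u s) :=
      ⟨(hsec s).aestronglyMeasurable, hNs.trans_lt (by simp)⟩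
    refine (lintegral_commutator_le hρ hg hA hB hs (hγm s)
      (fun v hv => extendGrowth_eq hs hv.le) (hsec s) hui (hu0 s) hvs (hε0 n)).trans ?_
    refine add_le_add (mul_le_mul' le_rfl ?_) (mul_le_mul' ?_ (mul_le_mul' le_rfl hNs))
    · exact (lintegral_enorm_moll_le hκm (hsec s) _).trans (by gcongr)
    · exact ENNReal.ofReal_le_ofReal (mul_le_of_le_one_right hB (hε1 n))
  refine ⟨fun n => ⟨(hm n).aestronglyMeasurable, ?_⟩, ?_⟩
  · rw [HasFiniteIntegral, lintegral_prod _ (hm n).enorm.aemeasurable]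
    refine (lintegral_mono_ae (hb n)).trans_lt ?_
    rw [lintegral_const]
    exact ENNReal.mul_lt_top hM.lt_top (measure_lt_top _ _)
  · have hdct := tendsto_lintegral_of_dominated_convergence (μ := τ)
      (F := fun n s => ∫⁻ v, ‖commutator ρ (ε n) (extendGrowth g s) (u s) v‖ₑ ∂vol)
      (f := fun _ => 0) (fun _ => M)
      (fun n => Measurable.lintegral_prod_right'
        (f := fun p : ℝ × ℝ => ‖commutator ρ (ε n) (extendGrowth g p.1) (u p.1) p.2‖ₑ)
        (hm n).enorm) hb ?_ ?_
    · rw [lintegral_zero] at hdct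
      refine hdct.congr fun n => ?_
      rw [lintegral_prod _ (hm n).enorm.aemeasurable]
    · rw [lintegral_const]
      exact ENNReal.mul_ne_top hM (measure_ne_top _ _)
    · filter_upwards [hτ, hN, hvu] with s hs hNs hvs
      have hui : Integrable (u s) :=
        ⟨(hsec s).aestronglyMeasurable, hNs.trans_lt (by simp)⟩
      exact tendsto_lintegral_commutator hρ hg hA hB hs (hγm s)
        (fun v hv => extendGrowth_eq hs hv.le) (hsec s) hui (hu0 s) hvs hε hε0

/-! ### Kato's inequality -/

/-- `u` solves `∂ₜ u + ∂ᵥ (γ u) = f` on `[0, t]` in the sense of distributions in `v`. -/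
def IsTransportSolution (t : ℝ) (γ f u : ℝ → ℝ → ℝ) : Prop :=
  ∀ r ∈ Icc 0 t, ∀ φ : ℝ → ℝ, ContDiff ℝ ∞ φ → HasCompactSupport φ → tsupport φ ⊆ Ioi 0 →
    ∫ v, φ v * u r v = (∫ v, φ v * u 0 v)
      + ∫ s in (0 : ℝ)..r, ((∫ v, deriv φ v * (γ s v * u s v)) + ∫ v, φ v * f s v)

/-- The equation is tested with `x ↦ ε⁻¹ ρ((x - v) / ε)`. Since `ρ` lives on `(0,1)`, this function
is supported in `[v, v + ε] ⊆ (0,∞)`: looking only to the right of `v` makes the mollified equation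
valid for every `v > 0`, up to the boundary. -/
theorem moll_eq_add_integral {t : ℝ} {γ f u : ℝ → ℝ → ℝ} (h : IsTransportSolution t γ f u)
    {ρ : ℝ → ℝ} (hρ : IsMollifier ρ) {ε : ℝ} (hε : 0 < ε) {v : ℝ} (hv : 0 < v) {r : ℝ}
    (hr : r ∈ Icc 0 t) :
    moll ρ ε (u r) v = moll ρ ε (u 0) v + ∫ s in (0 : ℝ)..r,
      (ε⁻¹ * moll (deriv ρ) ε (fun x => γ s x * u s x) v + moll ρ ε (f s) v) := by
  set φ : ℝ → ℝ := fun x => ε⁻¹ * ρ ((x - v) / ε) with hφ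
  have haff : ContDiff ℝ ∞ fun x : ℝ => (x - v) / ε := by fun_prop
  have hφc : ContDiff ℝ ∞ φ := contDiff_const.mul (hρ.contDiff.comp haff)
  have hd : ∀ x, deriv φ x = ε⁻¹ * (ε⁻¹ * deriv ρ ((x - v) / ε)) := fun x => by
    have h1 : HasDerivAt (fun w => (w - v) / ε) (1 / ε) x := by
      simpa using ((hasDerivAt_id x).sub_const v).div_const ε
    have h2 := (((hρ.differentiable ((x - v) / ε)).hasDerivAt.comp x h1).const_mul ε⁻¹).deriv
    rw [one_div, mul_comm (deriv ρ _)] at h2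
    exact h2
  have hz : ∀ x, φ x ≠ 0 → x ∈ Icc v (v + ε) := fun x hx => by
    by_contra hcon
    refine hx ?_
    have : (x - v) / ε ∉ Ioo (0 : ℝ) 1 := fun hmem => hcon ⟨by
      have := (div_pos_iff_of_pos_right hε).1 hmem.1; linarith, by
      have := (div_lt_one hε).1 hmem.2; linarith⟩
    simp [hφ, hρ.eq_zero this]
  have hts : tsupport φ ⊆ Icc v (v + ε) := closure_minimal hz isClosed_Icc
  have hφs : HasCompactSupport φ := HasCompactSupport.of_support_subset_isCompact isCompact_Icc hz
  have e1 : ∀ w : ℝ → ℝ, ∫ x, φ x * w x = moll ρ ε w v := fun w => by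
    simp only [hφ, mul_assoc]
    rw [integral_const_mul, integral_comp_sub_div_mul _ _ hε, ← mul_assoc,
      inv_mul_cancel₀ hε.ne', one_mul]
  have e2 : ∀ w : ℝ → ℝ, ∫ x, deriv φ x * w x = ε⁻¹ * moll (deriv ρ) ε w v := fun w => by
    simp only [hd, mul_assoc]
    rw [integral_const_mul, integral_const_mul, integral_comp_sub_div_mul _ _ hε,
      ← mul_assoc ε⁻¹ ε, inv_mul_cancel₀ hε.ne', one_mul]
  have := h r hr φ hφc hφs (hts.trans fun x hx => hv.trans_le hx.1)
  simpa only [e1, e2] using this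

theorem prod_vol_eq (τ : Measure ℝ) [SFinite τ] :
    τ.prod vol = (τ.prod volume).restrict (univ ×ˢ Ioi 0) := by
  rw [← Measure.prod_restrict, Measure.restrict_univ]

theorem prod_vol_le (τ : Measure ℝ) [SFinite τ] : τ.prod vol ≤ τ.prod volume := by
  rw [prod_vol_eq]; exact Measure.restrict_le_self

theorem ae_prod_vol_pos (τ : Measure ℝ) [SFinite τ] : ∀ᵐ p ∂(τ.prod vol), 0 < p.2 := by
  rw [prod_vol_eq]
  filter_upwards [ae_restrict_mem (MeasurableSet.univ.prod measurableSet_Ioi)] with p hp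
  exact hp.2

theorem IsTransportWeight.integrable_prod_mul {W W' : ℝ → ℝ} {C : ℝ}
    (hW : IsTransportWeight W W' C) {τ : Measure ℝ} [SFinite τ] {F : ℝ × ℝ → ℝ}
    (hF : Integrable F (τ.prod vol)) : Integrable (fun p => W p.2 * F p) (τ.prod vol) := by
  refine hF.bdd_mul (c := C) (hW.measurable.comp measurable_snd).aestronglyMeasurable ?_
  filter_upwards [ae_prod_vol_pos τ] with p hp
  rw [Real.norm_of_nonneg (hW.pos _ hp).le]
  exact hW.le _ hp

theorem integrable_prod_of_lintegral_le {t : ℝ} {X : ℝ × ℝ → ℝ} (hX : Measurable X) {M : ℝ≥0∞}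
    (hM : M ≠ ⊤) (hXM : ∀ s ∈ Icc 0 t, ∫⁻ v, ‖X (s, v)‖ₑ ≤ M) :
    Integrable X ((volume.restrict (Ioc 0 t)).prod volume) := by
  refine ⟨hX.aestronglyMeasurable, ?_⟩
  rw [HasFiniteIntegral, lintegral_prod _ hX.enorm.aemeasurable]
  refine (setLIntegral_mono' measurableSet_Ioc fun s hs => hXM s (Ioc_subset_Icc_self hs)).trans_lt ?_
  rw [lintegral_const]
  exact ENNReal.mul_lt_top hM.lt_top (measure_lt_top _ _)

theorem integrable_growth_mul_param {t : ℝ} {g : ℝ → ℝ → ℝ} {A B : ℝ} (hg : IsGrowthRate g A B)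
    {u : ℝ → ℝ → ℝ} (hum : Measurable (Function.uncurry u)) (hu0 : ∀ s, ∀ v ≤ 0, u s v = 0)
    (hvu : Integrable (fun p : ℝ × ℝ => p.2 * u p.1 p.2)
      ((volume.restrict (Ioc 0 t)).prod volume)) :
    Integrable (Function.uncurry fun s x => extendGrowth g s x * u s x)
      ((volume.restrict (Ioc 0 t)).prod volume) := by
  refine (hvu.const_mul A).mono (hg.continuous_extend.measurable.mul hum).aestronglyMeasurable ?_
  have : ∀ᵐ p ∂((volume.restrict (Ioc 0 t)).prod (volume : Measure ℝ)), p.1 ∈ Ioc 0 t :=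
    Measure.quasiMeasurePreserving_fst.ae (ae_restrict_mem measurableSet_Ioc)
  filter_upwards [this] with p hp
  simp only [Function.uncurry]
  rcases le_or_gt p.2 0 with hv | hv
  · simp [hu0 _ _ hv]
  · have h0 := hg.nonneg p.1 hp.1.le p.2 hv.le
    have h1 := hg.le_mul hp.1.le hv.le
    rw [extendGrowth_eq hp.1.le hv.le, ← mul_assoc, norm_mul, norm_mul, Real.norm_of_nonneg h0,
      Real.norm_of_nonneg (h0.trans h1)]
    gcongr

/-- Kato's inequality for the mollified equation. -/
theorem kato_mollified {t : ℝ} (ht : 0 ≤ t) {g : ℝ → ℝ → ℝ} {A B : ℝ} (hg : IsGrowthRate g A B)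
    (hA : 0 ≤ A) (hB : 0 ≤ B) {W W' : ℝ → ℝ} {C : ℝ} (hW : IsTransportWeight W W' C)
    {ρ : ℝ → ℝ} (hρ : IsMollifier ρ) {u f : ℝ → ℝ → ℝ}
    (hum : Measurable (Function.uncurry u)) (hfm : Measurable (Function.uncurry f))
    (hu0 : ∀ s, ∀ v ≤ 0, u s v = 0)
    (hui : ∀ s ∈ Icc 0 t, Integrable (u s)) (hvui : ∀ s ∈ Icc 0 t, Integrable fun v => v * u s v)
    (hu : Integrable (Function.uncurry u) ((volume.restrict (Ioc 0 t)).prod volume))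
    (hvu : Integrable (fun p : ℝ × ℝ => p.2 * u p.1 p.2)
      ((volume.restrict (Ioc 0 t)).prod volume))
    (hf : Integrable (Function.uncurry f) ((volume.restrict (Ioc 0 t)).prod volume))
    (hsol : IsTransportSolution t (extendGrowth g) f u) {ε : ℝ} (hε : 0 < ε)
    (hR : Integrable (fun p : ℝ × ℝ => commutator ρ ε (extendGrowth g p.1) (u p.1) p.2)
      ((volume.restrict (Ioc 0 t)).prod vol)) :
    ∫ v, W v * |moll ρ ε (u t) v| ∂vol ≤ (∫ v, W v * |moll ρ ε (u 0) v| ∂vol)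
      + A * (∫ p, W p.2 * |moll ρ ε (u p.1) p.2| ∂((volume.restrict (Ioc 0 t)).prod vol))
      + (∫ p, W p.2 * |commutator ρ ε (extendGrowth g p.1) (u p.1) p.2|
          ∂((volume.restrict (Ioc 0 t)).prod vol))
      + ∫ p, W p.2 * (Real.sign (moll ρ ε (u p.1) p.2) * moll ρ ε (f p.1) p.2)
          ∂((volume.restrict (Ioc 0 t)).prod vol) := by
  set τ : Measure ℝ := volume.restrict (Ioc 0 t) with hτ
  have hsec : ∀ s, Measurable (u s) := fun s => hum.comp measurable_prodMk_left
  have hρm := hρ.continuous.measurable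
  have hγm : ∀ s, Measurable (extendGrowth g s) := fun s =>
    hg.continuous_extend.measurable.comp measurable_prodMk_left
  set U : ℝ × ℝ → ℝ := fun p => moll ρ ε (u p.1) p.2 with hU
  set Tr : ℝ × ℝ → ℝ := fun p =>
    ε⁻¹ * moll (deriv ρ) ε (fun x => extendGrowth g p.1 x * u p.1 x) p.2 with hTr
  set F : ℝ × ℝ → ℝ := fun p => moll ρ ε (f p.1) p.2 with hF
  have hUm : Measurable U := measurable_moll_param hρm hum ε
  have hsm : Measurable fun p => Real.sign (U p) := measurable_real_sign.comp hUm
  have hUi : Integrable U (τ.prod vol) :=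
    (integrable_moll_param hρm hρ.integrable hum hu ε).mono_measure (prod_vol_le τ)
  have hFi : Integrable F (τ.prod vol) :=
    (integrable_moll_param hρm hρ.integrable hfm hf ε).mono_measure (prod_vol_le τ)
  have hTi : Integrable Tr (τ.prod vol) :=
    ((integrable_moll_param hρ.continuous_deriv.measurable hρ.integrable_deriv
      (h := fun s x => extendGrowth g s x * u s x) (hg.continuous_extend.measurable.mul hum)
      (integrable_growth_mul_param hg hum hu0 hvu) ε).mono_measure (prod_vol_le τ)).const_mul _
  have hsg : ∀ {X : ℝ × ℝ → ℝ}, Integrable X (τ.prod vol) →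
      Integrable (fun p => W p.2 * (Real.sign (U p) * X p)) (τ.prod vol) := fun hX =>
    hW.integrable_prod_mul (hX.bdd_mul (c := 1) hsm.aestronglyMeasurable
      (Eventually.of_forall fun _ => abs_sign_le_one _))
  have i1 := hsg hTi
  have i2 := hsg hFi
  have i12 := hsg (hTi.add hFi)
  -- the equation for `|U|` at fixed `v`
  have h1 : ∀ᵐ v ∂vol, W v * |moll ρ ε (u t) v| - W v * |moll ρ ε (u 0) v|
      = ∫ s, W v * (Real.sign (U (s, v)) * (Tr + F) (s, v)) ∂τ := by
    filter_upwards [(hTi.add hFi).prod_left_ae, ae_restrict_mem measurableSet_Ioi] with v hv hv0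
    have := abs_sub_abs_eq_integral_sign (U := fun s => moll ρ ε (u s) v)
      (H := fun s => (Tr + F) (s, v)) ht
      ((intervalIntegrable_iff_integrableOn_Ioc_of_le ht).2 hv)
      fun r hr => moll_eq_add_integral hsol hρ hε hv0 hr
    rw [← mul_sub, this, intervalIntegral.integral_of_le ht, integral_const_mul]
  have j : ∀ r ∈ Icc 0 t, Integrable (fun v => W v * |moll ρ ε (u r) v|) vol := fun r hr =>
    hW.integrableOn_mul (integrable_moll hρm hρ.integrable (hsec r) (hui r hr) ε).abs.integrableOn
  have h2 : (∫ v, W v * |moll ρ ε (u t) v| ∂vol) - ∫ v, W v * |moll ρ ε (u 0) v| ∂vol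
      = ∫ p, W p.2 * (Real.sign (U p) * (Tr + F) p) ∂(τ.prod vol) := by
    rw [← integral_sub (j t ⟨ht, le_rfl⟩) (j 0 ⟨le_rfl, ht⟩), integral_congr_ae h1,
      integral_prod_symm _ i12]
  have h3 : ∫ p, W p.2 * (Real.sign (U p) * (Tr + F) p) ∂(τ.prod vol)
      = (∫ p, W p.2 * (Real.sign (U p) * Tr p) ∂(τ.prod vol))
        + ∫ p, W p.2 * (Real.sign (U p) * F p) ∂(τ.prod vol) := by
    rw [← integral_add i1 i2]
    refine integral_congr_ae (Eventually.of_forall fun p => ?_)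
    simp only [Pi.add_apply]
    ring
  have k1 := hW.integrable_prod_mul hUi.abs
  have k2 := hW.integrable_prod_mul hR.abs
  -- The time integration was carried out at fixed `v`, whereas the transport bound holds at fixed
  -- `s`; Fubini exchanges the two points of view.
  have h4 : ∫ p, W p.2 * (Real.sign (U p) * Tr p) ∂(τ.prod vol)
      ≤ A * (∫ p, W p.2 * |U p| ∂(τ.prod vol))
        + ∫ p, W p.2 * |commutator ρ ε (extendGrowth g p.1) (u p.1) p.2| ∂(τ.prod vol) := by
    rw [integral_prod _ i1, integral_prod _ k1, integral_prod _ k2, ← integral_const_mul,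
      ← integral_add (k1.integral_prod_left.const_mul A) k2.integral_prod_left]
    refine integral_mono_ae i1.integral_prod_left
      ((k1.integral_prod_left.const_mul A).add k2.integral_prod_left) ?_
    filter_upwards [ae_restrict_mem measurableSet_Ioc] with s hs
    exact (integral_weight_sign_mul_transport_le hg hs.1.le hA hB hW hρ (hγm s)
      (fun v hv => extendGrowth_eq hs.1.le (le_of_lt hv)) (hsec s) (hui s ⟨hs.1.le, hs.2⟩) (hu0 s)
      (hvui s ⟨hs.1.le, hs.2⟩) hε).2
  linarith

theorem tendsto_integral_bounded_mul {α : Type*} [MeasurableSpace α] {μ : Measure α}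
    {w : α → ℝ} {C : ℝ} (hw : AEStronglyMeasurable w μ) (hwC : ∀ᵐ x ∂μ, |w x| ≤ C)
    {F : ℕ → α → ℝ} {f : α → ℝ} (hF : ∀ n, Integrable (F n) μ) (hf : Integrable f μ)
    (h : Tendsto (fun n => ∫⁻ x, ‖F n x - f x‖ₑ ∂μ) atTop (𝓝 0)) :
    Tendsto (fun n => ∫ x, w x * |F n x| ∂μ) atTop (𝓝 (∫ x, w x * |f x| ∂μ)) := by
  have hb : ∀ {X : α → ℝ}, Integrable X μ → Integrable (fun x => w x * |X x|) μ := fun hX =>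
    hX.abs.bdd_mul (c := C) hw hwC
  refine tendsto_integral_of_L1 _ (hb hf).1 (Eventually.of_forall fun n => hb (hF n)) ?_
  refine tendsto_of_tendsto_of_tendsto_of_le_of_le tendsto_const_nhds
    (?_ : Tendsto (fun n => ENNReal.ofReal C * ∫⁻ x, ‖F n x - f x‖ₑ ∂μ) atTop (𝓝 0))
    (fun _ => zero_le) fun n => ?_
  · simpa using ENNReal.Tendsto.const_mul h (a := ENNReal.ofReal C) (Or.inr ENNReal.ofReal_ne_top)
  · simp only
    rw [← lintegral_const_mul' _ _ ENNReal.ofReal_ne_top]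
    refine lintegral_mono_ae ?_
    filter_upwards [hwC] with x hx
    rw [← mul_sub, enorm_mul, Real.enorm_eq_ofReal_abs]
    refine mul_le_mul' (ENNReal.ofReal_le_ofReal hx) ?_
    rw [Real.enorm_eq_ofReal_abs, Real.enorm_eq_ofReal_abs]
    exact ENNReal.ofReal_le_ofReal (abs_abs_sub_abs_le_abs_sub _ _)

/-- Although the sign jumps at `0`, `sign y * x` tends to `|x|` as `y → x` for every `x`, including
`x = 0`. -/
theorem abs_sub_sign_mul_le (x y : ℝ) : abs (|x| - Real.sign y * x) ≤ 2 * |y - x| := by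
  have h1 : |x| - Real.sign y * x = (|x| - |y|) + Real.sign y * (y - x) := by
    rw [← sign_mul_self_eq_abs y]; ring
  rw [h1]
  refine (abs_add_le _ _).trans ?_
  have h2 := abs_abs_sub_abs_le_abs_sub x y
  have h3 : |Real.sign y * (y - x)| ≤ |y - x| := by
    rw [abs_mul]; exact mul_le_of_le_one_left (abs_nonneg _) (abs_sign_le_one y)
  rw [abs_sub_comm x y] at h2
  linarith

/-- The factor `l` may be unbounded, as the loss rate is, so `L¹` convergence of `F n` does not give
the limit directly. Along a.e. convergent subsequences the integrands converge and are dominated by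
`|l f|`. -/
theorem tendsto_integral_sign_mul {α : Type*} [MeasurableSpace α] {μ : Measure α}
    {F : ℕ → α → ℝ} {f l : α → ℝ} (hF : ∀ n, Measurable (F n)) (hf : Measurable f)
    (hl : Integrable (fun x => l x * f x) μ) (hlm : Measurable l)
    (h : Tendsto (fun n => ∫⁻ x, ‖F n x - f x‖ₑ ∂μ) atTop (𝓝 0)) :
    Tendsto (fun n => ∫ x, l x * (Real.sign (F n x) * f x) ∂μ) atTop
      (𝓝 (∫ x, l x * |f x| ∂μ)) := by
  refine tendsto_of_subseq_tendsto fun ns hns => ?_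
  have hmeas : TendstoInMeasure μ (fun n => F (ns n)) atTop f := by
    refine tendstoInMeasure_of_tendsto_eLpNorm (p := 1) (by simp)
      (fun n => (hF _).aestronglyMeasurable) hf.aestronglyMeasurable ?_
    simp only [eLpNorm_one_eq_lintegral_enorm, Pi.sub_apply]
    exact h.comp hns
  obtain ⟨ms, -, hms⟩ := hmeas.exists_seq_tendsto_ae
  refine ⟨ms, ?_⟩
  refine tendsto_integral_of_dominated_convergence (fun x => ‖l x * f x‖) (fun n => ?_) hl.norm
    (fun n => Eventually.of_forall fun x => ?_) ?_
  · exact (hlm.mul ((measurable_real_sign.comp (hF _)).mul hf)).aestronglyMeasurable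
  · rw [norm_mul, norm_mul, norm_mul]
    refine mul_le_mul_of_nonneg_left ?_ (norm_nonneg _)
    exact mul_le_of_le_one_left (norm_nonneg _) (abs_sign_le_one _)
  · filter_upwards [hms] with x hx
    refine Tendsto.const_mul _ ?_
    rw [tendsto_iff_dist_tendsto_zero] at hx ⊢
    refine squeeze_zero (fun _ => dist_nonneg) (fun n => ?_) (by simpa using hx.const_mul 2)
    rw [Real.dist_eq, abs_sub_comm, Real.dist_eq]
    exact abs_sub_sign_mul_le _ _

/-- Kato's inequality for `∂ₜ u + ∂ᵥ (g u) = G - L u` with `L ≥ 0`. -/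
theorem kato_inequality {t : ℝ} (ht : 0 ≤ t) {g : ℝ → ℝ → ℝ} {A B : ℝ} (hg : IsGrowthRate g A B)
    (hA : 0 ≤ A) (hB : 0 ≤ B) {W W' : ℝ → ℝ} {C : ℝ} (hW : IsTransportWeight W W' C)
    {u G L : ℝ → ℝ → ℝ} (hum : Measurable (Function.uncurry u))
    (hGm : Measurable (Function.uncurry G)) (hLm : Measurable (Function.uncurry L))
    (hu0 : ∀ s, ∀ v ≤ 0, u s v = 0) {N : ℝ≥0}
    (hN : ∀ s ∈ Icc 0 t, ∫⁻ v, ‖u s v‖ₑ ≤ N) (hvN : ∀ s ∈ Icc 0 t, ∫⁻ v, ‖v * u s v‖ₑ ≤ N)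
    (hG : Integrable (Function.uncurry G) ((volume.restrict (Ioc 0 t)).prod volume))
    (hL : Integrable (fun p : ℝ × ℝ => L p.1 p.2 * u p.1 p.2)
      ((volume.restrict (Ioc 0 t)).prod volume))
    (hsol : IsTransportSolution t (extendGrowth g) (fun s v => G s v - L s v * u s v) u) :
    ∫ v, W v * |u t v| ∂vol ≤ (∫ v, W v * |u 0 v| ∂vol)
      + A * (∫ p, W p.2 * |u p.1 p.2| ∂((volume.restrict (Ioc 0 t)).prod vol))
      + ∫ p, W p.2 * (|G p.1 p.2| - L p.1 p.2 * |u p.1 p.2|)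
          ∂((volume.restrict (Ioc 0 t)).prod vol) := by
  obtain ⟨ρ, hρ⟩ := exists_isMollifier
  have hρm := hρ.continuous.measurable
  set τ : Measure ℝ := volume.restrict (Ioc 0 t) with hτ
  set ε : ℕ → ℝ := fun n => ((n : ℝ) + 1)⁻¹ with hεdef
  have hε : Tendsto ε atTop (𝓝 0) := by
    simpa [one_div] using tendsto_one_div_add_atTop_nhds_zero_nat (𝕜 := ℝ)
  have hε0 : ∀ n, 0 < ε n := fun n => by positivity
  have hε1 : ∀ n, ε n ≤ 1 := fun n =>
    inv_le_one_of_one_le₀ (by linarith [n.cast_nonneg (α := ℝ)])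
  have hsec : ∀ s, Measurable (u s) := fun s => hum.comp measurable_prodMk_left
  have hvum : Measurable fun p : ℝ × ℝ => p.2 * u p.1 p.2 := measurable_snd.mul hum
  have hui : ∀ s ∈ Icc 0 t, Integrable (u s) := fun s hs =>
    ⟨(hsec s).aestronglyMeasurable, (hN s hs).trans_lt (by simp)⟩
  have hvui : ∀ s ∈ Icc 0 t, Integrable fun v => v * u s v := fun s hs =>
    ⟨(measurable_id.mul (hsec s)).aestronglyMeasurable, (hvN s hs).trans_lt (by simp)⟩
  have hmemτ : ∀ᵐ s ∂τ, s ∈ Icc 0 t := by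
    filter_upwards [ae_restrict_mem measurableSet_Ioc] with s hs using Ioc_subset_Icc_self hs
  have hu : Integrable (Function.uncurry u) (τ.prod volume) :=
    integrable_prod_of_lintegral_le hum ENNReal.coe_ne_top hN
  have hvu : Integrable (fun p : ℝ × ℝ => p.2 * u p.1 p.2) (τ.prod volume) :=
    integrable_prod_of_lintegral_le hvum ENNReal.coe_ne_top hvN
  set f : ℝ → ℝ → ℝ := fun s v => G s v - L s v * u s v with hf
  have hfm : Measurable (Function.uncurry f) := hGm.sub (hLm.mul hum)
  have hfi : Integrable (Function.uncurry f) (τ.prod volume) := hG.sub hL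
  obtain ⟨hR, hRlim⟩ := lintegral_commutator_param (τ := τ)
    (hmemτ.mono fun s hs => hs.1) hρ hg hA hB hum hu0 (hmemτ.mono fun s hs => hN s hs)
    (hmemτ.mono fun s hs => hvui s hs) hε hε0 hε1
  have hle := prod_vol_le τ
  have hUm : ∀ n, Measurable fun p : ℝ × ℝ => moll ρ (ε n) (u p.1) p.2 := fun n =>
    measurable_moll_param hρm hum (ε n)
  have hUi : ∀ n, Integrable (fun p : ℝ × ℝ => moll ρ (ε n) (u p.1) p.2) (τ.prod vol) := fun n =>
    (integrable_moll_param hρm hρ.integrable hum hu _).mono_measure hle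
  have hFm : ∀ n, Measurable fun p : ℝ × ℝ => moll ρ (ε n) (f p.1) p.2 := fun n =>
    measurable_moll_param hρm hfm (ε n)
  have hFi : ∀ n, Integrable (fun p : ℝ × ℝ => moll ρ (ε n) (f p.1) p.2) (τ.prod vol) := fun n =>
    (integrable_moll_param hρm hρ.integrable hfm hfi _).mono_measure hle
  have hUlim : Tendsto (fun n => ∫⁻ p : ℝ × ℝ, ‖moll ρ (ε n) (u p.1) p.2 - u p.1 p.2‖ₑ ∂(τ.prod vol))
      atTop (𝓝 0) :=
    tendsto_of_tendsto_of_tendsto_of_le_of_le tendsto_const_nhds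
      (tendsto_lintegral_moll_param_sub hρ hum hu hε hε0) (fun _ => zero_le)
      fun n => lintegral_mono' hle le_rfl
  have hFlim : Tendsto (fun n => ∫⁻ p : ℝ × ℝ, ‖moll ρ (ε n) (f p.1) p.2 - f p.1 p.2‖ₑ ∂(τ.prod vol))
      atTop (𝓝 0) :=
    tendsto_of_tendsto_of_tendsto_of_le_of_le tendsto_const_nhds
      (tendsto_lintegral_moll_param_sub hρ hfm hfi hε hε0) (fun _ => zero_le)
      fun n => lintegral_mono' hle le_rfl
  have hWm : AEStronglyMeasurable (fun p : ℝ × ℝ => W p.2) (τ.prod vol) :=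
    (hW.measurable.comp measurable_snd).aestronglyMeasurable
  have hWC : ∀ᵐ p ∂(τ.prod vol), |W p.2| ≤ C := by
    filter_upwards [ae_prod_vol_pos τ] with p hp
    rw [abs_of_pos (hW.pos _ hp)]; exact hW.le _ hp
  have hWC' : ∀ᵐ v ∂vol, |W v| ≤ C := by
    filter_upwards [ae_restrict_mem measurableSet_Ioi] with v hv
    rw [abs_of_pos (hW.pos _ hv)]; exact hW.le _ hv
  -- the limits of the terms
  have hslice : ∀ r ∈ Icc 0 t, Tendsto (fun n => ∫ v, W v * |moll ρ (ε n) (u r) v| ∂vol) atTop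
      (𝓝 (∫ v, W v * |u r v| ∂vol)) := fun r hr => by
    refine tendsto_integral_bounded_mul hW.measurable.aestronglyMeasurable hWC'
      (fun n => (integrable_moll hρm hρ.integrable (hsec r) (hui r hr) _).integrableOn)
      (hui r hr).integrableOn ?_
    have := tendsto_lintegral_moll_sub hρ.continuous hρ.compact (hui r hr) (hsec r) hε
      fun n => (hε0 n).ne'
    simp only [hρ.integral_eq_one, one_mul] at this
    exact tendsto_of_tendsto_of_tendsto_of_le_of_le tendsto_const_nhds this (fun _ => zero_le)
      fun n => setLIntegral_le_lintegral _ _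
  have l3 := tendsto_integral_bounded_mul hWm hWC hUi (hu.mono_measure hle) hUlim
  have l4 := tendsto_integral_bounded_mul hWm hWC hR (integrable_zero _ _ _)
    (by simpa using hRlim)
  have l5 := tendsto_integral_bounded_mul hWm hWC
    (fun n => (hFi n).sub (hfi.mono_measure hle)) (integrable_zero _ _ _)
    (by simpa [Function.uncurry] using hFlim)
  have hLv := hL.mono_measure hle
  have hGv := hG.mono_measure hle
  have hWLu : Integrable (fun p : ℝ × ℝ => (W p.2 * L p.1 p.2) * u p.1 p.2) (τ.prod vol) := by
    simpa only [mul_assoc] using hW.integrable_prod_mul hLv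
  have l6 := tendsto_integral_sign_mul hUm hum hWLu
    ((hW.measurable.comp measurable_snd).mul hLm) hUlim
  have hGa : Integrable (fun p : ℝ × ℝ => W p.2 * |G p.1 p.2|) (τ.prod vol) :=
    hW.integrable_prod_mul hGv.abs
  -- the source term
  have hsrc : ∀ n, ∫ p, W p.2 * (Real.sign (moll ρ (ε n) (u p.1) p.2) * moll ρ (ε n) (f p.1) p.2)
      ∂(τ.prod vol) ≤ (∫ p, W p.2 * |moll ρ (ε n) (f p.1) p.2 - f p.1 p.2| ∂(τ.prod vol))
        + (∫ p, W p.2 * |G p.1 p.2| ∂(τ.prod vol))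
        - ∫ p, (W p.2 * L p.1 p.2) * (Real.sign (moll ρ (ε n) (u p.1) p.2) * u p.1 p.2)
          ∂(τ.prod vol) := fun n => by
    have hsm : Measurable fun p : ℝ × ℝ => Real.sign (moll ρ (ε n) (u p.1) p.2) :=
      measurable_real_sign.comp (hUm n)
    have a1 := hW.integrable_prod_mul ((hFi n).bdd_mul (c := 1) hsm.aestronglyMeasurable
      (Eventually.of_forall fun _ => abs_sign_le_one _))
    have a2 : Integrable (fun p : ℝ × ℝ => W p.2 * |moll ρ (ε n) (f p.1) p.2 - f p.1 p.2|)
        (τ.prod vol) := hW.integrable_prod_mul ((hFi n).sub (hfi.mono_measure hle)).abs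
    have a3 : Integrable (fun p : ℝ × ℝ => (W p.2 * L p.1 p.2) *
        (Real.sign (moll ρ (ε n) (u p.1) p.2) * u p.1 p.2)) (τ.prod vol) := by
      have := hWLu.bdd_mul (c := 1) hsm.aestronglyMeasurable
        (Eventually.of_forall fun _ => abs_sign_le_one _)
      refine this.congr (Eventually.of_forall fun p => ?_)
      simp only
      ring
    have a4 : Integrable (fun p : ℝ × ℝ => W p.2 * |moll ρ (ε n) (f p.1) p.2 - f p.1 p.2|
        + W p.2 * |G p.1 p.2|) (τ.prod vol) := a2.add hGa
    rw [← integral_add a2 hGa, ← integral_sub a4 a3]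
    refine integral_mono_ae a1 (a4.sub a3) ?_
    filter_upwards [ae_prod_vol_pos τ] with p hp
    have hWp := (hW.pos _ hp).le
    set σ := Real.sign (moll ρ (ε n) (u p.1) p.2)
    have hb : ∀ x, σ * x ≤ |x| := fun x => (le_abs_self _).trans (by
      rw [abs_mul]; exact mul_le_of_le_one_left (abs_nonneg _) (abs_sign_le_one _))
    have b1 := hb (moll ρ (ε n) (f p.1) p.2 - f p.1 p.2)
    have b2 := hb (G p.1 p.2)
    -- The mollified source is replaced by the source at the price of an `L¹` error. The part `G` is
    -- estimated by `|G|`, but the loss is kept exactly, because its limit `-L |u|` is needed with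
    -- its sign.
    have b3 : σ * moll ρ (ε n) (f p.1) p.2 ≤ |moll ρ (ε n) (f p.1) p.2 - f p.1 p.2| + |G p.1 p.2|
        - L p.1 p.2 * (σ * u p.1 p.2) := by
      have : σ * moll ρ (ε n) (f p.1) p.2 = σ * (moll ρ (ε n) (f p.1) p.2 - f p.1 p.2)
          + σ * G p.1 p.2 - L p.1 p.2 * (σ * u p.1 p.2) := by simp only [hf]; ring
      linarith
    calc _ ≤ W p.2 * (|moll ρ (ε n) (f p.1) p.2 - f p.1 p.2| + |G p.1 p.2|
        - L p.1 p.2 * (σ * u p.1 p.2)) := mul_le_mul_of_nonneg_left b3 hWp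
      _ = _ := by ring
  have hlim := (((hslice 0 ⟨le_rfl, ht⟩).add (l3.const_mul A)).add l4).add
    ((l5.add_const (∫ p, W p.2 * |G p.1 p.2| ∂(τ.prod vol))).sub l6)
  have hfinal := le_of_tendsto_of_tendsto' (hslice t ⟨ht, le_rfl⟩) hlim fun n =>
    (kato_mollified ht hg hA hB hW hρ hum hfm hu0 hui hvui hu hvu hfi hsol (hε0 n) (hR n)).trans
      (add_le_add le_rfl (hsrc n))
  refine hfinal.trans (le_of_eq ?_)
  have hLa : Integrable (fun p : ℝ × ℝ => (W p.2 * L p.1 p.2) * |u p.1 p.2|) (τ.prod vol) := by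
    refine hWLu.norm.mono ((((hW.measurable.comp measurable_snd).mul hLm).mul
      hum.norm).aestronglyMeasurable) (Eventually.of_forall fun p => ?_)
    simp
  have : ∫ p, W p.2 * (|G p.1 p.2| - L p.1 p.2 * |u p.1 p.2|) ∂(τ.prod vol)
      = (∫ p, W p.2 * |G p.1 p.2| ∂(τ.prod vol))
        - ∫ p, (W p.2 * L p.1 p.2) * |u p.1 p.2| ∂(τ.prod vol) := by
    rw [← integral_sub hGa hLa]
    refine integral_congr_ae (Eventually.of_forall fun p => ?_)
    simp only
    ring
  rw [this]
  simp [Function.uncurry]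

/-! ### The weight and the domination of the kernel -/

theorem one_le_weight {m r v : ℝ} (hm : m ≤ 0) (hr : 0 ≤ r) (hv : 0 < v) : 1 ≤ weight m r v := by
  rw [weight]
  rcases le_total v 1 with h | h
  · linarith [Real.one_le_rpow_of_pos_of_le_one_of_nonpos hv h hm, Real.rpow_nonneg hv.le r]
  · linarith [Real.rpow_nonneg hv.le m, Real.one_le_rpow h hr]

theorem le_weight {β v : ℝ} (hv : 0 < v) : v ≤ weight (-β) 1 v := by
  rw [weight, Real.rpow_one]
  linarith [Real.rpow_nonneg hv.le (-β)]

theorem weight_nonneg {m r v : ℝ} (hv : 0 ≤ v) : 0 ≤ weight m r v :=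
  add_nonneg (Real.rpow_nonneg hv _) (Real.rpow_nonneg hv _)

theorem measurable_weight (m r : ℝ) : Measurable (weight m r) := by
  unfold weight
  fun_prop

/-- This is `(a + b)² ≤ 2 (a² + b²)`. It turns the assumed bound in `L¹_{-2β,2}` into a bound on `∫
w² p`. -/
theorem weight_sq_le {β v : ℝ} (hv : 0 < v) :
    weight (-β) 1 v ^ 2 ≤ 2 * weight (-2 * β) 2 v := by
  have h1 : v ^ (-2 * β) = (v ^ (-β)) ^ 2 := by
    rw [← Real.rpow_natCast, ← Real.rpow_mul hv.le]
    congr 1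
    push_cast
    ring
  rw [weight, weight, h1, Real.rpow_one, Real.rpow_two]
  nlinarith [sq_nonneg (v ^ (-β) - v)]

/-- Each bound on `K` is a product of summands of the two weights, except when both sizes exceed
`1`: there `x + y ≤ 2 x y` produces the factor `2`. The hypotheses say nothing on the lines where a
size equals `1`, which form a null set. -/
theorem IsCoagulationKernel.le_weight_mul {K : ℝ → ℝ → ℝ} {β k : ℝ} (hK : IsCoagulationKernel K β k)
    (hk : 0 < k) {x y : ℝ} (hx : 0 < x) (hy : 0 < y) (hx1 : x ≠ 1) (hy1 : y ≠ 1) :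
    K x y ≤ 2 * k * (weight (-β) 1 x * weight (-β) 1 y) := by
  have hxb := Real.rpow_nonneg hx.le (-β)
  have hyb := Real.rpow_nonneg hy.le (-β)
  simp only [weight, Real.rpow_one]
  have aux : ∀ a b c d : ℝ, 0 ≤ a → 0 ≤ b → 0 ≤ c → 0 ≤ d →
      k * (a * b) ≤ 2 * k * ((a + c) * (b + d)) := fun a b c d ha hb hc hd => by
    have h1 : a * b ≤ (a + c) * (b + d) := by gcongr <;> linarith
    have h2 : 0 ≤ k * (a * b) := by positivity
    nlinarith
  rcases lt_or_gt_of_ne hx1 with h | h <;> rcases lt_or_gt_of_ne hy1 with h' | h'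
  · refine (hK.le_small_small x ⟨hx, h⟩ y ⟨hy, h'⟩).trans ?_
    rw [Real.mul_rpow hx.le hy.le]
    exact aux _ _ _ _ hxb hyb hx.le hy.le
  · refine (hK.le_small_large x ⟨hx, h⟩ y h').trans ?_
    have := aux _ _ _ _ hxb hy.le hx.le hyb
    linarith
  · rw [hK.symm x hx y hy]
    refine (hK.le_small_large y ⟨hy, h'⟩ x h).trans ?_
    have := aux _ _ _ _ hx.le hyb hxb hy.le
    linarith
  · refine (hK.le_large_large x h y h').trans ?_
    have h1 : x + y ≤ 2 * (x * y) := by nlinarith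
    have h2 : x * y ≤ (x ^ (-β) + x) * (y ^ (-β) + y) := by gcongr <;> linarith
    have := mul_le_mul_of_nonneg_left (h1.trans (mul_le_mul_of_nonneg_left h2 zero_le_two)) hk.le
    linarith

/-- A measurable symmetric kernel supported in the quadrant `(0,∞)²` and dominated by
`κ w(x) w(y)`. -/
structure IsDominatedKernel (K : ℝ → ℝ → ℝ) (w : ℝ → ℝ) (κ : ℝ) : Prop where
  measurable : Measurable (Function.uncurry K)
  const_nonneg : 0 ≤ κ
  nonneg : ∀ x y, 0 ≤ K x y
  symm : ∀ x y, K x y = K y x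
  le : ∀ x > 0, ∀ y > 0, K x y ≤ κ * (w x * w y)

/-- A measurable representative of `K` is symmetrised and truncated between `0` and the bound. This
enforces everywhere what `K` satisfies a.e. on the quadrant, so `K` changes only on a null set,
which the weak formulation does not see. -/
theorem IsCoagulationKernel.exists_dominated {K : ℝ → ℝ → ℝ} {β k : ℝ}
    (hK : IsCoagulationKernel K β k) (hk : 0 < k) :
    ∃ K' : ℝ → ℝ → ℝ, IsDominatedKernel K' (weight (-β) 1) (2 * k) ∧
      Function.uncurry K' =ᵐ[vol.prod vol] Function.uncurry K := by
  have hae : AEMeasurable (Function.uncurry K) (vol.prod vol) := by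
    rw [Measure.prod_restrict]; exact hK.aemeasurable
  set H := hae.mk with hH
  have hHm : Measurable H := hae.measurable_mk
  set b : ℝ → ℝ → ℝ := fun x y => 2 * k * (weight (-β) 1 x * weight (-β) 1 y) with hb
  have hbm : Measurable (Function.uncurry b) := by
    have := measurable_weight (-β) 1
    simp only [hb, Function.uncurry_def]
    fun_prop
  refine ⟨fun x y => max 0 (min (b x y) ((H (x, y) + H (y, x)) / 2)), ⟨?_, by positivity, ?_, ?_, ?_⟩, ?_⟩
  · refine measurable_const.max (hbm.min ?_)
    exact (hHm.add (hHm.comp measurable_swap)).div_const 2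
  · exact fun x y => le_max_left _ _
  · intro x y
    simp only [hb]
    rw [mul_comm (weight (-β) 1 x), add_comm (H (x, y))]
  · intro x hx y hy
    refine max_le ?_ (min_le_left _ _)
    have := weight_nonneg (m := -β) (r := 1) hx.le
    have := weight_nonneg (m := -β) (r := 1) hy.le
    positivity
  · have h1 : Function.uncurry K =ᵐ[vol.prod vol] H := hae.ae_eq_mk
    have h2 : ∀ᵐ q ∂(vol.prod vol), Function.uncurry K q.swap = H q.swap :=
      (Measure.measurePreserving_swap (μ := vol) (ν := vol)).quasiMeasurePreserving.ae h1
    have h3 : ∀ᵐ x ∂vol, 0 < x ∧ x ≠ 1 := by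
      filter_upwards [ae_restrict_mem measurableSet_Ioi,
        ae_restrict_of_ae (Measure.ae_ne volume (1 : ℝ))] with x hx hx1 using ⟨hx, hx1⟩
    filter_upwards [h1, h2, (Measure.quasiMeasurePreserving_fst (μ := vol) (ν := vol)).ae h3,
      (Measure.quasiMeasurePreserving_snd (μ := vol) (ν := vol)).ae h3] with q e1 e2 e3 e4
    have hq : H (q.1, q.2) = K q.1 q.2 := e1.symm
    have hq' : H (q.2, q.1) = K q.1 q.2 := by
      rw [hK.symm _ e3.1 _ e4.1]; exact e2.symm
    simp only [Function.uncurry, hq, hq']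
    rw [add_self_div_two, min_eq_right (hK.le_weight_mul hk e3.1 e4.1 e3.2 e4.2),
      max_eq_right (hK.nonneg _ e3.1 _ e4.1)]

theorem integrable_of_weight {m r : ℝ} (hm : m ≤ 0) (hr : 0 ≤ r) {c : ℝ → ℝ}
    (hc : MemWeightedL1 m r c) :
    Integrable c vol := by
  have h1 : ∀ᵐ v ∂vol, c v = (weight m r v)⁻¹ * (weight m r v * c v) := by
    filter_upwards [ae_restrict_mem measurableSet_Ioi] with v hv
    have := one_le_weight hm hr hv
    field_simp
  refine (Integrable.congr ?_ (h1.mono fun v hv => hv.symm))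
  refine Integrable.bdd_mul (c := 1) hc (measurable_weight _ _).inv.aestronglyMeasurable ?_
  filter_upwards [ae_restrict_mem measurableSet_Ioi] with v hv
  have := one_le_weight hm hr hv
  rw [norm_inv, Real.norm_of_nonneg (by linarith)]
  exact inv_le_one_of_one_le₀ this

/-! ### Jointly measurable versions of weakly continuous families -/

/-- A weakly continuous family of non-negative functions has a jointly measurable version. -/
theorem IsWeaklyContinuous.exists_measurable_version {T β : ℝ} (hT : 0 ≤ T) (hβ : 0 < β)
    {c : ℝ → ℝ → ℝ} (hc : IsWeaklyContinuous T (-β) 1 c)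
    (hc0 : ∀ t ∈ Icc 0 T, ∀ᵐ v ∂vol, 0 ≤ c t v) :
    ∃ c' : ℝ → ℝ → ℝ, Measurable (Function.uncurry c') ∧ (∀ s v, 0 ≤ c' s v) ∧
      (∀ s, ∀ v ≤ 0, c' s v = 0) ∧ ∀ s ∈ Icc 0 T, c' s =ᵐ[vol] c s := by
  set π : ℝ → ℝ := fun s => (projIcc 0 T hT s : ℝ) with hπ
  have hπm : ∀ s, π s ∈ Icc 0 T := fun s => (projIcc 0 T hT s).2
  have hπc : Continuous π := continuous_subtype_val.comp continuous_projIcc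
  -- The distribution functions are continuous in `s` by weak continuity and monotone in `v` by
  -- non-negativity, hence jointly measurable. The density is recovered from them by Lebesgue
  -- differentiation. The projection `π` onto `[0,T]` makes them defined for all times.
  set F : ℝ → ℝ → ℝ := fun s v => ∫ x in Iic v, c (π s) x ∂vol with hF
  have hint : ∀ s, Integrable (c (π s)) vol := fun s => integrable_of_weight (neg_nonpos.2 hβ.le) zero_le_one (hc.mem _ (hπm s))
  have hFmono : ∀ s, Monotone (F s) := fun s a b hab =>
    setIntegral_mono_set (hint s).integrableOn
      (ae_restrict_of_ae (hc0 _ (hπm s))) (Iic_subset_Iic.2 hab).eventuallyLE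
  have hFcont : ∀ v, Continuous fun s => F s v := by
    intro v
    -- This test function cancels the weight built into the weak topology; it is bounded because the
    -- weight is at least `1`.
    set ψ : ℝ → ℝ := (Iic v).indicator fun x => (weight (-β) 1 x)⁻¹ with hψ
    have hψm : Measurable ψ := (measurable_weight _ _).inv.indicator measurableSet_Iic
    have hψL : MemLp ψ ⊤ vol := by
      refine memLp_top_of_bound hψm.aestronglyMeasurable 1 ?_
      filter_upwards [ae_restrict_mem measurableSet_Ioi] with x hx
      have := one_le_weight (neg_nonpos.2 hβ.le) zero_le_one hx
      refine (norm_indicator_le_norm_self _ _).trans ?_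
      rw [norm_inv, Real.norm_of_nonneg (by linarith)]
      exact inv_le_one_of_one_le₀ this
    have := (hc.continuousOn ψ hψL).comp_continuous hπc hπm
    refine this.congr fun s => ?_
    simp only [hF]
    rw [← integral_indicator measurableSet_Iic]
    refine integral_congr_ae ?_
    filter_upwards [ae_restrict_mem measurableSet_Ioi] with x hx
    have := one_le_weight (neg_nonpos.2 hβ.le) zero_le_one hx
    by_cases h : x ∈ Iic v
    · simp only [hψ, indicator_of_mem h]
      field_simp
    · simp [hψ, indicator_of_notMem h]
  have hFm : Measurable (Function.uncurry F) :=
    measurable_uncurry_of_continuous_of_measurable hFcont fun s => (hFmono s).measurable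
  -- Difference quotients in `[0,∞]`: their limsup is measurable whether or not they converge, and
  -- equals the density wherever they do.
  set Q : ℕ → ℝ × ℝ → ℝ≥0∞ := fun n q =>
    ENNReal.ofReal (((n : ℝ) + 1) * (F q.1 (q.2 + ((n : ℝ) + 1)⁻¹) - F q.1 q.2)) with hQ
  have hQm : ∀ n, Measurable (Q n) := fun n => by
    have h1 : Measurable fun q : ℝ × ℝ => F q.1 (q.2 + ((n : ℝ) + 1)⁻¹) :=
      hFm.comp (f := fun q : ℝ × ℝ => (q.1, q.2 + ((n : ℝ) + 1)⁻¹)) (by fun_prop)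
    exact ((h1.sub hFm).const_mul _).ennreal_ofReal
  set D : ℝ × ℝ → ℝ := fun q => (limsup (fun n => Q n q) atTop).toReal with hD
  have hDm : Measurable D := (Measurable.limsup hQm).ennreal_toReal
  refine ⟨fun s v => (Ioi (0 : ℝ)).indicator (fun v => D (s, v)) v, ?_, ?_, ?_, ?_⟩
  · have : (Function.uncurry fun s v => (Ioi (0 : ℝ)).indicator (fun v => D (s, v)) v)
        = (Prod.snd ⁻¹' Ioi (0 : ℝ)).indicator D := by
      ext q
      simp [Function.uncurry, indicator]
    rw [this]
    exact hDm.indicator (measurable_snd measurableSet_Ioi)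
  · exact fun s v => indicator_nonneg (fun _ _ => ENNReal.toReal_nonneg) _
  · exact fun s v hv => indicator_of_notMem (by simpa using hv) _
  · intro s hs
    have hπs : π s = s := by simp [hπ, projIcc_of_mem hT hs]
    set h : ℝ → ℝ := (Ioi (0 : ℝ)).indicator (c s) with hh
    have hi : Integrable h := by
      have := hint s
      rw [hπs] at this
      exact (integrable_indicator_iff measurableSet_Ioi).2 this
    have hFh : ∀ v, F s v = ∫ x in Iic v, h x := fun v => by
      simp only [hF, hπs, hh]
      rw [Measure.restrict_restrict measurableSet_Iic, setIntegral_indicator measurableSet_Ioi]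
    have hae := ae_restrict_of_ae (s := Ioi (0 : ℝ))
      (_root_.LocallyIntegrable.ae_hasDerivAt_integral hi.locallyIntegrable)
    filter_upwards [hae, hc0 s hs, ae_restrict_mem measurableSet_Ioi] with v hv hcv hv0
    have hd := hv 0
    have hhv : h v = c s v := indicator_of_mem hv0 _
    rw [hhv] at hd
    have hlim0 : Tendsto (fun n : ℕ => ((n : ℝ) + 1)⁻¹) atTop (𝓝[>] 0) := by
      refine tendsto_nhdsWithin_iff.2 ⟨by
        simpa [one_div] using tendsto_one_div_add_atTop_nhds_zero_nat (𝕜 := ℝ),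
        Eventually.of_forall fun n => ?_⟩
      exact (by positivity : (0 : ℝ) < ((n : ℝ) + 1)⁻¹)
    have hlim := (hd.tendsto_slope_zero_right).comp hlim0
    have hlimQ : Tendsto (fun n => Q n (s, v)) atTop (𝓝 (ENNReal.ofReal (c s v))) := by
      refine ENNReal.tendsto_ofReal (hlim.congr fun n => ?_)
      simp only [Function.comp_apply, inv_inv, smul_eq_mul]
      rw [hFh, hFh, intervalIntegral.integral_Iic_sub_Iic hi.integrableOn hi.integrableOn,
        intervalIntegral.integral_interval_sub_left hi.intervalIntegrable hi.intervalIntegrable]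
    rw [indicator_of_mem hv0]
    simp only [hD]
    rw [hlimQ.limsup_eq, ENNReal.toReal_ofReal hcv]

theorem IsWeaklyContinuous.exists_bound {T m r : ℝ} {c : ℝ → ℝ → ℝ}
    (hc : IsWeaklyContinuous T m r c) :
    ∃ N : ℝ, ∀ s ∈ Icc 0 T, ∫ v, weight m r v * c s v ∂vol ≤ N := by
  have h1 : MemLp (fun _ : ℝ => (1 : ℝ)) ⊤ vol := memLp_top_const 1
  have h2 := hc.continuousOn _ h1
  simp only [one_mul] at h2
  obtain ⟨N, hN⟩ := isCompact_Icc.exists_bound_of_continuousOn h2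
  exact ⟨N, fun s hs => (le_abs_self _).trans (hN s hs)⟩

/-! ### The linearised coagulation operator -/

/-- The density of collision events between the densities `u` and `p`. -/
def collision (K : ℝ → ℝ → ℝ) (p u : ℝ → ℝ) (x y : ℝ) : ℝ := K x y * p y * u x

/-- The density of particles created by the collisions. -/
noncomputable def gain (K : ℝ → ℝ → ℝ) (p u : ℝ → ℝ) (v : ℝ) : ℝ :=
  1 / 2 * ∫ y, collision K p u (v - y) y

/-- The loss of particles of the density `p` through collisions with `u`. -/
noncomputable def crossLoss (K : ℝ → ℝ → ℝ) (p u : ℝ → ℝ) (v : ℝ) : ℝ :=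
  1 / 2 * ∫ x, collision K p u x v

/-- The rate at which particles of size `v` are lost through collisions with `p`. -/
noncomputable def lossRate (K : ℝ → ℝ → ℝ) (p : ℝ → ℝ) (v : ℝ) : ℝ := 1 / 2 * ∫ y, K v y * p y

theorem lossRate_mul (K : ℝ → ℝ → ℝ) (p u : ℝ → ℝ) (v : ℝ) :
    lossRate K p v * u v = 1 / 2 * ∫ y, collision K p u v y := by
  simp only [lossRate, collision]
  rw [integral_mul_const]
  ring

theorem collision_param_measurable {K : ℝ → ℝ → ℝ} (hK : Measurable (Function.uncurry K))
    {p u : ℝ → ℝ → ℝ} (hp : Measurable (Function.uncurry p)) (hu : Measurable (Function.uncurry u))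
    {α : Type*} [MeasurableSpace α] {S X Y : α → ℝ} (hS : Measurable S) (hX : Measurable X)
    (hY : Measurable Y) :
    Measurable fun a => collision K (p (S a)) (u (S a)) (X a) (Y a) := by
  have h1 : Measurable fun a => K (X a) (Y a) := hK.comp (hX.prodMk hY)
  have h2 : Measurable fun a => p (S a) (Y a) := hp.comp (hS.prodMk hY)
  have h3 : Measurable fun a => u (S a) (X a) := hu.comp (hS.prodMk hX)
  exact (h1.mul h2).mul h3

section Param
variable {K : ℝ → ℝ → ℝ} {p u : ℝ → ℝ → ℝ}

theorem measurable_gain (hK : Measurable (Function.uncurry K))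
    (hp : Measurable (Function.uncurry p)) (hu : Measurable (Function.uncurry u)) :
    Measurable (Function.uncurry fun s => gain K (p s) (u s)) := by
  have := (collision_param_measurable hK hp hu (α := (ℝ × ℝ) × ℝ) (S := fun a => a.1.1)
    (X := fun a => a.1.2 - a.2) (Y := fun a => a.2) (by fun_prop) (by fun_prop)
    (by fun_prop)).stronglyMeasurable
  exact this.integral_prod_right.measurable.const_mul _

theorem measurable_crossLoss (hK : Measurable (Function.uncurry K))
    (hp : Measurable (Function.uncurry p)) (hu : Measurable (Function.uncurry u)) :
    Measurable (Function.uncurry fun s => crossLoss K (p s) (u s)) := by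
  have := (collision_param_measurable hK hp hu (α := (ℝ × ℝ) × ℝ) (S := fun a => a.1.1)
    (X := fun a => a.2) (Y := fun a => a.1.2) (by fun_prop) (by fun_prop)
    (by fun_prop)).stronglyMeasurable
  exact this.integral_prod_right.measurable.const_mul _

theorem measurable_lossRate (hK : Measurable (Function.uncurry K))
    (hp : Measurable (Function.uncurry p)) :
    Measurable (Function.uncurry fun s => lossRate K (p s)) := by
  have := (collision_param_measurable hK hp (measurable_const (a := (1 : ℝ)))
    (u := fun _ _ => 1) (α := (ℝ × ℝ) × ℝ) (S := fun a => a.1.1)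
    (X := fun a => a.1.2) (Y := fun a => a.2) (by fun_prop) (by fun_prop)
    (by fun_prop)).stronglyMeasurable
  simp only [collision, mul_one] at this
  exact this.integral_prod_right.measurable.const_mul _

end Param

/-- A pair of densities on `(0,∞)`, the first one non-negative, with finite `w`-moments. -/
structure IsCollisionPair (w p u : ℝ → ℝ) : Prop where
  measurable_left : Measurable p
  measurable_right : Measurable u
  nonneg : ∀ v, 0 ≤ p v
  left_eq_zero : ∀ v ≤ 0, p v = 0
  right_eq_zero : ∀ v ≤ 0, u v = 0
  integrable_left : Integrable fun v => w v * p v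
  integrable_right : Integrable fun v => w v * u v

section Static
variable {K : ℝ → ℝ → ℝ} {w p u : ℝ → ℝ} {κ : ℝ}

theorem measurable_collision (hK : IsDominatedKernel K w κ) (h : IsCollisionPair w p u) :
    Measurable fun q : ℝ × ℝ => collision K p u q.1 q.2 :=
  (hK.measurable.mul (h.measurable_left.comp measurable_snd)).mul
    (h.measurable_right.comp measurable_fst)

/-- Both densities vanish on `(-∞,0]`, so the kernel bound on the quadrant controls the collisions
on the whole plane and integrals may be taken over `ℝ`. -/
theorem abs_collision_le (hK : IsDominatedKernel K w κ) (h : IsCollisionPair w p u) (x y : ℝ) :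
    |collision K p u x y| ≤ κ * (|w x * u x| * |w y * p y|) := by
  rcases le_or_gt x 0 with hx | hx
  · simp [collision, h.right_eq_zero x hx]
  rcases le_or_gt y 0 with hy | hy
  · simp [collision, h.left_eq_zero y hy]
  have hκ := hK.const_nonneg
  have h1 : K x y ≤ κ * (|w x| * |w y|) := (hK.le x hx y hy).trans (by
    rw [← abs_mul]; gcongr; exact le_abs_self _)
  rw [collision, abs_mul, abs_mul, abs_of_nonneg (hK.nonneg x y), abs_mul, abs_mul]
  calc K x y * |p y| * |u x| ≤ κ * (|w x| * |w y|) * |p y| * |u x| := by gcongr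
    _ = _ := by ring

theorem integrable_collision (hK : IsDominatedKernel K w κ) (h : IsCollisionPair w p u) :
    Integrable (fun q : ℝ × ℝ => collision K p u q.1 q.2) (volume.prod volume) := by
  refine ((h.integrable_right.abs.mul_prod h.integrable_left.abs).const_mul κ).mono'
    (measurable_collision hK h).aestronglyMeasurable (Eventually.of_forall fun q => ?_)
  exact abs_collision_le hK h q.1 q.2

theorem lintegral_collision_le (hK : IsDominatedKernel K w κ) (h : IsCollisionPair w p u) :
    ∫⁻ q : ℝ × ℝ, ‖collision K p u q.1 q.2‖ₑ ∂(volume.prod volume)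
      ≤ ENNReal.ofReal κ * ((∫⁻ v, ‖w v * u v‖ₑ) * ∫⁻ v, ‖w v * p v‖ₑ) := by
  have h1 := h.integrable_right.1.enorm
  have h2 := h.integrable_left.1.enorm
  rw [← lintegral_prod_mul h1 h2, ← lintegral_const_mul' _ _ ENNReal.ofReal_ne_top]
  refine lintegral_mono fun q => ?_
  rw [Real.enorm_eq_ofReal_abs, Real.enorm_eq_ofReal_abs, Real.enorm_eq_ofReal_abs,
    ← ENNReal.ofReal_mul (abs_nonneg _), ← ENNReal.ofReal_mul hK.const_nonneg]
  exact ENNReal.ofReal_le_ofReal (abs_collision_le hK h q.1 q.2)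

theorem integrable_collision_shift (hK : IsDominatedKernel K w κ) (h : IsCollisionPair w p u) :
    Integrable (fun q : ℝ × ℝ => collision K p u (q.1 - q.2) q.2) (volume.prod volume) :=
  (measurePreserving_sub_prod (volume : Measure ℝ) (volume : Measure ℝ)).integrable_comp_of_integrable
    (integrable_collision hK h)

theorem integral_shift {f : ℝ × ℝ → ℝ} (hf : AEStronglyMeasurable f (volume.prod volume)) :
    ∫ q : ℝ × ℝ, f (q.1 - q.2, q.2) ∂(volume.prod volume) = ∫ q, f q ∂(volume.prod volume) := by
  have hT := measurePreserving_sub_prod (volume : Measure ℝ) (volume : Measure ℝ)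
  have := integral_map hT.measurable.aemeasurable (f := f) (by rwa [hT.map_eq])
  rw [hT.map_eq] at this
  exact this.symm

theorem integrable_gain (hK : IsDominatedKernel K w κ) (h : IsCollisionPair w p u) :
    Integrable (gain K p u) :=
  (integrable_collision_shift hK h).integral_prod_left.const_mul _

theorem integrable_crossLoss (hK : IsDominatedKernel K w κ) (h : IsCollisionPair w p u) :
    Integrable (crossLoss K p u) :=
  (integrable_collision hK h).integral_prod_right.const_mul _

theorem integrable_lossRate_mul (hK : IsDominatedKernel K w κ) (h : IsCollisionPair w p u) :
    Integrable fun v => lossRate K p v * u v := by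
  simp only [lossRate_mul]
  exact (integrable_collision hK h).integral_prod_left.const_mul _

theorem enorm_half_mul_le (x : ℝ) : ‖1 / 2 * x‖ₑ ≤ ‖x‖ₑ := by
  rw [Real.enorm_eq_ofReal_abs, Real.enorm_eq_ofReal_abs, abs_mul]
  refine ENNReal.ofReal_le_ofReal (mul_le_of_le_one_left (abs_nonneg _) ?_)
  norm_num [abs_of_pos]

theorem lintegral_gain_le (hK : IsDominatedKernel K w κ) (h : IsCollisionPair w p u) :
    ∫⁻ v, ‖gain K p u v‖ₑ
      ≤ ENNReal.ofReal κ * ((∫⁻ v, ‖w v * u v‖ₑ) * ∫⁻ v, ‖w v * p v‖ₑ) := by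
  refine le_trans ?_ (lintegral_collision_le hK h)
  have hT := measurePreserving_sub_prod (volume : Measure ℝ) (volume : Measure ℝ)
  rw [← hT.lintegral_comp (measurable_collision hK h).enorm,
    lintegral_prod _ (by
      exact ((measurable_collision hK h).comp hT.measurable).enorm.aemeasurable)]
  exact lintegral_mono fun v => (enorm_half_mul_le _).trans (enorm_integral_le_lintegral_enorm _)

theorem lintegral_crossLoss_le (hK : IsDominatedKernel K w κ) (h : IsCollisionPair w p u) :
    ∫⁻ v, ‖crossLoss K p u v‖ₑ
      ≤ ENNReal.ofReal κ * ((∫⁻ v, ‖w v * u v‖ₑ) * ∫⁻ v, ‖w v * p v‖ₑ) := by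
  refine le_trans ?_ (lintegral_collision_le hK h)
  rw [lintegral_prod_symm _ (measurable_collision hK h).enorm.aemeasurable]
  exact lintegral_mono fun v => (enorm_half_mul_le _).trans (enorm_integral_le_lintegral_enorm _)

theorem lintegral_lossRate_mul_le (hK : IsDominatedKernel K w κ) (h : IsCollisionPair w p u) :
    ∫⁻ v, ‖lossRate K p v * u v‖ₑ
      ≤ ENNReal.ofReal κ * ((∫⁻ v, ‖w v * u v‖ₑ) * ∫⁻ v, ‖w v * p v‖ₑ) := by
  refine le_trans ?_ (lintegral_collision_le hK h)
  rw [lintegral_prod _ (measurable_collision hK h).enorm.aemeasurable]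
  simp only [lossRate_mul]
  exact lintegral_mono fun v => (enorm_half_mul_le _).trans (enorm_integral_le_lintegral_enorm _)

/-- The weak form of the coagulation operator. -/
theorem integral_collision_eq (hK : IsDominatedKernel K w κ) (h : IsCollisionPair w p u)
    {φ : ℝ → ℝ} (hφ : Measurable φ) {C : ℝ} (hC : ∀ v, |φ v| ≤ C) :
    ∫ q : ℝ × ℝ, (φ (q.1 + q.2) - φ q.1 - φ q.2) * collision K p u q.1 q.2 ∂(volume.prod volume)
      = 2 * ∫ v, φ v * (gain K p u v - crossLoss K p u v - lossRate K p v * u v) := by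
  have hJ := integrable_collision hK h
  have hb : ∀ {X : ℝ × ℝ → ℝ} {F : ℝ × ℝ → ℝ}, Measurable X → Integrable F (volume.prod volume) →
      Integrable (fun q => φ (X q) * F q) (volume.prod volume) := fun hX hF =>
    hF.bdd_mul (hφ.comp hX).aestronglyMeasurable (Eventually.of_forall fun _ => hC _)
  have i1 := hb (X := fun q => q.1 + q.2) (by fun_prop) hJ
  have i2 := hb (X := fun q => q.1) (by fun_prop) hJ
  have i3 := hb (X := fun q => q.2) (by fun_prop) hJ
  have i4 := hb (X := fun q => q.1) (by fun_prop) (integrable_collision_shift hK h)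
  have hb' : ∀ {F : ℝ → ℝ}, Integrable F → Integrable fun v => φ v * F v := fun hF =>
    hF.bdd_mul hφ.aestronglyMeasurable (Eventually.of_forall hC)
  have j1 := hb' (integrable_gain hK h)
  have j2 := hb' (integrable_crossLoss hK h)
  have j3 := hb' (integrable_lossRate_mul hK h)
  -- The shear `(v, y) ↦ (v - y, y)` preserves Lebesgue measure and turns `φ(x + y)` into `φ(v)`.
  have e1 : ∫ q : ℝ × ℝ, φ (q.1 + q.2) * collision K p u q.1 q.2 ∂(volume.prod volume)
      = 2 * ∫ v, φ v * gain K p u v := by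
    have := integral_shift i1.1
    simp only [sub_add_cancel] at this
    rw [← this, integral_prod _ i4, ← integral_const_mul]
    refine integral_congr_ae (Eventually.of_forall fun v => ?_)
    simp only [gain]
    rw [integral_const_mul]
    ring
  have e2 : ∫ q : ℝ × ℝ, φ q.1 * collision K p u q.1 q.2 ∂(volume.prod volume)
      = 2 * ∫ v, φ v * (lossRate K p v * u v) := by
    rw [integral_prod _ i2, ← integral_const_mul]
    refine integral_congr_ae (Eventually.of_forall fun v => ?_)
    simp only [lossRate_mul]
    rw [integral_const_mul]
    ring
  have e3 : ∫ q : ℝ × ℝ, φ q.2 * collision K p u q.1 q.2 ∂(volume.prod volume)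
      = 2 * ∫ v, φ v * crossLoss K p u v := by
    rw [integral_prod_symm _ i3, ← integral_const_mul]
    refine integral_congr_ae (Eventually.of_forall fun v => ?_)
    simp only [crossLoss]
    rw [integral_const_mul]
    ring
  have j12 : Integrable fun v => φ v * gain K p u v - φ v * crossLoss K p u v := j1.sub j2
  have i12 : Integrable (fun q : ℝ × ℝ => φ (q.1 + q.2) * collision K p u q.1 q.2
      - φ q.1 * collision K p u q.1 q.2) (volume.prod volume) := i1.sub i2
  simp only [sub_mul, mul_sub]
  rw [integral_sub i12 i3, integral_sub i1 i2, integral_sub j12 j3, integral_sub j1 j2, e1, e2, e3]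
  ring

/-- The contraction property of the coagulation operator up to a bounded perturbation. -/
theorem integral_weight_coagulation_le (hK : IsDominatedKernel K w κ) (h : IsCollisionPair w p u)
    {W W' : ℝ → ℝ} {C : ℝ} (hW : IsTransportWeight W W' C)
    (hsub : ∀ x > 0, ∀ y > 0, W (x + y) ≤ W x + W y) (hWw : ∀ v > 0, W v ≤ w v)
    (hp2 : Integrable fun v => w v ^ 2 * p v) :
    ∫ v, W v * (|gain K p u v - crossLoss K p u v| - lossRate K p v * |u v|) ∂vol
      ≤ κ * ((∫ v, |w v * u v|) * ∫ v, w v ^ 2 * p v) := by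
  -- Nothing is known about `W` on `(-∞,0]`; the extension by zero is bounded and non-negative on
  -- all of `ℝ`.
  set V : ℝ → ℝ := (Ioi (0 : ℝ)).indicator W with hV
  have hVm : Measurable V := hW.measurable.indicator measurableSet_Ioi
  have hV0 : ∀ v, 0 ≤ V v := fun v => indicator_nonneg (fun x hx => (hW.pos x hx).le) v
  have hVpos : ∀ v > 0, V v = W v := fun v hv => indicator_of_mem hv _
  have hC0 : 0 ≤ C := (hW.pos 1 one_pos).le.trans (hW.le 1 one_pos)
  have hVC : ∀ v, ‖V v‖ ≤ C := fun v => by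
    rw [Real.norm_of_nonneg (hV0 v)]
    exact indicator_le' (fun x hx => hW.le x hx) (fun _ _ => hC0) v
  have hJ := (integrable_collision hK h).abs
  have hJs := (integrable_collision_shift hK h).abs
  have hb : ∀ {X : ℝ × ℝ → ℝ} {F : ℝ × ℝ → ℝ}, Measurable X → Integrable F (volume.prod volume) →
      Integrable (fun q => V (X q) * F q) (volume.prod volume) := fun hX hF =>
    hF.bdd_mul (hVm.comp hX).aestronglyMeasurable (Eventually.of_forall fun _ => hVC _)
  have i1 := hb (X := fun q => q.1 + q.2) (by fun_prop) hJ
  have i2 := hb (X := fun q => q.1) (by fun_prop) hJ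
  have i3 := hb (X := fun q => q.2) (by fun_prop) hJ
  have i4 := hb (X := fun q => q.1) (by fun_prop) hJs
  have hb' : ∀ {F : ℝ → ℝ}, Integrable F → Integrable fun v => V v * F v := fun hF =>
    hF.bdd_mul hVm.aestronglyMeasurable (Eventually.of_forall hVC)
  have j1 := hb' (integrable_gain hK h).abs
  have j2 := hb' (integrable_crossLoss hK h).abs
  -- As `K p ≥ 0`, the loss of `|u|` is exactly the integral of `|collision|`. The equality is
  -- essential: this term is used with a minus sign to cancel `W(x)`.
  have hl : ∀ v, lossRate K p v * |u v| = 1 / 2 * ∫ y, |collision K p u v y| := fun v => by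
    have : ∀ y, |collision K p u v y| = K v y * p y * |u v| := fun y => by
      rw [collision, abs_mul, abs_of_nonneg (mul_nonneg (hK.nonneg _ _) (h.nonneg _))]
    simp only [this, lossRate]
    rw [integral_mul_const]
    ring
  have j3 : Integrable fun v => V v * (lossRate K p v * |u v|) := by
    refine hb' ?_
    simp only [hl]
    exact hJ.integral_prod_left.const_mul _
  have hhalf : |(1 / 2 : ℝ)| = 1 / 2 := abs_of_pos (by norm_num)
  have e1 : ∫ v, V v * |gain K p u v|
      ≤ 1 / 2 * ∫ q : ℝ × ℝ, V (q.1 + q.2) * |collision K p u q.1 q.2| ∂(volume.prod volume) := by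
    have := integral_shift i1.1
    simp only [sub_add_cancel] at this
    rw [← this, integral_prod _ i4, ← integral_const_mul]
    refine integral_mono j1 (i4.integral_prod_left.const_mul _) fun v => ?_
    simp only [gain]
    rw [integral_const_mul, abs_mul, hhalf]
    have := mul_le_mul_of_nonneg_left
      (abs_integral_le_integral_abs (f := fun y => collision K p u (v - y) y) (μ := volume)) (hV0 v)
    linarith
  have e2 : ∫ v, V v * |crossLoss K p u v|
      ≤ 1 / 2 * ∫ q : ℝ × ℝ, V q.2 * |collision K p u q.1 q.2| ∂(volume.prod volume) := by
    rw [integral_prod_symm _ i3, ← integral_const_mul]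
    refine integral_mono j2 (i3.integral_prod_right.const_mul _) fun v => ?_
    simp only [crossLoss]
    rw [integral_const_mul, abs_mul, hhalf]
    have := mul_le_mul_of_nonneg_left
      (abs_integral_le_integral_abs (f := fun x => collision K p u x v) (μ := volume)) (hV0 v)
    linarith
  have e3 : ∫ v, V v * (lossRate K p v * |u v|)
      = 1 / 2 * ∫ q : ℝ × ℝ, V q.1 * |collision K p u q.1 q.2| ∂(volume.prod volume) := by
    rw [integral_prod _ i2, ← integral_const_mul]
    refine integral_congr_ae (Eventually.of_forall fun v => ?_)
    simp only [hl]
    rw [integral_const_mul]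
    ring
  have e4 : ∫ v, W v * (|gain K p u v - crossLoss K p u v| - lossRate K p v * |u v|) ∂vol
      = ∫ v, V v * (|gain K p u v - crossLoss K p u v| - lossRate K p v * |u v|) := by
    rw [← integral_indicator measurableSet_Ioi]
    refine integral_congr_ae (Eventually.of_forall fun v => ?_)
    by_cases hv : v ∈ Ioi (0 : ℝ)
    · simp only [hV, indicator_of_mem hv]
    · simp only [hV, indicator_of_notMem hv, zero_mul]
  have j12 : Integrable fun v => V v * |gain K p u v| + V v * |crossLoss K p u v| := j1.add j2
  have j0 : Integrable fun v =>
      V v * (|gain K p u v - crossLoss K p u v| - lossRate K p v * |u v|) := by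
    have := (hb' ((integrable_gain hK h).sub (integrable_crossLoss hK h)).abs).sub j3
    refine this.congr (Eventually.of_forall fun v => ?_)
    simp only [Pi.sub_apply]
    ring
  have e5 : ∫ v, V v * (|gain K p u v - crossLoss K p u v| - lossRate K p v * |u v|)
      ≤ (∫ v, V v * |gain K p u v|) + (∫ v, V v * |crossLoss K p u v|)
        - ∫ v, V v * (lossRate K p v * |u v|) := by
    rw [← integral_add j1 j2, ← integral_sub j12 j3]
    refine integral_mono j0 (j12.sub j3) fun v => ?_
    have := mul_le_mul_of_nonneg_left (abs_sub (gain K p u v) (crossLoss K p u v)) (hV0 v)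
    simp only [mul_sub] at this ⊢
    linarith
  have i12 : Integrable (fun q : ℝ × ℝ => V (q.1 + q.2) * |collision K p u q.1 q.2|
      + V q.2 * |collision K p u q.1 q.2|) (volume.prod volume) := i1.add i3
  have e6 : (∫ q : ℝ × ℝ, V (q.1 + q.2) * |collision K p u q.1 q.2| ∂(volume.prod volume))
      + (∫ q : ℝ × ℝ, V q.2 * |collision K p u q.1 q.2| ∂(volume.prod volume))
      - ∫ q : ℝ × ℝ, V q.1 * |collision K p u q.1 q.2| ∂(volume.prod volume)
      ≤ ∫ q : ℝ × ℝ, 2 * (κ * (|w q.1 * u q.1| * (w q.2 ^ 2 * p q.2))) ∂(volume.prod volume) := by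
    rw [← integral_add i1 i3, ← integral_sub i12 i2]
    refine integral_mono (i12.sub i2)
      (((h.integrable_right.abs.mul_prod hp2).const_mul κ).const_mul 2) fun q => ?_
    simp only
    rcases le_or_gt q.1 0 with hx | hx
    · simp [collision, h.right_eq_zero _ hx]
    rcases le_or_gt q.2 0 with hy | hy
    · simp [collision, h.left_eq_zero _ hy]
    have h1 := abs_collision_le hK h q.1 q.2
    rw [hVpos _ (add_pos hx hy), hVpos _ hx, hVpos _ hy]
    have h2 := hsub _ hx _ hy
    have hwy : 0 ≤ w q.2 := (hW.pos _ hy).le.trans (hWw _ hy)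
    -- Subadditivity gives `W(x+y) + W(y) - W(x) ≤ 2 W(y)`. The remaining weight falls on `p`, where
    -- it joins the `w(y)` from the kernel to form `w(y)²`.
    calc W (q.1 + q.2) * |collision K p u q.1 q.2| + W q.2 * |collision K p u q.1 q.2|
          - W q.1 * |collision K p u q.1 q.2|
        = (W (q.1 + q.2) + W q.2 - W q.1) * |collision K p u q.1 q.2| := by ring
      _ ≤ (2 * w q.2) * |collision K p u q.1 q.2| := by
          gcongr
          linarith [hWw _ hy]
      _ ≤ (2 * w q.2) * (κ * (|w q.1 * u q.1| * |w q.2 * p q.2|)) := by gcongr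
      _ = _ := by rw [abs_of_nonneg (mul_nonneg hwy (h.nonneg q.2))]; ring
  have e7 : ∫ q : ℝ × ℝ, 2 * (κ * (|w q.1 * u q.1| * (w q.2 ^ 2 * p q.2))) ∂(volume.prod volume)
      = 2 * (κ * ((∫ v, |w v * u v|) * ∫ v, w v ^ 2 * p v)) := by
    rw [integral_const_mul, integral_const_mul,
      integral_prod_mul (fun v => |w v * u v|) fun v => w v ^ 2 * p v]
  linarith

end Static

/-! ### Bounded subadditive weights -/

/-- A bounded approximation of the weight `v ^ (-β) + v`. -/
noncomputable def approxWeight (β δ v : ℝ) : ℝ := (v + δ) ^ (-β) + v / (1 + δ * v)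

/-- The derivative of `approxWeight`. -/
noncomputable def approxWeightDeriv (β δ v : ℝ) : ℝ :=
  -β * (v + δ) ^ (-β - 1) + 1 / (1 + δ * v) ^ 2

section Weight
variable {β δ : ℝ}

/-- The shift by `δ` removes the singularity at `0`, and `v / (1 + δ v)` saturates at `1 / δ`. In `v
W'` the power contributes a negative term, and the fraction gives `v / (1 + δ v)²`, which is below
the fraction itself. -/
theorem isTransportWeight_approxWeight (hβ : 0 < β) (hδ : 0 < δ) :
    IsTransportWeight (approxWeight β δ) (approxWeightDeriv β δ) (δ ^ (-β) + 1 / δ) where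
  measurable := by unfold approxWeight; fun_prop
  pos v hv := by unfold approxWeight; positivity
  le v hv := by
    unfold approxWeight
    refine add_le_add ?_ ?_
    · exact Real.rpow_le_rpow_of_nonpos hδ (by linarith) (by linarith)
    · rw [div_le_div_iff₀ (by positivity) hδ]
      nlinarith
  hasDerivAt v hv := by
    unfold approxWeight approxWeightDeriv
    have h1 : HasDerivAt (fun v => (v + δ) ^ (-β)) (-β * (v + δ) ^ (-β - 1)) v := by
      have := ((hasDerivAt_id v).add_const δ).rpow_const (p := -β)
        (Or.inl (by simp only [id]; positivity))
      simpa using this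
    have h2 : HasDerivAt (fun v => v / (1 + δ * v)) (1 / (1 + δ * v) ^ 2) v := by
      have := (hasDerivAt_id v).div (((hasDerivAt_id v).const_mul δ).const_add 1)
        (by simp only [id]; positivity)
      refine this.congr_deriv ?_
      simp only [id]
      congr 1
      ring
    exact h1.add h2
  continuousOn := by
    unfold approxWeightDeriv
    refine ContinuousOn.add (continuousOn_const.mul ?_) ?_
    · exact ContinuousOn.rpow_const (by fun_prop) fun x hx =>
        Or.inl (by have : 0 < x := hx; positivity)
    · exact ContinuousOn.div (by fun_prop) (by fun_prop) fun x hx => by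
        have : 0 < x := hx
        positivity
  mul_le v hv := by
    unfold approxWeight approxWeightDeriv
    have h1 : 0 ≤ (v + δ) ^ (-β - 1) := by positivity
    have h2 : 0 ≤ (v + δ) ^ (-β) := by positivity
    have h3 : v * (1 / (1 + δ * v) ^ 2) ≤ v / (1 + δ * v) := by
      rw [mul_one_div]
      refine div_le_div_of_nonneg_left hv.le (by positivity) ?_
      nlinarith [mul_pos hδ hv]
    nlinarith [mul_nonneg (mul_nonneg hv.le hβ.le) h1]

/-- The power is positive and decreasing, so one of the two summands already suffices; the fraction
is `v` times a decreasing function. -/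
theorem approxWeight_add_le (hβ : 0 < β) (hδ : 0 < δ) {x y : ℝ} (hx : 0 < x) (hy : 0 < y) :
    approxWeight β δ (x + y) ≤ approxWeight β δ x + approxWeight β δ y := by
  unfold approxWeight
  have h1 : (x + y + δ) ^ (-β) ≤ (x + δ) ^ (-β) :=
    Real.rpow_le_rpow_of_nonpos (by positivity) (by linarith) (by linarith)
  have h2 : 0 ≤ (y + δ) ^ (-β) := by positivity
  have h3 : (x + y) / (1 + δ * (x + y)) ≤ x / (1 + δ * x) + y / (1 + δ * y) := by
    rw [add_div]
    refine add_le_add (div_le_div_of_nonneg_left hx.le (by positivity) ?_)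
      (div_le_div_of_nonneg_left hy.le (by positivity) ?_) <;> nlinarith [mul_pos hδ hx, mul_pos hδ hy]
  linarith

theorem approxWeight_le_weight (hβ : 0 < β) (hδ : 0 < δ) {v : ℝ} (hv : 0 < v) :
    approxWeight β δ v ≤ weight (-β) 1 v := by
  unfold approxWeight weight
  rw [Real.rpow_one]
  refine add_le_add (Real.rpow_le_rpow_of_nonpos hv (by linarith) (by linarith)) ?_
  exact div_le_self hv.le (by nlinarith [mul_pos hδ hv])

theorem tendsto_approxWeight {v : ℝ} (hv : 0 < v) {δ : ℕ → ℝ} (hδ : Tendsto δ atTop (𝓝 0)) :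
    Tendsto (fun n => approxWeight β (δ n) v) atTop (𝓝 (weight (-β) 1 v)) := by
  have hc : ContinuousAt (fun d => approxWeight β d v) 0 := by
    unfold approxWeight
    refine ContinuousAt.add (ContinuousAt.rpow_const (by fun_prop) (Or.inl (by simpa using hv.ne')))
      (ContinuousAt.div (by fun_prop) (by fun_prop) (by simp))
  have := hc.tendsto.comp hδ
  simpa [approxWeight, weight, Function.comp_def] using this

end Weight

/-! ### Gronwall's inequality -/

/-- Gronwall's inequality in integral form, for bounded measurable functions. -/
theorem le_mul_exp_of_le_add_integral {N : ℝ → ℝ} {T a l R : ℝ} (ha : 0 ≤ a) (hl : 0 ≤ l)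
    (hNm : Measurable N) (hNR : ∀ t ∈ Icc 0 T, |N t| ≤ R)
    (h0 : ∀ t ∈ Icc 0 T, 0 ≤ N t)
    (h : ∀ t ∈ Icc 0 T, N t ≤ a + l * ∫ s in (0 : ℝ)..t, N s) {t : ℝ} (ht : t ∈ Icc 0 T) :
    N t ≤ a * Real.exp (l * t) := by
  have hT : 0 ≤ T := ht.1.trans ht.2
  have hint : IntegrableOn N (Icc 0 T) := by
    refine Measure.integrableOn_of_bounded (M := R) (by simp) hNm.aestronglyMeasurable ?_
    filter_upwards [ae_restrict_mem measurableSet_Icc] with s hs using hNR s hs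
  have hi : ∀ r ∈ Icc 0 T, IntervalIntegrable N volume 0 r := fun r hr =>
    (intervalIntegrable_iff_integrableOn_Ioc_of_le hr.1).2
      (hint.mono_set fun x hx => ⟨hx.1.le, hx.2.trans hr.2⟩)
  set y : ℝ → ℝ := fun r => a + l * ∫ s in (0 : ℝ)..r, N s with hy
  have hyc : ContinuousOn y (Icc 0 T) := by
    have := intervalIntegral.continuousOn_primitive_interval (f := N) (μ := volume) (a := 0) (b := T)
      (by rwa [uIcc_of_le hT])
    rw [uIcc_of_le hT] at this
    exact continuousOn_const.add (continuousOn_const.mul this)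
  -- a globally continuous extension of `y`
  set Y : ℝ → ℝ := fun r => y (projIcc 0 T hT r) with hY
  have hYc : Continuous Y := hyc.comp_continuous (continuous_subtype_val.comp continuous_projIcc)
    fun r => (projIcc 0 T hT r).2
  have hYy : ∀ r ∈ Icc 0 T, Y r = y r := fun r hr => by simp [hY, projIcc_of_mem hT hr]
  have hy0 : ∀ r ∈ Icc 0 T, 0 ≤ y r := fun r hr => (h0 r hr).trans (h r hr)
  have hY0 : ∀ r, 0 ≤ Y r := fun r => hy0 _ (projIcc 0 T hT r).2
  -- The right-hand side `y` is continuous but need not be differentiable, since `N` is only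
  -- measurable. Integrating its extension `Y` once more gives a differentiable `f` with `N ≤ y ≤ f`
  -- on `[0,T]` and `f' = l Y ≤ l f`, to which the differential form applies.
  set f : ℝ → ℝ := fun r => a + l * ∫ s in (0 : ℝ)..r, Y s with hf
  have hfd : ∀ r, HasDerivAt f (l * Y r) r := fun r =>
    (((hYc.integral_hasStrictDerivAt 0 r).hasDerivAt).const_mul l).const_add a
  have hyf : ∀ r ∈ Icc 0 T, y r ≤ f r := fun r hr => by
    have : ∫ s in (0 : ℝ)..r, N s ≤ ∫ s in (0 : ℝ)..r, Y s := by
      refine intervalIntegral.integral_mono_on hr.1 (hi r hr) (hYc.intervalIntegrable _ _)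
        fun s hs => ?_
      have hsT : s ∈ Icc 0 T := ⟨hs.1, hs.2.trans hr.2⟩
      rw [hYy s hsT]
      exact h s hsT
    simp only [hy, hf]
    gcongr
  have hg := norm_le_gronwallBound_of_norm_deriv_right_le (f := f) (f' := fun r => l * Y r)
    (δ := a) (K := l) (ε := 0) (a := 0) (b := T)
    (fun r _ => (hfd r).continuousAt.continuousWithinAt) (fun r _ => (hfd r).hasDerivWithinAt)
    (by simp [hf, abs_of_nonneg ha]) (fun r hr => by
      have hrT : r ∈ Icc 0 T := Ico_subset_Icc_self hr
      have h1 := hyf r hrT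
      rw [Real.norm_of_nonneg (mul_nonneg hl (hY0 r)),
        Real.norm_of_nonneg ((hy0 r hrT).trans h1), add_zero, hYy r hrT]
      gcongr) t ht
  rw [gronwallBound_ε0, sub_zero] at hg
  exact (h t ht).trans ((hyf t ht).trans ((le_abs_self _).trans hg))

/-! ### From weak solutions to the linear transport equation -/

theorem integral_vol_eq {F : ℝ → ℝ} (h : ∀ v ≤ 0, F v = 0) : ∫ v, F v ∂vol = ∫ v, F v :=
  setIntegral_eq_integral_of_forall_compl_eq_zero fun v hv => h v (not_lt.1 hv)

theorem lintegral_vol_eq {F : ℝ → ℝ≥0∞} (h : ∀ v ≤ 0, F v = 0) : ∫⁻ v, F v ∂vol = ∫⁻ v, F v := by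
  rw [← lintegral_indicator measurableSet_Ioi]
  refine lintegral_congr fun v => ?_
  by_cases hv : v ∈ Ioi (0 : ℝ)
  · rw [indicator_of_mem hv]
  · rw [indicator_of_notMem hv, h v (not_lt.1 hv)]

theorem prod_vol_vol : vol.prod vol
    = ((volume : Measure ℝ).prod volume).restrict (Ioi 0 ×ˢ Ioi 0) := Measure.prod_restrict _ _

theorem isW1Infty_of_contDiff {φ : ℝ → ℝ} (hφ : ContDiff ℝ ∞ φ) (hc : HasCompactSupport φ) :
    IsW1Infty φ (deriv φ) := by
  have hφ' : Continuous (deriv φ) := (contDiff_infty_iff_deriv.1 hφ).2.continuous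
  have hb : ∀ {ψ : ℝ → ℝ}, Continuous ψ → HasCompactSupport ψ → MemLp ψ ⊤ vol := fun h h' => by
    obtain ⟨C, hC⟩ := h'.exists_bound_of_continuous h
    exact memLp_top_of_bound h.aestronglyMeasurable C (Eventually.of_forall hC)
  refine ⟨hb hφ.continuous hc, hb hφ' hc.deriv, fun η hη hηc hηs => ?_⟩
  have hη' : Continuous (deriv η) := (contDiff_infty_iff_deriv.1 hη).2.continuous
  have h0 : ∀ v ≤ 0, η v = 0 := fun v hv =>
    image_eq_zero_of_notMem_tsupport fun h => not_lt.2 hv (hηs h)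
  have h0' : ∀ v ≤ 0, deriv η v = 0 := fun v hv =>
    image_eq_zero_of_notMem_tsupport fun h => not_lt.2 hv (hηs
      ((closure_minimal support_deriv_subset (isClosed_tsupport _)) h))
  rw [integral_vol_eq fun v hv => by rw [h0' v hv, mul_zero],
    integral_vol_eq fun v hv => by rw [h0 v hv, mul_zero]]
  have hd : ∀ {ψ : ℝ → ℝ}, ContDiff ℝ ∞ ψ → ∀ v, HasDerivAt ψ (deriv ψ v) v := fun h v =>
    (h.differentiable (by simp) v).hasDerivAt
  exact integral_mul_deriv_eq_deriv_mul_of_integrable (fun v _ => hd hφ v) (fun v _ => hd hη v)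
    ((hφ.continuous.mul hη').integrable_of_hasCompactSupport hc.mul_right)
    ((hφ'.mul hη.continuous).integrable_of_hasCompactSupport hc.deriv.mul_right)
    ((hφ.continuous.mul hη.continuous).integrable_of_hasCompactSupport hc.mul_right)

/-- A jointly measurable family of non-negative densities on `(0,∞)` whose `w`-moments are bounded
on `[0,T]`. -/
structure IsDensityFamily (T N : ℝ) (w : ℝ → ℝ) (c : ℝ → ℝ → ℝ) : Prop where
  measurable : Measurable (Function.uncurry c)
  nonneg : ∀ s v, 0 ≤ c s v
  eq_zero : ∀ s, ∀ v ≤ 0, c s v = 0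
  integrable : ∀ s ∈ Icc 0 T, Integrable fun v => w v * c s v
  moment_le : ∀ s ∈ Icc 0 T, ∫ v, |w v * c s v| ≤ N

theorem IsWeakSolution.exists_densityFamily {K g : ℝ → ℝ → ℝ} {β T : ℝ} {c₀ : ℝ → ℝ}
    {c : ℝ → ℝ → ℝ} (hT : 0 ≤ T) (hβ : 0 < β) (hc : IsWeakSolution K g β T c₀ c) :
    ∃ c' : ℝ → ℝ → ℝ, (∃ N, IsDensityFamily T N (weight (-β) 1) c') ∧
      ∀ s ∈ Icc 0 T, c' s =ᵐ[vol] c s := by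
  obtain ⟨c', hm, h0, hz, hae⟩ :=
    hc.weaklyContinuous.exists_measurable_version hT hβ hc.nonneg
  obtain ⟨N, hN⟩ := hc.weaklyContinuous.exists_bound
  have hi : ∀ s ∈ Icc 0 T, Integrable fun v => weight (-β) 1 v * c' s v := fun s hs => by
    have h1 : IntegrableOn (fun v => weight (-β) 1 v * c' s v) (Ioi 0) := by
      refine Integrable.congr (hc.weaklyContinuous.mem s hs) ?_
      filter_upwards [hae s hs] with v hv
      rw [hv]
    exact h1.integrable_of_forall_notMem_eq_zero fun v hv => by
      rw [hz s v (not_lt.1 hv), mul_zero]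
  refine ⟨c', ⟨N, hm, h0, hz, hi, fun s hs => ?_⟩, hae⟩
  refine le_trans (le_of_eq ?_) (hN s hs)
  rw [← integral_vol_eq fun v hv => by rw [hz s v hv, mul_zero, abs_zero]]
  refine integral_congr_ae ?_
  filter_upwards [hae s hs, ae_restrict_mem measurableSet_Ioi] with v hv hv0
  rw [hv, ← hv, abs_of_nonneg (mul_nonneg (weight_nonneg (le_of_lt hv0)) (h0 s v))]

theorem IsDensityFamily.isCollisionPair {T N N' : ℝ} {w : ℝ → ℝ} {a b : ℝ → ℝ → ℝ}
    (ha : IsDensityFamily T N w a) (hb : IsDensityFamily T N' w b) {s : ℝ} (hs : s ∈ Icc 0 T) :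
    IsCollisionPair w (a s) (b s) :=
  ⟨ha.measurable.comp measurable_prodMk_left, hb.measurable.comp measurable_prodMk_left,
    ha.nonneg s, ha.eq_zero s, hb.eq_zero s, ha.integrable s hs, hb.integrable s hs⟩

/-- The pairing of `φ` with the collisions between the densities `b` and `a`. -/
noncomputable def collisionPairing (K : ℝ → ℝ → ℝ) (φ a b : ℝ → ℝ) : ℝ :=
  ∫ q : ℝ × ℝ, (φ (q.1 + q.2) - φ q.1 - φ q.2) * collision K a b q.1 q.2 ∂(volume.prod volume)

theorem integrable_collisionPairing {K : ℝ → ℝ → ℝ} {w : ℝ → ℝ} {κ : ℝ}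
    (hK : IsDominatedKernel K w κ) {a b : ℝ → ℝ} (h : IsCollisionPair w a b) {φ : ℝ → ℝ}
    (hφ : Measurable φ) {C : ℝ} (hC : ∀ v, |φ v| ≤ C) :
    Integrable (fun q : ℝ × ℝ => (φ (q.1 + q.2) - φ q.1 - φ q.2) * collision K a b q.1 q.2)
      (volume.prod volume) := by
  refine (integrable_collision hK h).bdd_mul (c := C + C + C)
    (Measurable.aestronglyMeasurable (by fun_prop)) (Eventually.of_forall fun q => ?_)
  exact (norm_sub_le _ _).trans (add_le_add ((norm_sub_le _ _).trans
    (add_le_add (hC _) (hC _))) (hC _))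

theorem abs_collisionPairing_le {K : ℝ → ℝ → ℝ} {w : ℝ → ℝ} {κ : ℝ}
    (hK : IsDominatedKernel K w κ) {a b : ℝ → ℝ} (h : IsCollisionPair w a b) {φ : ℝ → ℝ}
    {C : ℝ} (hC : ∀ v, |φ v| ≤ C) :
    |collisionPairing K φ a b|
      ≤ (C + C + C) * (κ * ((∫ v, |w v * b v|) * ∫ v, |w v * a v|)) := by
  rw [← integral_prod_mul (fun v => |w v * b v|) fun v => |w v * a v|, ← integral_const_mul,
    ← integral_const_mul]
  refine abs_integral_le_integral_abs.trans (integral_mono_of_nonneg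
    (Eventually.of_forall fun _ => abs_nonneg _)
    (((h.integrable_right.abs.mul_prod h.integrable_left.abs).const_mul κ).const_mul _)
    (Eventually.of_forall fun q => ?_))
  have hC0 : 0 ≤ C := (abs_nonneg _).trans (hC 0)
  simp only [abs_mul (φ (q.1 + q.2) - φ q.1 - φ q.2)]
  have h1 : |φ (q.1 + q.2) - φ q.1 - φ q.2| ≤ C + C + C :=
    (abs_sub _ _).trans (add_le_add ((abs_sub _ _).trans (add_le_add (hC _) (hC _))) (hC _))
  exact mul_le_mul h1 (abs_collision_le hK h q.1 q.2) (abs_nonneg _) (by positivity)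

theorem measurable_collisionPairing {K : ℝ → ℝ → ℝ} (hK : Measurable (Function.uncurry K))
    {a b : ℝ → ℝ → ℝ} (ha : Measurable (Function.uncurry a)) (hb : Measurable (Function.uncurry b))
    {φ : ℝ → ℝ} (hφ : Measurable φ) : Measurable fun s => collisionPairing K φ (a s) (b s) := by
  have h1 := collision_param_measurable hK ha hb (α := ℝ × (ℝ × ℝ)) (S := fun q => q.1)
    (X := fun q => q.2.1) (Y := fun q => q.2.2) (by fun_prop) (by fun_prop) (by fun_prop)
  have h2 : Measurable fun q : ℝ × (ℝ × ℝ) => φ (q.2.1 + q.2.2) - φ q.2.1 - φ q.2.2 := by fun_prop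
  exact (h2.mul h1).stronglyMeasurable.integral_prod_right.measurable

/-- The bracket in `φ` and the kernel are both invariant under exchanging the colliding particles.
-/
theorem collisionPairing_comm {K : ℝ → ℝ → ℝ} {w : ℝ → ℝ} {κ : ℝ} (hK : IsDominatedKernel K w κ)
    (φ a b : ℝ → ℝ) : collisionPairing K φ a b = collisionPairing K φ b a := by
  rw [collisionPairing, ← integral_prod_swap, collisionPairing]
  refine integral_congr_ae (Eventually.of_forall fun q => ?_)
  simp only [collision, Prod.fst_swap, Prod.snd_swap]
  rw [hK.symm q.2 q.1, add_comm q.2]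
  ring

/-- The weak form of the coagulation operator is a quadratic form in the density. -/
theorem collisionPairing_sub {K : ℝ → ℝ → ℝ} {w : ℝ → ℝ} {κ : ℝ} (hK : IsDominatedKernel K w κ)
    {T N₁ N₂ : ℝ} {a b : ℝ → ℝ → ℝ} (ha : IsDensityFamily T N₁ w a)
    (hb : IsDensityFamily T N₂ w b) {s : ℝ} (hs : s ∈ Icc 0 T) {φ : ℝ → ℝ} (hφ : Measurable φ)
    {C : ℝ} (hC : ∀ v, |φ v| ≤ C) :
    collisionPairing K φ (fun v => a s v + b s v) (fun v => a s v - b s v)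
      = collisionPairing K φ (a s) (a s) - collisionPairing K φ (b s) (b s) := by
  have i1 := integrable_collisionPairing hK (ha.isCollisionPair ha hs) hφ hC
  have i2 := integrable_collisionPairing hK (hb.isCollisionPair hb hs) hφ hC
  have i3 := integrable_collisionPairing hK (hb.isCollisionPair ha hs) hφ hC
  have i4 := integrable_collisionPairing hK (ha.isCollisionPair hb hs) hφ hC
  -- Expanding `(a + b)(a - b)` leaves two cross terms, which cancel by the symmetry of the pairing.
  have e : collisionPairing K φ (fun v => a s v + b s v) (fun v => a s v - b s v)
      = (collisionPairing K φ (a s) (a s) - collisionPairing K φ (b s) (b s))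
        + (collisionPairing K φ (b s) (a s) - collisionPairing K φ (a s) (b s)) := by
    simp only [collisionPairing]
    rw [← integral_sub' i1 i2, ← integral_sub' i3 i4, ← integral_add' (i1.sub i2) (i3.sub i4)]
    refine integral_congr_ae (Eventually.of_forall fun q => ?_)
    simp only [collision, Pi.sub_apply, Pi.add_apply]
    ring
  rw [e, collisionPairing_comm hK φ (b s) (a s), sub_self, add_zero]

section Normalized
variable {K K' g : ℝ → ℝ → ℝ} {β T A B κ N : ℝ} {c₀ : ℝ → ℝ} {c c' : ℝ → ℝ → ℝ}

/-- The weak formulation for the jointly measurable version of a solution. -/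
theorem IsWeakSolution.weak_formulation_version (hc : IsWeakSolution K g β T c₀ c)
    (hK' : IsDominatedKernel K' (weight (-β) 1) κ)
    (hKK : Function.uncurry K' =ᵐ[vol.prod vol] Function.uncurry K)
    (hc' : IsDensityFamily T N (weight (-β) 1) c') (hcc : ∀ s ∈ Icc 0 T, c' s =ᵐ[vol] c s)
    {r : ℝ} (hr : r ∈ Icc 0 T) {φ : ℝ → ℝ} (hφ : ContDiff ℝ ∞ φ) (hφc : HasCompactSupport φ) :
    ∫ v, φ v * c' r v = (∫ v, φ v * c' 0 v)
      + (∫ s in (0 : ℝ)..r, ∫ v, deriv φ v * (extendGrowth g s v * c' s v))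
      + 1 / 2 * ∫ s in (0 : ℝ)..r, collisionPairing K' φ (c' s) (c' s) := by
  have hW := isW1Infty_of_contDiff hφ hφc
  obtain ⟨C, hC⟩ := hφc.exists_bound_of_continuous hφ.continuous
  have h0T : (0 : ℝ) ∈ Icc 0 T := ⟨le_rfl, hr.1.trans hr.2⟩
  have e1 : ∀ s ∈ Icc 0 T, ∫ v, c s v * φ v ∂vol = ∫ v, φ v * c' s v := fun s hs => by
    rw [← integral_vol_eq fun v hv => by rw [hc'.eq_zero s v hv, mul_zero]]
    refine integral_congr_ae ?_
    filter_upwards [hcc s hs] with v hv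
    rw [hv, mul_comm]
  have e2 : ∀ s ∈ Icc 0 T, ∫ v, deriv φ v * g s v * c s v ∂vol
      = ∫ v, deriv φ v * (extendGrowth g s v * c' s v) := fun s hs => by
    rw [← integral_vol_eq fun v hv => by rw [hc'.eq_zero s v hv, mul_zero, mul_zero]]
    refine integral_congr_ae ?_
    filter_upwards [hcc s hs, ae_restrict_mem measurableSet_Ioi] with v hv hv0
    rw [hv, extendGrowth_eq hs.1 (le_of_lt hv0), mul_assoc]
  have e3 : ∀ s ∈ Icc 0 T, ∫ v₂, (∫ v₁, (φ (v₁ + v₂) - φ v₁ - φ v₂) * K v₁ v₂ * c s v₂ * c s v₁ ∂vol)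
      ∂vol = collisionPairing K' φ (c' s) (c' s) := fun s hs => by
    have hi := integrable_collisionPairing hK' (hc'.isCollisionPair hc' hs) hφ.continuous.measurable
      hC
    have hiv : Integrable (fun q : ℝ × ℝ => (φ (q.1 + q.2) - φ q.1 - φ q.2)
        * collision K' (c' s) (c' s) q.1 q.2) (vol.prod vol) := by
      rw [prod_vol_vol]; exact hi.restrict
    have hae : (fun q : ℝ × ℝ => (φ (q.1 + q.2) - φ q.1 - φ q.2)
        * collision K' (c' s) (c' s) q.1 q.2) =ᵐ[vol.prod vol] fun q : ℝ × ℝ =>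
        (φ (q.1 + q.2) - φ q.1 - φ q.2) * K q.1 q.2 * c s q.2 * c s q.1 := by
      filter_upwards [hKK, (Measure.quasiMeasurePreserving_fst (μ := vol) (ν := vol)).ae (hcc s hs),
        (Measure.quasiMeasurePreserving_snd (μ := vol) (ν := vol)).ae (hcc s hs)] with q h1 h2 h3
      simp only [Function.uncurry] at h1
      rw [collision, h1, h2, h3]
      ring
    -- The weak formulation integrates over `v₁` first, hence the symmetric form of Fubini.
    have h4 := integral_prod_symm _ (hiv.congr hae)
    simp only at h4
    rw [← h4, ← integral_congr_ae hae, collisionPairing, prod_vol_vol]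
    refine setIntegral_eq_integral_of_forall_compl_eq_zero fun q hq => ?_
    rw [mem_prod, not_and_or] at hq
    rcases hq with hq | hq
    · simp [collision, hc'.eq_zero s _ (not_lt.1 hq)]
    · simp [collision, hc'.eq_zero s _ (not_lt.1 hq)]
  -- At time `0` the formulation identifies the pairing with `c₀` and the pairing with `c 0`, so the
  -- initial datum can be replaced by the version at time `0`.
  have h0 := hc.weak_formulation 0 h0T φ _ hW
  have h1 := hc.weak_formulation r hr φ _ hW
  simp only [intervalIntegral.integral_same, mul_zero, add_zero] at h0
  have hsub : ∀ s ∈ uIcc 0 r, s ∈ Icc 0 T := fun s hs => by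
    rw [uIcc_of_le hr.1] at hs
    exact ⟨hs.1, hs.2.trans hr.2⟩
  rw [← h0, e1 r hr, e1 0 h0T, intervalIntegral.integral_congr fun s hs => e2 s (hsub s hs),
    intervalIntegral.integral_congr fun s hs => e3 s (hsub s hs)] at h1
  exact h1

/-- At time `0` both time integrals vanish, so `c 0` and `c₀` agree against all smooth test
functions supported in `(0,∞)`, hence a.e. -/
theorem IsWeakSolution.initial_ae_eq {m r : ℝ} (hm : m ≤ 0) (hr : 0 ≤ r) (hT : 0 ≤ T) (hβ : 0 < β)
    (hc : IsWeakSolution K g β T c₀ c) (hc₀ : MemWeightedL1 m r c₀) : c 0 =ᵐ[vol] c₀ := by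
  have h0T : (0 : ℝ) ∈ Icc 0 T := ⟨le_rfl, hT⟩
  have i1 : IntegrableOn (c 0) (Ioi 0) :=
    integrable_of_weight (neg_nonpos.2 hβ.le) zero_le_one (hc.weaklyContinuous.mem 0 h0T)
  have i2 : IntegrableOn c₀ (Ioi 0) := integrable_of_weight hm hr hc₀
  have hae := IsOpen.ae_eq_zero_of_integral_contDiff_smul_eq_zero (μ := volume)
    (isOpen_Ioi (a := (0 : ℝ))) (f := fun v => c 0 v - c₀ v) (i1.sub i2).locallyIntegrableOn ?_
  · rw [Filter.EventuallyEq, ae_restrict_iff' measurableSet_Ioi]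
    filter_upwards [hae] with v hv hv0
    exact sub_eq_zero.1 (hv hv0)
  · intro φ hφ hφc hφs
    have hz : ∀ v ≤ 0, φ v = 0 := fun v hv =>
      image_eq_zero_of_notMem_tsupport fun h => not_lt.2 hv (hφs h)
    have hb : ∀ {F : ℝ → ℝ}, IntegrableOn F (Ioi 0) → Integrable (fun v => F v * φ v) vol :=
      fun hF => by
        obtain ⟨C, hC⟩ := hφc.exists_bound_of_continuous hφ.continuous
        exact hF.mul_bdd (c := C) hφ.continuous.aestronglyMeasurable (Eventually.of_forall hC)
    have h0 := hc.weak_formulation 0 h0T φ _ (isW1Infty_of_contDiff hφ hφc)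
    simp only [intervalIntegral.integral_same, mul_zero, add_zero] at h0
    rw [← integral_vol_eq fun v hv => by rw [hz v hv, zero_smul]]
    refine Eq.trans ?_ (sub_eq_zero.2 h0)
    rw [← integral_sub (hb i1) (hb i2)]
    refine integral_congr_ae (Eventually.of_forall fun v => ?_)
    simp only [smul_eq_mul]
    ring

theorem intervalIntegrable_of_bounded {F : ℝ → ℝ} (hF : Measurable F) {R : ℝ}
    (hR : ∀ s ∈ Icc 0 T, |F s| ≤ R) {r : ℝ} (hr : r ∈ Icc 0 T) :
    IntervalIntegrable F volume 0 r := by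
  rw [intervalIntegrable_iff_integrableOn_Ioc_of_le hr.1]
  refine Measure.integrableOn_of_bounded (M := R) (by simp) hF.aestronglyMeasurable ?_
  filter_upwards [ae_restrict_mem measurableSet_Ioc] with s hs
  exact hR s ⟨hs.1.le, hs.2.trans hr.2⟩

theorem IsDensityFamily.intervalIntegrable_collisionPairing
    (hK' : IsDominatedKernel K' (weight (-β) 1) κ)
    (hc' : IsDensityFamily T N (weight (-β) 1) c') {φ : ℝ → ℝ} (hφ : Measurable φ) {C : ℝ}
    (hC : ∀ v, |φ v| ≤ C) {r : ℝ} (hr : r ∈ Icc 0 T) :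
    IntervalIntegrable (fun s => collisionPairing K' φ (c' s) (c' s)) volume 0 r := by
  refine intervalIntegrable_of_bounded (R := (C + C + C) * (κ * (N * N)))
    (measurable_collisionPairing hK'.measurable hc'.measurable hc'.measurable hφ) (fun s hs => ?_) hr
  refine (abs_collisionPairing_le hK' (hc'.isCollisionPair hc' hs) hC).trans ?_
  have hC0 : 0 ≤ C := (abs_nonneg _).trans (hC 0)
  have h1 := hc'.moment_le s hs
  have h2 : 0 ≤ ∫ v, |weight (-β) 1 v * c' s v| := integral_nonneg fun _ => abs_nonneg _
  have := hK'.const_nonneg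
  have := h2.trans h1
  gcongr

theorem IsDensityFamily.integrable_growth (hg : IsGrowthRate g A B)
    (hc' : IsDensityFamily T N (weight (-β) 1) c') {s : ℝ} (hs : s ∈ Icc 0 T) :
    Integrable (fun v => extendGrowth g s v * c' s v) ∧
      ∫ v, |extendGrowth g s v * c' s v| ≤ |A| * N := by
  have hm : Measurable (c' s) := hc'.measurable.comp measurable_prodMk_left
  have hγ : Measurable (extendGrowth g s) :=
    hg.continuous_extend.measurable.comp measurable_prodMk_left
  have hle : ∀ v, |extendGrowth g s v * c' s v| ≤ |A| * |weight (-β) 1 v * c' s v| := fun v => by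
    rcases le_or_gt v 0 with hv | hv
    · simp [hc'.eq_zero s v hv]
    · have h1 := hg.nonneg s hs.1 v hv.le
      have h2 := hg.le_mul hs.1 hv.le
      have h3 := hc'.nonneg s v
      rw [extendGrowth_eq hs.1 hv.le, abs_mul, abs_mul, abs_of_nonneg h1, ← mul_assoc]
      have h4 := le_weight (β := β) hv
      rw [abs_of_nonneg (hv.le.trans h4)]
      gcongr
      calc g s v ≤ A * v := h2
        _ ≤ |A| * v := by gcongr; exact le_abs_self _
        _ ≤ _ := by gcongr
  have hi := ((hc'.integrable s hs).abs.const_mul |A|)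
  have hint : Integrable (fun v => extendGrowth g s v * c' s v) :=
    hi.mono' (hγ.mul hm).aestronglyMeasurable (Eventually.of_forall hle)
  refine ⟨hint, (integral_mono hint.abs hi hle).trans ?_⟩
  rw [integral_const_mul]
  gcongr
  exact hc'.moment_le s hs

theorem IsDensityFamily.intervalIntegrable_transport (hg : IsGrowthRate g A B)
    (hc' : IsDensityFamily T N (weight (-β) 1) c') {ψ : ℝ → ℝ} (hψ : Measurable ψ) {C : ℝ}
    (hC : ∀ v, |ψ v| ≤ C) {r : ℝ} (hr : r ∈ Icc 0 T) :
    IntervalIntegrable (fun s => ∫ v, ψ v * (extendGrowth g s v * c' s v)) volume 0 r := by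
  have hm : Measurable fun q : ℝ × ℝ => ψ q.2 * (extendGrowth g q.1 q.2 * c' q.1 q.2) :=
    (hψ.comp measurable_snd).mul (hg.continuous_extend.measurable.mul hc'.measurable)
  refine intervalIntegrable_of_bounded (R := C * (|A| * N))
    hm.stronglyMeasurable.integral_prod_right.measurable (fun s hs => ?_) hr
  obtain ⟨h1, h2⟩ := hc'.integrable_growth hg hs
  have hC0 : 0 ≤ C := (abs_nonneg _).trans (hC 0)
  calc |∫ v, ψ v * (extendGrowth g s v * c' s v)| ≤ ∫ v, C * |extendGrowth g s v * c' s v| := by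
        refine abs_integral_le_integral_abs.trans (integral_mono_of_nonneg
          (Eventually.of_forall fun _ => abs_nonneg _) (h1.abs.const_mul C)
          (Eventually.of_forall fun v => ?_))
        simp only
        rw [abs_mul (ψ v)]
        gcongr
        exact hC v
    _ = C * ∫ v, |extendGrowth g s v * c' s v| := integral_const_mul _ _
    _ ≤ _ := by gcongr

theorem abs_le_abs_weight_mul (hβ : 0 < β) {u : ℝ → ℝ} (hu : ∀ v ≤ 0, u v = 0) (v : ℝ) :
    |u v| ≤ |weight (-β) 1 v * u v| := by
  rcases le_or_gt v 0 with hv | hv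
  · simp [hu v hv]
  · rw [abs_mul]
    refine le_mul_of_one_le_left (abs_nonneg _) ?_
    exact (one_le_weight (neg_nonpos.2 hβ.le) zero_le_one hv).trans (le_abs_self _)

theorem abs_mul_le_abs_weight_mul {u : ℝ → ℝ} (hu : ∀ v ≤ 0, u v = 0) (v : ℝ) :
    |v * u v| ≤ |weight (-β) 1 v * u v| := by
  rcases le_or_gt v 0 with hv | hv
  · simp [hu v hv]
  · rw [abs_mul, abs_mul, abs_of_pos hv]
    gcongr
    exact (le_weight hv).trans (le_abs_self _)

theorem integrable_of_integrable_weight_mul (hβ : 0 < β) {u : ℝ → ℝ} (hm : Measurable u)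
    (hu : ∀ v ≤ 0, u v = 0) (hi : Integrable fun v => weight (-β) 1 v * u v) : Integrable u :=
  hi.mono hm.aestronglyMeasurable (Eventually.of_forall fun v => abs_le_abs_weight_mul hβ hu v)

/-- The difference of two solutions solves a linear transport equation with source. -/
theorem isTransportSolution_sub {N₂ : ℝ} {d₀ : ℝ → ℝ} {d d' : ℝ → ℝ → ℝ} (hβ : 0 < β)
    (hg : IsGrowthRate g A B)
    (hK' : IsDominatedKernel K' (weight (-β) 1) κ)
    (hKK : Function.uncurry K' =ᵐ[vol.prod vol] Function.uncurry K)
    (hc : IsWeakSolution K g β T c₀ c) (hd : IsWeakSolution K g β T d₀ d)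
    (hc' : IsDensityFamily T N (weight (-β) 1) c') (hcc : ∀ s ∈ Icc 0 T, c' s =ᵐ[vol] c s)
    (hd' : IsDensityFamily T N₂ (weight (-β) 1) d') (hdd : ∀ s ∈ Icc 0 T, d' s =ᵐ[vol] d s)
    (hpair : ∀ s ∈ Icc 0 T, IsCollisionPair (weight (-β) 1) (fun v => c' s v + d' s v)
      (fun v => c' s v - d' s v)) :
    IsTransportSolution T (extendGrowth g) (fun s v =>
      gain K' (fun v => c' s v + d' s v) (fun v => c' s v - d' s v) v
        - crossLoss K' (fun v => c' s v + d' s v) (fun v => c' s v - d' s v) v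
        - lossRate K' (fun v => c' s v + d' s v) v * (c' s v - d' s v))
      (fun s v => c' s v - d' s v) := by
  intro r hr φ hφ hφc hφs
  have hφ' : Continuous (deriv φ) := (contDiff_infty_iff_deriv.1 hφ).2.continuous
  obtain ⟨C, hC⟩ := hφc.exists_bound_of_continuous hφ.continuous
  obtain ⟨C', hC'⟩ := hφc.deriv.exists_bound_of_continuous hφ'
  have h0T : (0 : ℝ) ∈ Icc 0 T := ⟨le_rfl, hr.1.trans hr.2⟩
  have hi : ∀ {M : ℝ} {a : ℝ → ℝ → ℝ}, IsDensityFamily T M (weight (-β) 1) a → ∀ s ∈ Icc 0 T,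
      Integrable fun v => φ v * a s v := fun ha s hs =>
    (integrable_of_integrable_weight_mul hβ (ha.measurable.comp measurable_prodMk_left)
      (ha.eq_zero s) (ha.integrable s hs)).bdd_mul (c := C) hφ.continuous.aestronglyMeasurable
        (Eventually.of_forall hC)
  have e0 : ∀ s ∈ Icc 0 T, ∫ v, φ v * (c' s v - d' s v)
      = (∫ v, φ v * c' s v) - ∫ v, φ v * d' s v := fun s hs => by
    rw [← integral_sub (hi hc' s hs) (hi hd' s hs)]
    simp only [mul_sub]
  have t1 := hc'.intervalIntegrable_transport hg hφ'.measurable hC' hr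
  have t2 := hd'.intervalIntegrable_transport hg hφ'.measurable hC' hr
  have q1 := hc'.intervalIntegrable_collisionPairing hK' hφ.continuous.measurable hC hr
  have q2 := hd'.intervalIntegrable_collisionPairing hK' hφ.continuous.measurable hC hr
  have w1 := hc.weak_formulation_version hK' hKK hc' hcc hr hφ hφc
  have w2 := hd.weak_formulation_version hK' hKK hd' hdd hr hφ hφc
  have e1 : ∫ s in (0 : ℝ)..r, ((∫ v, deriv φ v * (extendGrowth g s v * (c' s v - d' s v)))
      + ∫ v, φ v * (gain K' (fun v => c' s v + d' s v) (fun v => c' s v - d' s v) v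
        - crossLoss K' (fun v => c' s v + d' s v) (fun v => c' s v - d' s v) v
        - lossRate K' (fun v => c' s v + d' s v) v * (c' s v - d' s v)))
      = ∫ s in (0 : ℝ)..r, (((∫ v, deriv φ v * (extendGrowth g s v * c' s v))
        - ∫ v, deriv φ v * (extendGrowth g s v * d' s v))
        + 1 / 2 * (collisionPairing K' φ (c' s) (c' s) - collisionPairing K' φ (d' s) (d' s))) := by
    refine intervalIntegral.integral_congr fun s hs => ?_
    rw [uIcc_of_le hr.1] at hs
    have hsT : s ∈ Icc 0 T := ⟨hs.1, hs.2.trans hr.2⟩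
    congr 1
    · have hb : ∀ {F : ℝ → ℝ}, Integrable F → Integrable fun v => deriv φ v * F v := fun hF =>
        hF.bdd_mul (c := C') hφ'.aestronglyMeasurable (Eventually.of_forall hC')
      rw [← integral_sub (hb (hc'.integrable_growth hg hsT).1)
        (hb (hd'.integrable_growth hg hsT).1)]
      simp only [mul_sub]
    -- The factor `2` of `integral_collision_eq` cancels the `1 / 2` of the weak formulation.
    · rw [← collisionPairing_sub hK' hc' hd' hsT hφ.continuous.measurable hC, collisionPairing,
        integral_collision_eq hK' (hpair s hsT) hφ.continuous.measurable hC]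
      ring
  rw [e0 r hr, e0 0 h0T, e1, intervalIntegral.integral_add (t1.sub t2) ((q1.sub q2).const_mul _),
    intervalIntegral.integral_sub t1 t2, intervalIntegral.integral_const_mul,
    intervalIntegral.integral_sub q1 q2, w1, w2]
  ring

end Normalized

theorem lintegral_enorm_le_of_integral_abs_le {F : ℝ → ℝ} (hF : Integrable F) {R : ℝ}
    (hR : ∫ v, |F v| ≤ R) : ∫⁻ v, ‖F v‖ₑ ≤ ENNReal.ofReal R := by
  rw [← ofReal_integral_norm_eq_lintegral_enorm hF]
  exact ENNReal.ofReal_le_ofReal hR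

/-! ### The stability estimate -/

section Stability
variable {K K' g : ℝ → ℝ → ℝ} {β T A B κ N₁ N₂ : ℝ} {c₀ d₀ : ℝ → ℝ} {c c' d d' : ℝ → ℝ → ℝ}

theorem IsDensityFamily.isCollisionPair_add_sub {w : ℝ → ℝ} (hc : IsDensityFamily T N₁ w c)
    (hd : IsDensityFamily T N₂ w d) {s : ℝ} (hs : s ∈ Icc 0 T) :
    IsCollisionPair w (fun v => c s v + d s v) (fun v => c s v - d s v) where
  measurable_left := (hc.measurable.comp measurable_prodMk_left).add
    (hd.measurable.comp measurable_prodMk_left)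
  measurable_right := (hc.measurable.comp measurable_prodMk_left).sub
    (hd.measurable.comp measurable_prodMk_left)
  nonneg v := add_nonneg (hc.nonneg s v) (hd.nonneg s v)
  left_eq_zero v hv := by rw [hc.eq_zero s v hv, hd.eq_zero s v hv, add_zero]
  right_eq_zero v hv := by rw [hc.eq_zero s v hv, hd.eq_zero s v hv, sub_zero]
  integrable_left := by
    simpa only [mul_add] using (hc.integrable s hs).fun_add (hd.integrable s hs)
  integrable_right := by
    refine ((hc.integrable s hs).sub (hd.integrable s hs)).congr (.of_forall fun v => ?_)
    simp only [Pi.sub_apply, mul_sub]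

theorem IsDensityFamily.moment_add_le {w : ℝ → ℝ} (hc : IsDensityFamily T N₁ w c)
    (hd : IsDensityFamily T N₂ w d) {s : ℝ} (hs : s ∈ Icc 0 T) :
    ∫ v, |w v * (c s v + d s v)| ≤ N₁ + N₂ ∧ ∫ v, |w v * (c s v - d s v)| ≤ N₁ + N₂ := by
  have h := hc.isCollisionPair_add_sub hd hs
  have hi := (hc.integrable s hs).abs.fun_add (hd.integrable s hs).abs
  have hle : (∫ v, (|w v * c s v| + |w v * d s v|)) ≤ N₁ + N₂ := by
    rw [integral_add (hc.integrable s hs).abs (hd.integrable s hs).abs]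
    exact add_le_add (hc.moment_le s hs) (hd.moment_le s hs)
  constructor
  · refine (integral_mono h.integrable_left.abs hi fun v => ?_).trans hle
    simp only [mul_add]
    exact abs_add_le _ _
  · refine (integral_mono h.integrable_right.abs hi fun v => ?_).trans hle
    simp only [mul_sub]
    exact abs_sub _ _

/-- The integral inequality for the distance of two solutions in the approximate norm. -/
theorem integral_approxWeight_sub_le (hβ : 0 < β) (hA : 0 ≤ A) (hB : 0 ≤ B)
    (hg : IsGrowthRate g A B) (hK' : IsDominatedKernel K' (weight (-β) 1) κ)
    (hKK : Function.uncurry K' =ᵐ[vol.prod vol] Function.uncurry K)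
    (hc : IsWeakSolution K g β T c₀ c) (hd : IsWeakSolution K g β T d₀ d)
    (hc' : IsDensityFamily T N₁ (weight (-β) 1) c') (hcc : ∀ s ∈ Icc 0 T, c' s =ᵐ[vol] c s)
    (hd' : IsDensityFamily T N₂ (weight (-β) 1) d') (hdd : ∀ s ∈ Icc 0 T, d' s =ᵐ[vol] d s)
    {m : ℝ} (hm : ∀ᵐ s ∂(volume.restrict (Ioc 0 T)),
      Integrable (fun v => weight (-β) 1 v ^ 2 * (c' s v + d' s v)) ∧
        ∫ v, weight (-β) 1 v ^ 2 * (c' s v + d' s v) ≤ m)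
    {t : ℝ} (ht : t ∈ Icc 0 T) {δ : ℝ} (hδ : 0 < δ) :
    ∫ v, approxWeight β δ v * |c' t v - d' t v| ∂vol
      ≤ (∫ v, |weight (-β) 1 v * (c' 0 v - d' 0 v)|)
        + (A + κ * m) * ∫ s in (0 : ℝ)..t, ∫ v, |weight (-β) 1 v * (c' s v - d' s v)| := by
  set w := weight (-β) 1 with hw
  set p : ℝ → ℝ → ℝ := fun s v => c' s v + d' s v with hp
  set u : ℝ → ℝ → ℝ := fun s v => c' s v - d' s v with hu
  set N : ℝ → ℝ := fun s => ∫ v, |w v * u s v| with hN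
  have hW := isTransportWeight_approxWeight hβ hδ
  have hpm : Measurable (Function.uncurry p) := hc'.measurable.add hd'.measurable
  have hum : Measurable (Function.uncurry u) := hc'.measurable.sub hd'.measurable
  have hu0 : ∀ s, ∀ v ≤ 0, u s v = 0 := fun s v hv => by
    simp only [hu]; rw [hc'.eq_zero s v hv, hd'.eq_zero s v hv, sub_zero]
  have hpair : ∀ s ∈ Icc 0 T, IsCollisionPair w (p s) (u s) := fun s hs =>
    hc'.isCollisionPair_add_sub hd' hs
  have hsT : ∀ s ∈ Icc 0 t, s ∈ Icc 0 T := fun s hs => ⟨hs.1, hs.2.trans ht.2⟩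
  -- This moment bound, coming from weak continuity, serves integrability only. The solutions enter
  -- the final constant solely through `m`.
  set R := N₁ + N₂ with hR
  have hlu : ∀ s ∈ Icc 0 T, ∫⁻ v, ‖w v * u s v‖ₑ ≤ ENNReal.ofReal R := fun s hs =>
    lintegral_enorm_le_of_integral_abs_le (hpair s hs).integrable_right
      (hc'.moment_add_le hd' hs).2
  have hlp : ∀ s ∈ Icc 0 T, ∫⁻ v, ‖w v * p s v‖ₑ ≤ ENNReal.ofReal R := fun s hs =>
    lintegral_enorm_le_of_integral_abs_le (hpair s hs).integrable_left
      (hc'.moment_add_le hd' hs).1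
  set M : ℝ≥0∞ := ENNReal.ofReal κ * (ENNReal.ofReal R * ENNReal.ofReal R) with hM
  have hMt : M ≠ ⊤ := ENNReal.mul_ne_top (by simp) (ENNReal.mul_ne_top (by simp) (by simp))
  have hbM : ∀ s ∈ Icc 0 t, ENNReal.ofReal κ * ((∫⁻ v, ‖w v * u s v‖ₑ) * ∫⁻ v, ‖w v * p s v‖ₑ)
      ≤ M := fun s hs => mul_le_mul' le_rfl (mul_le_mul' (hlu s (hsT s hs)) (hlp s (hsT s hs)))
  have hG1m := measurable_gain hK'.measurable hpm hum
  have hG2m := measurable_crossLoss hK'.measurable hpm hum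
  have hLm := measurable_lossRate hK'.measurable hpm
  set G : ℝ → ℝ → ℝ := fun s v => gain K' (p s) (u s) v - crossLoss K' (p s) (u s) v with hG
  set L : ℝ → ℝ → ℝ := fun s v => lossRate K' (p s) v with hL
  have hG1 := integrable_prod_of_lintegral_le hG1m hMt fun s hs =>
    (lintegral_gain_le hK' (hpair s (hsT s hs))).trans (hbM s hs)
  have hG2 := integrable_prod_of_lintegral_le hG2m hMt fun s hs =>
    (lintegral_crossLoss_le hK' (hpair s (hsT s hs))).trans (hbM s hs)
  have hLi := integrable_prod_of_lintegral_le (X := fun q => L q.1 q.2 * u q.1 q.2)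
    (hLm.mul hum) hMt fun s hs =>
    (lintegral_lossRate_mul_le hK' (hpair s (hsT s hs))).trans (hbM s hs)
  have hGi : Integrable (Function.uncurry G) ((volume.restrict (Ioc 0 t)).prod volume) :=
    hG1.sub hG2
  have hGm : Measurable (Function.uncurry G) := hG1m.sub hG2m
  have hui := integrable_prod_of_lintegral_le hum ENNReal.ofReal_ne_top fun s hs =>
    (lintegral_mono fun v => enorm_le_iff_norm_le.2 (abs_le_abs_weight_mul hβ (hu0 s) v)).trans
      (hlu s (hsT s hs))
  have hsol : IsTransportSolution t (extendGrowth g) (fun s v => G s v - L s v * u s v) u :=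
    fun r hr => isTransportSolution_sub hβ hg hK' hKK hc hd hc' hcc hd' hdd hpair r (hsT r hr)
  have hkato := kato_inequality ht.1 hg hA hB hW hum hGm hLm hu0 (N := R.toNNReal)
    (fun s hs => (lintegral_mono fun v =>
      enorm_le_iff_norm_le.2 (abs_le_abs_weight_mul hβ (hu0 s) v)).trans (hlu s (hsT s hs)))
    (fun s hs => (lintegral_mono fun v =>
      enorm_le_iff_norm_le.2 (abs_mul_le_abs_weight_mul (β := β) (hu0 s) v)).trans (hlu s (hsT s hs)))
    hGi hLi hsol
  have hle := prod_vol_le (volume.restrict (Ioc 0 t))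
  -- the single terms
  have hNle : ∀ s ∈ Icc 0 T, ∫ v, approxWeight β δ v * |u s v| ∂vol ≤ N s := fun s hs => by
    simp only [hN]
    rw [← integral_vol_eq fun v hv => by rw [hu0 s v hv, mul_zero, abs_zero]]
    refine integral_mono_of_nonneg ?_ (hpair s hs).integrable_right.abs.integrableOn ?_
    · filter_upwards [ae_restrict_mem measurableSet_Ioi] with v hv
      exact mul_nonneg (hW.pos v hv).le (abs_nonneg _)
    · filter_upwards [ae_restrict_mem measurableSet_Ioi] with v hv
      rw [abs_mul]
      gcongr
      exact (approxWeight_le_weight hβ hδ hv).trans (le_abs_self _)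
  have hNm : Measurable N := by
    have : Measurable fun q : ℝ × ℝ => |w q.2 * u q.1 q.2| :=
      (((measurable_weight (-β) 1).comp measurable_snd).mul hum).abs
    exact this.stronglyMeasurable.integral_prod_right.measurable
  have hNi : IntervalIntegrable N volume 0 t :=
    intervalIntegrable_of_bounded (R := R) hNm (fun s hs => by
      rw [abs_of_nonneg (integral_nonneg fun _ => abs_nonneg _)]
      exact (hc'.moment_add_le hd' hs).2) ht
  have hNi' : Integrable N (volume.restrict (Ioc 0 t)) :=
    (intervalIntegrable_iff_integrableOn_Ioc_of_le ht.1).1 hNi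
  have j1 := hW.integrable_prod_mul (hui.mono_measure hle).abs
  have j2 : Integrable (fun q : ℝ × ℝ => approxWeight β δ q.2 *
      (|G q.1 q.2| - L q.1 q.2 * |u q.1 q.2|)) ((volume.restrict (Ioc 0 t)).prod vol) := by
    refine hW.integrable_prod_mul ((hGi.mono_measure hle).abs.sub ?_)
    refine (hLi.mono_measure hle).mono (hLm.mul hum.abs).aestronglyMeasurable
      (Eventually.of_forall fun q => ?_)
    simp
  have h2 : ∫ q : ℝ × ℝ, approxWeight β δ q.2 * |u q.1 q.2| ∂((volume.restrict (Ioc 0 t)).prod vol)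
      ≤ ∫ s in Ioc 0 t, N s := by
    refine (integral_prod _ j1).le.trans (integral_mono_ae j1.integral_prod_left hNi' ?_)
    filter_upwards [ae_restrict_mem measurableSet_Ioc] with s hs
    exact hNle s ⟨hs.1.le, hs.2.trans ht.2⟩
  have h3 : ∫ q : ℝ × ℝ, approxWeight β δ q.2 * (|G q.1 q.2| - L q.1 q.2 * |u q.1 q.2|)
      ∂((volume.restrict (Ioc 0 t)).prod vol) ≤ ∫ s in Ioc 0 t, (κ * m) * N s := by
    rw [integral_prod _ j2]
    refine integral_mono_ae j2.integral_prod_left (hNi'.const_mul _) ?_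
    filter_upwards [ae_restrict_mem measurableSet_Ioc,
      ae_restrict_of_ae_restrict_of_subset (Ioc_subset_Ioc_right ht.2) hm] with s hs hms
    have h4 := integral_weight_coagulation_le hK' (hpair s ⟨hs.1.le, hs.2.trans ht.2⟩) hW
      (fun x hx y hy => approxWeight_add_le hβ hδ hx hy)
      (fun v hv => approxWeight_le_weight hβ hδ hv) hms.1
    refine h4.trans ?_
    have := hK'.const_nonneg
    have h5 : 0 ≤ N s := integral_nonneg fun _ => abs_nonneg _
    calc κ * (N s * ∫ v, w v ^ 2 * p s v) ≤ κ * (N s * m) := by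
          gcongr
          exact hms.2
      _ = κ * m * N s := by ring
  rw [integral_const_mul] at h3
  rw [intervalIntegral.integral_of_le ht.1]
  have h1 := hNle 0 ⟨le_rfl, ht.1.trans ht.2⟩
  have h6 := mul_le_mul_of_nonneg_left h2 hA
  simp only [hN] at h1 h3 h6
  linarith

/-- The stability estimate for the jointly measurable versions of two solutions. -/
theorem integral_weight_sub_le_exp (hβ : 0 < β) (hA : 0 ≤ A) (hB : 0 ≤ B)
    (hg : IsGrowthRate g A B) (hK' : IsDominatedKernel K' (weight (-β) 1) κ)
    (hKK : Function.uncurry K' =ᵐ[vol.prod vol] Function.uncurry K)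
    (hc : IsWeakSolution K g β T c₀ c) (hd : IsWeakSolution K g β T d₀ d)
    (hc' : IsDensityFamily T N₁ (weight (-β) 1) c') (hcc : ∀ s ∈ Icc 0 T, c' s =ᵐ[vol] c s)
    (hd' : IsDensityFamily T N₂ (weight (-β) 1) d') (hdd : ∀ s ∈ Icc 0 T, d' s =ᵐ[vol] d s)
    {m : ℝ} (hm0 : 0 ≤ m) (hm : ∀ᵐ s ∂(volume.restrict (Ioc 0 T)),
      Integrable (fun v => weight (-β) 1 v ^ 2 * (c' s v + d' s v)) ∧
        ∫ v, weight (-β) 1 v ^ 2 * (c' s v + d' s v) ≤ m)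
    {t : ℝ} (ht : t ∈ Icc 0 T) :
    ∫ v, |weight (-β) 1 v * (c' t v - d' t v)|
      ≤ (∫ v, |weight (-β) 1 v * (c' 0 v - d' 0 v)|) * Real.exp ((A + κ * m) * t) := by
  have hκ := hK'.const_nonneg
  refine le_mul_exp_of_le_add_integral
    (N := fun s => ∫ v, |weight (-β) 1 v * (c' s v - d' s v)|) (T := T) (R := N₁ + N₂)
    (integral_nonneg fun _ => abs_nonneg _) (by positivity) ?_ ?_
    (fun s _ => integral_nonneg fun _ => abs_nonneg _) (fun r hr => ?_) ht
  · have : Measurable fun q : ℝ × ℝ => |weight (-β) 1 q.2 * (c' q.1 q.2 - d' q.1 q.2)| :=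
      (((measurable_weight (-β) 1).comp measurable_snd).mul
        (hc'.measurable.sub hd'.measurable)).abs
    exact this.stronglyMeasurable.integral_prod_right.measurable
  · intro s hs
    rw [abs_of_nonneg (integral_nonneg fun _ => abs_nonneg _)]
    exact (hc'.moment_add_le hd' hs).2
  · have hpair := hc'.isCollisionPair_add_sub hd' hr
    set δ : ℕ → ℝ := fun n => ((n : ℝ) + 1)⁻¹ with hδ
    have hδ0 : ∀ n, 0 < δ n := fun n => by positivity
    have hlim0 : Tendsto δ atTop (𝓝 0) := by
      simpa [one_div] using tendsto_one_div_add_atTop_nhds_zero_nat (𝕜 := ℝ)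
    -- The collision bound involves the full weight `w`, so the inequality for fixed `δ` has the
    -- weaker norm on the left only and cannot be iterated. Its right-hand side is independent of
    -- `δ`, and `δ → 0` restores `w` on the left.
    have hlim : Tendsto (fun n => ∫ v, approxWeight β (δ n) v * |c' r v - d' r v| ∂vol) atTop
        (𝓝 (∫ v, |weight (-β) 1 v * (c' r v - d' r v)| ∂vol)) := by
      refine tendsto_integral_of_dominated_convergence
        (fun v => |weight (-β) 1 v * (c' r v - d' r v)|) (fun n => ?_)
        hpair.integrable_right.abs.integrableOn (fun n => ?_) ?_
      · exact ((isTransportWeight_approxWeight hβ (hδ0 n)).measurable.mul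
          hpair.measurable_right.abs).aestronglyMeasurable
      · filter_upwards [ae_restrict_mem measurableSet_Ioi] with v hv
        have h1 := (isTransportWeight_approxWeight hβ (hδ0 n)).pos v hv
        rw [Real.norm_of_nonneg (mul_nonneg h1.le (abs_nonneg _)), abs_mul]
        gcongr
        exact (approxWeight_le_weight hβ (hδ0 n) hv).trans (le_abs_self _)
      · filter_upwards [ae_restrict_mem measurableSet_Ioi] with v hv
        rw [abs_mul, abs_of_nonneg (weight_nonneg (le_of_lt hv))]
        exact (tendsto_approxWeight hv hlim0).mul_const _
    rw [integral_vol_eq fun v hv => by rw [hpair.right_eq_zero v hv, mul_zero, abs_zero]] at hlim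
    exact le_of_tendsto' hlim fun n => integral_approxWeight_sub_le hβ hA hB hg hK' hKK hc hd
      hc' hcc hd' hdd hm hr (hδ0 n)

/-- A bound in `L^∞(0,T; L¹_{m,r})` passes to the jointly measurable version. -/
theorem ae_moment_le_of_linftyNorm_le {m r : ℝ} {M : ℝ≥0} (hM : linftyNorm T m r c ≤ M)
    (hcc : ∀ s ∈ Icc 0 T, c' s =ᵐ[vol] c s)
    (hcz : ∀ s, ∀ v ≤ 0, c' s v = 0) (hcm : Measurable (Function.uncurry c')) :
    ∀ᵐ s ∂(volume.restrict (Ioc 0 T)), Integrable (fun v => weight m r v * c' s v) ∧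
      ∫ v, weight m r v * c' s v ≤ M := by
  have h1 : ∀ᵐ s ∂(volume.restrict (Ioc 0 T)), weightedNorm m r (c s) ≤ M := by
    rw [Measure.restrict_congr_set Ioo_ae_eq_Ioc.symm]
    exact (ENNReal.ae_le_essSup _).mono fun s hs => hs.trans hM
  filter_upwards [h1, ae_restrict_mem measurableSet_Ioc] with s hs hsT
  have hm : Measurable fun v => weight m r v * c' s v :=
    (measurable_weight m r).mul (hcm.comp measurable_prodMk_left)
  have h2 : ∫⁻ v, ‖weight m r v * c' s v‖ₑ ≤ M := by
    rw [← lintegral_vol_eq fun v hv => by rw [hcz s v hv, mul_zero, enorm_zero]]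
    refine le_trans (le_of_eq (lintegral_congr_ae ?_)) hs
    filter_upwards [hcc s (Ioc_subset_Icc_self hsT)] with v hv
    rw [hv]
  have hi : Integrable fun v => weight m r v * c' s v :=
    ⟨hm.aestronglyMeasurable, h2.trans_lt (by simp)⟩
  refine ⟨hi, ?_⟩
  rw [← ofReal_integral_norm_eq_lintegral_enorm hi, ENNReal.ofReal_le_iff_le_toReal (by simp)] at h2
  refine le_trans (integral_mono hi hi.norm fun v => le_abs_self _) h2

theorem weightedNorm_eq_ofReal {m r : ℝ} {u u' : ℝ → ℝ} (hu : u' =ᵐ[vol] u)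
    (hz : ∀ v ≤ 0, u' v = 0) (hi : Integrable fun v => weight m r v * u' v) :
    weightedNorm m r u = ENNReal.ofReal (∫ v, |weight m r v * u' v|) := by
  rw [weightedNorm, ← lintegral_congr_ae (f := fun v => ‖weight m r v * u' v‖ₑ)
    (hu.mono fun v hv => by simp only [hv]),
    lintegral_vol_eq fun v hv => by rw [hz v hv, mul_zero, enorm_zero],
    ← ofReal_integral_norm_eq_lintegral_enorm hi]
  rfl

end Stability

end GrowthCoag

/-! ### The stability theorem -/

open GrowthCoag in
theorem proposition5p1 (k A T : ℝ) (hk : 0 < k) (hA : 0 < A) (hT : 0 < T) (M₁ M₂ : ℝ≥0) :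
    ∃ C : ℝ≥0, 0 < C ∧
      ∀ (β B : ℝ) (K g : ℝ → ℝ → ℝ) (c₁₀ c₂₀ : ℝ → ℝ) (c₁ c₂ : ℝ → ℝ → ℝ),
        0 < β → 0 < B →
        GrowthCoag.IsCoagulationKernel K β k →
        GrowthCoag.IsGrowthRate g A B →
        (∀ᵐ v ∂GrowthCoag.vol, 0 ≤ c₁₀ v) → GrowthCoag.MemWeightedL1 (-2 * β) 2 c₁₀ →
        (∀ᵐ v ∂GrowthCoag.vol, 0 ≤ c₂₀ v) → GrowthCoag.MemWeightedL1 (-2 * β) 2 c₂₀ →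
        GrowthCoag.IsWeakSolution K g β T c₁₀ c₁ →
        GrowthCoag.IsWeakSolution K g β T c₂₀ c₂ →
        GrowthCoag.linftyNorm T (-2 * β) 2 c₁ ≤ M₁ →
        GrowthCoag.linftyNorm T (-2 * β) 2 c₂ ≤ M₂ →
        ∀ t ∈ Icc 0 T,
          GrowthCoag.weightedNorm (-β) 1 (fun v => c₁ t v - c₂ t v) ≤
            C * GrowthCoag.weightedNorm (-β) 1 (fun v => c₁₀ v - c₂₀ v) := by
  -- `m` bounds `∫ w² (c₁ + c₂)`, with the factor `2` from `weight_sq_le`. In the rate `l`, the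
  -- summand `A` comes from transport and `2 * k` from the kernel bound; neither `β` nor `B` occurs,
  -- so the constant can be fixed before them.
  set m : ℝ := 2 * ((M₁ : ℝ) + M₂) with hm
  set l : ℝ := A + 2 * k * m with hl
  have hm0 : 0 ≤ m := by positivity
  have hl0 : 0 ≤ l := by positivity
  refine ⟨(Real.exp (l * T)).toNNReal, Real.toNNReal_pos.2 (Real.exp_pos _), ?_⟩
  intro β B K g c₁₀ c₂₀ c₁ c₂ hβ hB hK hg _ hc₁₀ _ hc₂₀ hc₁ hc₂ hM₁ hM₂ t ht
  obtain ⟨K', hK', hKK⟩ := hK.exists_dominated hk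
  obtain ⟨c', ⟨N₁, hc'⟩, hcc⟩ := hc₁.exists_densityFamily hT.le hβ
  obtain ⟨d', ⟨N₂, hd'⟩, hdd⟩ := hc₂.exists_densityFamily hT.le hβ
  have hmom : ∀ᵐ s ∂(volume.restrict (Ioc 0 T)),
      Integrable (fun v => weight (-β) 1 v ^ 2 * (c' s v + d' s v)) ∧
        ∫ v, weight (-β) 1 v ^ 2 * (c' s v + d' s v) ≤ m := by
    filter_upwards [ae_moment_le_of_linftyNorm_le hM₁ hcc hc'.eq_zero hc'.measurable,
      ae_moment_le_of_linftyNorm_le hM₂ hdd hd'.eq_zero hd'.measurable] with s h1 h2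
    have hdom : Integrable fun v => 2 * (weight (-2 * β) 2 v * c' s v
        + weight (-2 * β) 2 v * d' s v) := (h1.1.fun_add h2.1).const_mul 2
    have hle : ∀ v, weight (-β) 1 v ^ 2 * (c' s v + d' s v)
        ≤ 2 * (weight (-2 * β) 2 v * c' s v + weight (-2 * β) 2 v * d' s v) := fun v => by
      rcases le_or_gt v 0 with hv | hv
      · simp [hc'.eq_zero s v hv, hd'.eq_zero s v hv]
      · have := mul_le_mul_of_nonneg_right (weight_sq_le (β := β) hv)
          (add_nonneg (hc'.nonneg s v) (hd'.nonneg s v))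
        linarith
    have hint : Integrable fun v => weight (-β) 1 v ^ 2 * (c' s v + d' s v) := by
      refine hdom.mono' (((measurable_weight (-β) 1).pow_const 2).mul
        ((hc'.measurable.comp measurable_prodMk_left).add
          (hd'.measurable.comp measurable_prodMk_left))).aestronglyMeasurable
        (Filter.Eventually.of_forall fun v => ?_)
      rw [Real.norm_of_nonneg (mul_nonneg (sq_nonneg _)
        (add_nonneg (hc'.nonneg s v) (hd'.nonneg s v)))]
      exact hle v
    refine ⟨hint, (integral_mono hint hdom hle).trans ?_⟩
    rw [integral_const_mul, integral_add h1.1 h2.1, hm]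
    linarith [h1.2, h2.2]
  have h0T : (0 : ℝ) ∈ Icc 0 T := ⟨le_rfl, hT.le⟩
  have hpt := hc'.isCollisionPair_add_sub hd' ht
  have hp0 := hc'.isCollisionPair_add_sub hd' h0T
  have e1 := weightedNorm_eq_ofReal (u := fun v => c₁ t v - c₂ t v)
    ((hcc t ht).sub (hdd t ht)) hpt.right_eq_zero hpt.integrable_right
  have hβ2 : -2 * β ≤ 0 := by linarith
  -- The prescribed data agree a.e. with the solutions at time `0`, so the initial value in the
  -- Gronwall estimate is the norm of `c₁₀ - c₂₀`.
  have e2 := weightedNorm_eq_ofReal (u := fun v => c₁₀ v - c₂₀ v)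
    (((hcc 0 h0T).trans (hc₁.initial_ae_eq hβ2 zero_le_two hT.le hβ hc₁₀)).sub
      ((hdd 0 h0T).trans (hc₂.initial_ae_eq hβ2 zero_le_two hT.le hβ hc₂₀)))
    hp0.right_eq_zero hp0.integrable_right
  rw [e1, e2, ENNReal.ofNNReal_toNNReal, ← ENNReal.ofReal_mul (Real.exp_pos _).le]
  refine ENNReal.ofReal_le_ofReal ?_
  have hmain := integral_weight_sub_le_exp hβ hA.le hB.le hg hK' hKK hc₁ hc₂ hc' hcc hd' hdd hm0
    hmom ht
  refine hmain.trans ?_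
  rw [mul_comm]
  refine mul_le_mul_of_nonneg_right (Real.exp_le_exp.2 ?_) (integral_nonneg fun _ => abs_nonneg _)
  exact mul_le_mul_of_nonneg_left ht.2 hl0
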